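/- Let $M^6$ be a smooth $6$-manifold with an $\mathrm{SU}(3)$-structure $(\omega,\psi_+,\psi_-)$, i.e. smooth forms such that near every point there is a coframe $e^1,\dots,e^6$ with $\omega=e^{12}+e^{34}+e^{56}$, $\psi_+=e^{135}-e^{146}-e^{236}-e^{245}$, $\psi_-=-e^{246}+e^{235}+e^{145}+e^{136}$. Its torsion forms are the functions $\pi_0,\sigma_0$, the $1$-forms $\pi_1,\nu_1$, the $2$-forms $\pi_2,\sigma_2\in\Omega^2_8=\{\sigma:\sigma\wedge\psi_+=0,\ \sigma\wedge\omega^2=0\}$ and the $3$-form $\nu_3\in\Omega^3_{12}=\{\gamma:\gamma\wedge\omega=0,\ \gamma\wedge\psi_\pm=0\}$ with $$d\omega=-\tfrac32\sigma_0\psi_++\tfrac32\pi_0\psi_-+\nu_1\wedge\omega+\nu_3,\quad d\psi_+=\pi_0\omega^2+\pi_1\wedge\psi_+-\pi_2\wedge\omega,\quad d\psi_-=\sigma_0\omega^2+\pi_1\wedge\psi_--\sigma_2\wedge\omega .$$ Let $f\in C^\infty(M^6)$ be nowhere zero, let $\alpha,\beta\in\mathbb R$ with $\alpha^2+\beta^2=1$,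 and let $s$ be the angular coordinate on $S^1$. Consider on $M^6\times S^1$ the warped $\mathrm{G}_2$-structure $$\varphi=f\,\omega\wedge ds+\alpha\psi_+-\beta\psi_- .$$ Let $\ast_7$ be the Hodge star of the metric and orientation induced by $\varphi$ (the coframes with $\varphi=e^{127}+e^{347}+e^{567}+e^{135}-e^{146}-e^{236}-e^{245}$ are orthonormal and positively oriented), and let $$\tau_0=\tfrac17\ast_7(d\varphi\wedge\varphi),\quad \tau_1=-\tfrac1{12}\ast_7(\ast_7d\varphi\wedge\varphi),\quad \tau_2=-\ast_7d\ast_7\varphi+4\ast_7(\tau_1\wedge\ast_7\varphi),\quad \tau_3=\ast_7d\varphi-\tau_0\varphi-3\ast_7(\tau_1\wedge\varphi)$$ be the torsion forms of $\varphi$. Put $\eta_1=\frac1f df+\pi_1+\nu_1$, $\eta_2=\frac1f df+\pi_1-2\nu_1$, $\eta_3=\frac1f df-\pi_1+\nu_1$. Then: - $\tau_0=0$ iff $\alpha\pi_0-\beta\sigma_0=0$. - $\tau_1=0$ iff $\alpha\sigma_0+\beta\pi_0=0$ and $\eta_1=0$. - $\tau_2=0$ iff $\eta_2=0$ and $\alpha\sigma_2+\beta\pi_2=0$.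 - $\tau_3=0$ iff $\alpha\pi_0-\beta\sigma_0=0$, $\eta_3=0$, $\alpha\pi_2-\beta\sigma_2=0$ and $\nu_3=0$. Say that the $\mathrm{SU}(3)$-structure is in a sum of the classes $\mathcal W_1^\pm,\mathcal W_2^\pm,\mathcal W_3,\mathcal W_4,\mathcal W_5$, with respective components $(\pi_0,\sigma_0),(\pi_2,\sigma_2),\nu_3,\nu_1,\pi_1$, if all components belonging to the other classes vanish; and that $\varphi$ is in a sum of the classes $\mathcal X_1,\mathcal X_2,\mathcal X_3,\mathcal X_4$, with respective components $\tau_0,\tau_2,\tau_3,\tau_1$, if all components belonging to the other classes vanish. As a consequence: - $\varphi$ is parallel ($\tau_0=\tau_1=\tau_2=\tau_3=0$) iff the $\mathrm{SU}(3)$-structure is in the class $\{0\}$ (all its torsion forms vanish) and $df=0$. - $\varphi$ is in $\mathcal X_2$ (closed) iff the $\mathrm{SU}(3)$-structure is in $\mathcal W_2^\pm\oplus\mathcal W_4$, $\alpha\pi_2-\beta\sigma_2=0$ and $\frac1f df=-\nu_1$. - $\varphi$ is in $\mathcal X_3$ (coclosed of pure type) iff the $\mathrm{SU}(3)$-structure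 is in $\mathcal W_2^\pm\oplus\mathcal W_3\oplus\mathcal W_5$, $\alpha\sigma_2+\beta\pi_2=0$ and $\frac1f df=-\pi_1$. - $\varphi$ is in $\mathcal X_4$ (locally conformal parallel) iff the $\mathrm{SU}(3)$-structure is in $\mathcal W_1^\pm\oplus\mathcal W_4\oplus\mathcal W_5$, $\alpha\pi_0-\beta\sigma_0=0$ and $\frac1f df=\frac12\nu_1=\frac13\pi_1$. - $\varphi$ is in $\mathcal X_1\oplus\mathcal X_3$ (coclosed) iff the $\mathrm{SU}(3)$-structure is in $\mathcal W_1^\pm\oplus\mathcal W_2^\pm\oplus\mathcal W_3\oplus\mathcal W_5$, $\alpha\sigma_0+\beta\pi_0=0$, $\alpha\sigma_2+\beta\pi_2=0$ and $\frac1f df=-\pi_1$. -/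

import Mathlib

open scoped Manifold ContDiff

namespace WarpedG2

noncomputable section

/-! ## Exterior algebra of one real vector space

An alternating `k`-form on `V` is a Mathlib continuous alternating map `V [⋀^Fin k]→L[ℝ] ℝ`. -/

section Pointwise

variable {V : Type*} [AddCommGroup V] [Module ℝ V] [TopologicalSpace V]

/-- The wedge product of a `k`-form and an `l`-form: the sum over `(k, l)`-shuffles
`∑ sign σ • a (v_{σ 1}, …, v_{σ k}) * b (v_{σ (k+1)}, …, v_{σ (k+l)})`,
that is, Mathlib's `AlternatingMap.domCoprod` followed by the multiplication of `ℝ`. -/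
def wedge {k l : ℕ} (a : V [⋀^Fin k]→L[ℝ] ℝ) (b : V [⋀^Fin l]→L[ℝ] ℝ) :
    V [⋀^Fin (k + l)]→L[ℝ] ℝ :=
  { ((LinearMap.mul' ℝ ℝ).compAlternatingMap
      (a.toAlternatingMap.domCoprod b.toAlternatingMap)).domDomCongr finSumFinEquiv with
    cont := by
      have h : ∀ σ : Equiv.Perm.ModSumCongr (Fin k) (Fin l), Continuous fun v : Fin k ⊕ Fin l → V =>
          LinearMap.mul' ℝ ℝ
            (AlternatingMap.domCoprod.summand a.toAlternatingMap b.toAlternatingMap σ v) := by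
        intro σ
        induction σ using Quotient.inductionOn' with
        | h σ =>
          have ha : Continuous fun v : Fin k ⊕ Fin l → V => a fun i => v (σ (Sum.inl i)) :=
            a.cont.comp (continuous_pi fun i => continuous_apply _)
          have hb : Continuous fun v : Fin k ⊕ Fin l → V => b fun i => v (σ (Sum.inr i)) :=
            b.cont.comp (continuous_pi fun i => continuous_apply _)
          have hab := (ha.mul hb).const_smul (Equiv.Perm.sign σ)
          refine hab.congr fun v => ?_
          rw [AlternatingMap.domCoprod.summand_mk'', smul_apply, Units.smul_def,
            Units.smul_def, map_zsmul]
          rfl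
      have h2 := (continuous_finsetSum Finset.univ fun σ _ => h σ).comp
        (continuous_pi fun i : Fin k ⊕ Fin l =>
          continuous_apply (A := fun _ : Fin (k + l) => V) (finSumFinEquiv i))
      refine h2.congr fun v => ?_
      simp [AlternatingMap.domCoprod_apply, Function.comp_def] }

/-- A continuous linear functional as a `1`-form. -/
def oneForm (L : V →L[ℝ] ℝ) : V [⋀^Fin 1]→L[ℝ] ℝ :=
  ContinuousAlternatingMap.ofSubsingleton ℝ V ℝ (0 : Fin 1) L

/-- A linear isomorphism `u : V ≃ ℝⁿ` is regarded as a frame of `V`: its coframe is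
`e^i = u(·)_i`, and the dual basis of `V` is `e_i = u⁻¹ (Pi.single i 1)`.
`coframe u i` is the functional `e^i` (indices start at `0`). -/
def coframe {n : ℕ} (u : V ≃L[ℝ] (Fin n → ℝ)) (i : Fin n) : V →L[ℝ] ℝ :=
  (ContinuousLinearMap.proj i).comp (u : V →L[ℝ] (Fin n → ℝ))

/-- The `k`-form `e^{i_1} ∧ ⋯ ∧ e^{i_k}` of the coframe of `u`, that is
`(v_1, …, v_k) ↦ det (e^{i_a} (v_b))`, as the alternatization of `∏ e^{i_a} (v_a)`. -/
def elem {n k : ℕ} (u : V ≃L[ℝ] (Fin n → ℝ)) (i : Fin k → Fin n) : V [⋀^Fin k]→L[ℝ] ℝ :=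
  ContinuousMultilinearMap.alternatization
    ((ContinuousMultilinearMap.mkPiAlgebra ℝ (Fin k) ℝ).compContinuousLinearMap
      fun a => coframe u (i a))

/-- The Hodge star `Λ^k V* → Λ^l V*`, `k + l = n`, of the metric and the orientation for which the
basis `e_1, …, e_n` of the frame `u` is orthonormal and positively oriented:
`* β = (1 / (k! l!)) ∑_{σ ∈ S_n} sign σ • β (e_{σ 1}, …, e_{σ k}) • e^{σ (k+1)} ∧ ⋯ ∧ e^{σ n}`.
It is characterized by `a ∧ * b = ⟨a, b⟩ e^1 ∧ ⋯ ∧ e^n`. -/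
def frameStar {n k l : ℕ} (h : k + l = n) (u : V ≃L[ℝ] (Fin n → ℝ))
    (β : V [⋀^Fin k]→L[ℝ] ℝ) : V [⋀^Fin l]→L[ℝ] ℝ :=
  ((k.factorial * l.factorial : ℝ))⁻¹ • ∑ σ : Equiv.Perm (Fin n),
    (((Equiv.Perm.sign σ : ℤ) : ℝ) *
      β fun a => u.symm (Pi.single (σ (Fin.cast h (Fin.castAdd l a))) 1)) •
        elem u fun c => σ (Fin.cast h (Fin.natAdd k c))

/-- The frame `u` is adapted to the triple `(ω, ψ₊, ψ₋)` (`om, ψp, ψm` in the code):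
`ω = e^{12} + e^{34} + e^{56}`, `ψ₊ = e^{135} - e^{146} - e^{236} - e^{245}`,
`ψ₋ = - e^{246} + e^{235} + e^{145} + e^{136}`. -/
structure IsSU3Frame (om : V [⋀^Fin 2]→L[ℝ] ℝ) (ψp ψm : V [⋀^Fin 3]→L[ℝ] ℝ)
    (u : V ≃L[ℝ] (Fin 6 → ℝ)) : Prop where
  omega_eq : om = elem u ![0, 1] + elem u ![2, 3] + elem u ![4, 5]
  psiPlus_eq : ψp = elem u ![0, 2, 4] - elem u ![0, 3, 5] - elem u ![1, 2, 5] - elem u ![1, 3, 4]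
  psiMinus_eq : ψm =
    - elem u ![1, 3, 5] + elem u ![1, 2, 4] + elem u ![0, 3, 4] + elem u ![0, 2, 5]

/-- The frame `u` is adapted to the `3`-form `φ`:
`φ = e^{127} + e^{347} + e^{567} + e^{135} - e^{146} - e^{236} - e^{245}`. -/
def IsG2Frame (φ : V [⋀^Fin 3]→L[ℝ] ℝ) (u : V ≃L[ℝ] (Fin 7 → ℝ)) : Prop :=
  φ = elem u ![0, 1, 6] + elem u ![2, 3, 6] + elem u ![4, 5, 6]
    + elem u ![0, 2, 4] - elem u ![0, 3, 5] - elem u ![1, 2, 5] - elem u ![1, 3, 4]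

open Classical in
/-- The Hodge star of the metric and orientation induced by a `G₂`-form `φ` on `V`, for which the
adapted frames are orthonormal and positively oriented. It does not depend on the adapted frame,
because two of them differ by an element of `G₂ ⊆ SO(7)`. (The value is `0` if `φ` is not a
`G₂`-form.) -/
def g2StarAt (φ : V [⋀^Fin 3]→L[ℝ] ℝ) {k l : ℕ} (h : k + l = 7) (β : V [⋀^Fin k]→L[ℝ] ℝ) :
    V [⋀^Fin l]→L[ℝ] ℝ :=
  if hu : ∃ u : V ≃L[ℝ] (Fin 7 → ℝ), IsG2Frame φ u then frameStar h hu.choose β else 0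

end Pointwise

/-! ## Differential forms on a manifold (without boundary) -/

section Forms

variable {E : Type*} [NormedAddCommGroup E] [NormedSpace ℝ E] {H : Type*} [TopologicalSpace H]
  (I : ModelWithCorners ℝ E H) {M : Type*} [TopologicalSpace M] [ChartedSpace H M]

variable (M) in
/-- A (not necessarily smooth) differential `k`-form on `M`. -/
abbrev Form (k : ℕ) : Type _ := ∀ x : M, TangentSpace I x [⋀^Fin k]→L[ℝ] ℝ

variable {I}

/-- The coordinate expression `(κ⁻¹)^* β` of the form `β` in the chart `κ` around `x₀`. -/
def Form.inChart {k : ℕ} (β : Form I M k) (x₀ : M) : E → E [⋀^Fin k]→L[ℝ] ℝ := fun y =>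
  (β ((extChartAt I x₀).symm y)).compContinuousLinearMap
    (mfderiv 𝓘(ℝ, E) I (extChartAt I x₀).symm y)

/-- A form is smooth if all its coordinate expressions are. -/
def Form.IsSmooth {k : ℕ} (β : Form I M k) : Prop :=
  ∀ x₀ : M, ContDiffOn ℝ ∞ (β.inChart x₀) (extChartAt I x₀).target

/-- The exterior derivative `dβ = κ^* d ((κ⁻¹)^* β)`, at the point `x` computed in the chart `κ`
around `x`. -/
def Form.d {k : ℕ} (β : Form I M k) : Form I M (k + 1) := fun x =>
  (extDeriv (β.inChart x) (extChartAt I x x)).compContinuousLinearMap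
    (mfderiv I 𝓘(ℝ, E) (extChartAt I x) x)

/-- The wedge product of differential forms. -/
def Form.wedge {k l : ℕ} (β : Form I M k) (γ : Form I M l) : Form I M (k + l) := fun x =>
  WarpedG2.wedge (β x) (γ x)

/-- The product of a function and a form. -/
def Form.mulFun {k : ℕ} (f : M → ℝ) (β : Form I M k) : Form I M k := fun x => f x • β x

variable (I) in
/-- The differential of a function, as a `1`-form. -/
def dFun (f : M → ℝ) : Form I M 1 := fun x => oneForm (mfderiv I 𝓘(ℝ, ℝ) f x)

/-- The pullback `F^* β` of a form by a map. -/
def Form.pullback {E' : Type*} [NormedAddCommGroup E'] [NormedSpace ℝ E'] {H' : Type*}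
    [TopologicalSpace H'] {I' : ModelWithCorners ℝ E' H'} {M' : Type*} [TopologicalSpace M']
    [ChartedSpace H' M'] {k : ℕ} (F : M' → M) (β : Form I M k) : Form I' M' k := fun x =>
  (β (F x)).compContinuousLinearMap (mfderiv I' I F x)

end Forms

local infixr:70 " ⋏ " => Form.wedge
local infixr:73 " ⊙ " => Form.mulFun

/-! ## `SU(3)`-structures on `6`-manifolds and their torsion forms -/

section SU3

variable {M : Type*} [TopologicalSpace M] [ChartedSpace (EuclideanSpace ℝ (Fin 6)) M]

/-- `(ω, ψ₊, ψ₋)` is an `SU(3)`-structure: the forms are smooth and every tangent space has an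
adapted frame. -/
structure IsSU3Structure (om : Form (𝓡 6) M 2) (ψp ψm : Form (𝓡 6) M 3) : Prop where
  smooth_omega : om.IsSmooth
  smooth_psiPlus : ψp.IsSmooth
  smooth_psiMinus : ψm.IsSmooth
  exists_frame : ∀ x : M, ∃ u : TangentSpace (𝓡 6) x ≃L[ℝ] (Fin 6 → ℝ),
    IsSU3Frame (om x) (ψp x) (ψm x) u

/-- `σ ∈ Ω²₈`: the smooth `2`-form `σ` satisfies `σ ∧ ψ₊ = 0` and `σ ∧ ω² = 0`, i.e. it is a
primitive form of type `(1, 1)`. -/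
structure MemOmega28 (om : Form (𝓡 6) M 2) (ψp : Form (𝓡 6) M 3) (σ : Form (𝓡 6) M 2) : Prop where
  smooth : σ.IsSmooth
  wedge_psiPlus : σ ⋏ ψp = 0
  wedge_omega_sq : σ ⋏ (om ⋏ om) = 0

/-- `γ ∈ Ω³₁₂`: the smooth `3`-form `γ` satisfies `γ ∧ ω = 0` and `γ ∧ ψ₊ = γ ∧ ψ₋ = 0`. -/
structure MemOmega312 (om : Form (𝓡 6) M 2) (ψp ψm γ : Form (𝓡 6) M 3) : Prop where
  smooth : γ.IsSmooth
  wedge_omega : γ ⋏ om = 0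
  wedge_psiPlus : γ ⋏ ψp = 0
  wedge_psiMinus : γ ⋏ ψm = 0

variable (M) in
/-- A tuple of forms of the degrees of the torsion forms of an `SU(3)`-structure. -/
structure SU3Forms where
  /-- the function `π₀` -/
  π₀ : M → ℝ
  /-- the function `σ₀` -/
  σ₀ : M → ℝ
  /-- the `1`-form `π₁` -/
  π₁ : Form (𝓡 6) M 1
  /-- the `1`-form `ν₁` -/
  ν₁ : Form (𝓡 6) M 1
  /-- the `2`-form `π₂` -/
  π₂ : Form (𝓡 6) M 2
  /-- the `2`-form `σ₂` -/
  σ₂ : Form (𝓡 6) M 2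
  /-- the `3`-form `ν₃` -/
  ν₃ : Form (𝓡 6) M 3

/-- The tuple `T` consists of the torsion forms of the `SU(3)`-structure `(ω, ψ₊, ψ₋)`:
`dω = - (3/2) σ₀ ψ₊ + (3/2) π₀ ψ₋ + ν₁ ∧ ω + ν₃`, `dψ₊ = π₀ ω² + π₁ ∧ ψ₊ - π₂ ∧ ω`,
`dψ₋ = σ₀ ω² + π₁ ∧ ψ₋ - σ₂ ∧ ω`, where `π₂, σ₂ ∈ Ω²₈` and `ν₃ ∈ Ω³₁₂`. -/
structure IsSU3Torsion (om : Form (𝓡 6) M 2) (ψp ψm : Form (𝓡 6) M 3) (T : SU3Forms M) : Prop where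
  smooth_pi0 : ContMDiff (𝓡 6) 𝓘(ℝ, ℝ) ∞ T.π₀
  smooth_sigma0 : ContMDiff (𝓡 6) 𝓘(ℝ, ℝ) ∞ T.σ₀
  smooth_pi1 : T.π₁.IsSmooth
  smooth_nu1 : T.ν₁.IsSmooth
  mem_pi2 : MemOmega28 om ψp T.π₂
  mem_sigma2 : MemOmega28 om ψp T.σ₂
  mem_nu3 : MemOmega312 om ψp ψm T.ν₃
  d_omega : om.d =
    (-(3 / 2) : ℝ) • (T.σ₀ ⊙ ψp) + (3 / 2 : ℝ) • (T.π₀ ⊙ ψm) + T.ν₁ ⋏ om + T.ν₃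
  d_psiPlus : ψp.d = T.π₀ ⊙ (om ⋏ om) + T.π₁ ⋏ ψp - T.π₂ ⋏ om
  d_psiMinus : ψm.d = T.σ₀ ⊙ (om ⋏ om) + T.π₁ ⋏ ψm - T.σ₂ ⋏ om

/-- The torsion lies in `⨁_{i ∈ S} 𝓦_i` (`S ⊆ {1, …, 5}`), where the component in `𝓦₁^±` is
`(π₀, σ₀)`, in `𝓦₂^±` it is `(π₂, σ₂)`, in `𝓦₃` it is `ν₃`, in `𝓦₄` it is `ν₁`, and in `𝓦₅` it
is `π₁`: all components outside `S` vanish. -/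
structure SU3Forms.InClass (T : SU3Forms M) (S : Set ℕ) : Prop where
  w1 : 1 ∉ S → T.π₀ = 0 ∧ T.σ₀ = 0
  w2 : 2 ∉ S → T.π₂ = 0 ∧ T.σ₂ = 0
  w3 : 3 ∉ S → T.ν₃ = 0
  w4 : 4 ∉ S → T.ν₁ = 0
  w5 : 5 ∉ S → T.π₁ = 0

end SU3

/-! ## Torsion forms of a `G₂`-form on a `7`-manifold -/

section G2

variable {E : Type*} [NormedAddCommGroup E] [NormedSpace ℝ E] {H : Type*} [TopologicalSpace H]
  {I : ModelWithCorners ℝ E H} {N : Type*} [TopologicalSpace N] [ChartedSpace H N]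

/-- The Hodge star `*₇ : Ω^k → Ω^l`, `k + l = 7`, of the metric and orientation induced by `φ`. -/
def g2Star (φ : Form I N 3) {k l : ℕ} (h : k + l = 7) (β : Form I N k) : Form I N l := fun p =>
  g2StarAt (φ p) h (β p)

/-- `τ₀ = (1/7) *₇ (dφ ∧ φ)`; the value of a `0`-form at a point is a number. -/
def τ₀ (φ : Form I N 3) : N → ℝ := fun p =>
  (1 / 7 : ℝ) * g2Star φ (k := 4 + 3) (l := 0) rfl (φ.d ⋏ φ) p ![]

/-- `τ₁ = - (1/12) *₇ (*₇ dφ ∧ φ)`. -/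
def τ₁ (φ : Form I N 3) : Form I N 1 :=
  (-(1 / 12) : ℝ) • g2Star φ (k := 3 + 3) (l := 1) rfl
    (g2Star φ (k := 4) (l := 3) rfl φ.d ⋏ φ)

/-- `τ₂ = - *₇ d *₇ φ + 4 *₇ (τ₁ ∧ *₇ φ)`. -/
def τ₂ (φ : Form I N 3) : Form I N 2 :=
  - g2Star φ (k := 5) (l := 2) rfl (g2Star φ (k := 3) (l := 4) rfl φ).d
    + (4 : ℝ) • g2Star φ (k := 1 + 4) (l := 2) rfl (τ₁ φ ⋏ g2Star φ (k := 3) (l := 4) rfl φ)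

/-- `τ₃ = *₇ dφ - τ₀ φ - 3 *₇ (τ₁ ∧ φ)`. -/
def τ₃ (φ : Form I N 3) : Form I N 3 :=
  g2Star φ (k := 4) (l := 3) rfl φ.d - τ₀ φ ⊙ φ
    - (3 : ℝ) • g2Star φ (k := 1 + 3) (l := 3) rfl (τ₁ φ ⋏ φ)

/-- The torsion of `φ` lies in `⨁_{i ∈ S} 𝓧_i` (`S ⊆ {1, …, 4}`), where the components in
`𝓧₁, 𝓧₂, 𝓧₃, 𝓧₄` are `τ₀, τ₂, τ₃, τ₁`: all components outside `S` vanish. -/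
structure InG2Class (φ : Form I N 3) (S : Set ℕ) : Prop where
  x1 : 1 ∉ S → τ₀ φ = 0
  x2 : 2 ∉ S → τ₂ φ = 0
  x3 : 3 ∉ S → τ₃ φ = 0
  x4 : 4 ∉ S → τ₁ φ = 0

end G2

/-! ## Warped `G₂`-structures -/

/-- The invariant `1`-form `ds` on the circle `{z : |z| = 1}`, where `z = exp (i s)`; that is
`ds = Im (conj z * dz)`. -/
def ds : Form (𝓡 1) Circle 1 := fun z =>
  oneForm (Complex.imCLM.comp ((ContinuousLinearMap.mul ℝ ℂ (star (z : ℂ))).comp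
    (mfderiv (𝓡 1) 𝓘(ℝ, ℂ) (fun w : Circle => (w : ℂ)) z)))

section Warped

variable {M : Type*} [TopologicalSpace M] [ChartedSpace (EuclideanSpace ℝ (Fin 6)) M]

/-- The warped `G₂`-form `φ = f ω ∧ ds + (α ψ₊ - β ψ₋)` on `M × S¹` (forms and functions on the
factors are pulled back by the projections). -/
def warpedForm (om : Form (𝓡 6) M 2) (ψp ψm : Form (𝓡 6) M 3) (f : M → ℝ) (α β : ℝ) :
    Form ((𝓡 6).prod (𝓡 1)) (M × Circle) 3 :=
  (f ⊙ om).pullback Prod.fst ⋏ ds.pullback Prod.snd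
    + (α • ψp - β • ψm).pullback Prod.fst

/-- The `1`-form `f⁻¹ df` on `M`. -/
def dLog (f : M → ℝ) : Form (𝓡 6) M 1 := (fun x => (f x)⁻¹) ⊙ dFun (𝓡 6) f

/-- `η₁ = f⁻¹ df + π₁ + ν₁`. -/
def SU3Forms.η₁ (T : SU3Forms M) (f : M → ℝ) : Form (𝓡 6) M 1 := dLog f + T.π₁ + T.ν₁

/-- `η₂ = f⁻¹ df + π₁ - 2 ν₁`. -/
def SU3Forms.η₂ (T : SU3Forms M) (f : M → ℝ) : Form (𝓡 6) M 1 := dLog f + T.π₁ - (2 : ℝ) • T.ν₁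

/-- `η₃ = f⁻¹ df - π₁ + ν₁`. -/
def SU3Forms.η₃ (T : SU3Forms M) (f : M → ℝ) : Form (𝓡 6) M 1 := dLog f - T.π₁ + T.ν₁

end Warped

end

end WarpedG2

open scoped Manifold ContDiff

namespace WarpedG2

noncomputable section

section Algebra

variable {V : Type*} [AddCommGroup V] [Module ℝ V] [TopologicalSpace V]
variable {V' : Type*} [AddCommGroup V'] [Module ℝ V'] [TopologicalSpace V']

/-! ## The wedge product -/

/-! Once dφ and d∗φ are known, everything is linear algebra at a point. The form ψ₊ + iψ₋ equals
(e¹+ie²)∧(e³+ie⁴)∧(e⁵+ie⁶), so multiplying the first complex covector by α+iβ turns an adapted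
coframe into one adapted to ω, Ψ₊ = αψ₊−βψ₋, Ψ₋ = αψ₋+βψ₊ (`IsSU3Frame.rotate`). The rotated
structure keeps π₁, ν₁, ν₃, and its other torsion components are p₀ = απ₀−βσ₀, s₀ = ασ₀+βπ₀, p₂ =
απ₂−βσ₂, s₂ = ασ₂+βπ₂ (`IsTorsionAt.isWarpedTorsion`). With e⁷ = f ds, whatever the sign of f, φ is
the model form ω∧e⁷+Ψ₊, and ∗φ = ½ω²+Ψ₋∧e⁷. As ds is closed, z = f⁻¹df gives dφ = (dω+z∧ω)∧e⁷+dΨ₊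
and d∗φ = ν₁∧ω²+(dΨ₋+z∧Ψ₋)∧e⁷.

Inserting this into the definitions of the τᵢ gives τ₀ = (12/7)p₀, τ₁ = η₁/6+s₀e⁷/2, and linear
systems for τ₂ and τ₃. Their shape is explained by representation theory: the G₂-modules of τ₀, τ₁,
τ₂, τ₃, of dimensions 1, 7, 14, 27, split under SU(3) as 1, 1+6, 6+8, 1+6+8+12, and the pieces are
p₀; s₀, η₁; η₂, s₂; p₀, η₃, p₂, ν₃, up to nonzero factors. The statements on classes follow by
elimination: (π₀,σ₀) ↦ (p₀,s₀) and (π₂,σ₂) ↦ (p₂,s₂) are rotations, and the ηᵢ are independent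
combinations of z, π₁, ν₁.

The linear systems are found by explicit computation with components indexed by lists: wedging with
a coordinate form deletes indices up to sign (`val_wedge_elemL`), the star passes to the
complementary indices (`val_frameStar`), and a form is determined by its components on increasing
lists (`form_ext`). That any adapted frame computes the star is `frameStar_eq_of_isG2Frame`. The
analytic input is the derivative of a product with ds (`Form.d_pullback_wedge_ds`) and of ω²
(`Form.d_wedge_self`). -/

theorem wedge_apply_quotient {k l : ℕ} (a : V [⋀^Fin k]→L[ℝ] ℝ) (b : V [⋀^Fin l]→L[ℝ] ℝ)
    (v : Fin (k + l) → V) :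
    wedge a b v = ∑ σ : Equiv.Perm.ModSumCongr (Fin k) (Fin l), LinearMap.mul' ℝ ℝ
      (AlternatingMap.domCoprod.summand a.toAlternatingMap b.toAlternatingMap σ
        fun i => v (finSumFinEquiv i)) := by
  change LinearMap.mul' ℝ ℝ
    ((a.toAlternatingMap.domCoprod b.toAlternatingMap) fun i => v (finSumFinEquiv i)) = _
  rw [AlternatingMap.domCoprod_apply, sum_apply, map_sum]

/-- The wedge product as a sum over all permutations. -/
theorem wedge_apply {k l : ℕ} (a : V [⋀^Fin k]→L[ℝ] ℝ) (b : V [⋀^Fin l]→L[ℝ] ℝ)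
    (v : Fin (k + l) → V) :
    wedge a b v = ((k.factorial * l.factorial : ℝ))⁻¹ * ∑ σ : Equiv.Perm (Fin k ⊕ Fin l),
      ((Equiv.Perm.sign σ : ℤ) : ℝ) * (a (fun i => v (finSumFinEquiv (σ (Sum.inl i)))) *
        b fun i => v (finSumFinEquiv (σ (Sum.inr i)))) := by
  -- A class of permutations modulo the two blocks has k! l! elements, all with the same summand;
  -- this is the normalizing factor.
  have h := congrArg (fun g => LinearMap.mul' ℝ ℝ (g fun i => v (finSumFinEquiv i)))
    (MultilinearMap.domCoprod_alternization_eq a.toAlternatingMap b.toAlternatingMap)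
  have h2 : wedge a b v = LinearMap.mul' ℝ ℝ
    ((a.toAlternatingMap.domCoprod b.toAlternatingMap) fun i => v (finSumFinEquiv i)) := rfl
  simp only [Fintype.card_fin, AlternatingMap.smul_apply, map_nsmul, ← h2,
    MultilinearMap.alternatization_apply] at h
  rw [eq_inv_mul_iff_mul_eq₀ (by positivity)]
  rw [nsmul_eq_mul] at h
  push_cast at h
  rw [← h, map_sum]
  refine Finset.sum_congr rfl fun σ _ => ?_
  rw [Units.smul_def, map_zsmul, zsmul_eq_mul]
  rfl

theorem wedge_add_left {k l : ℕ} (a a' : V [⋀^Fin k]→L[ℝ] ℝ) (b : V [⋀^Fin l]→L[ℝ] ℝ) :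
    wedge (a + a') b = wedge a b + wedge a' b := by
  ext v
  simp only [wedge_apply, ContinuousAlternatingMap.add_apply, ← mul_add, add_mul,
    ← Finset.sum_add_distrib]

theorem wedge_add_right {k l : ℕ} (a : V [⋀^Fin k]→L[ℝ] ℝ) (b b' : V [⋀^Fin l]→L[ℝ] ℝ) :
    wedge a (b + b') = wedge a b + wedge a b' := by
  ext v
  simp only [wedge_apply, ContinuousAlternatingMap.add_apply, ← mul_add,
    ← Finset.sum_add_distrib]

theorem wedge_smul_left {k l : ℕ} (c : ℝ) (a : V [⋀^Fin k]→L[ℝ] ℝ) (b : V [⋀^Fin l]→L[ℝ] ℝ) :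
    wedge (c • a) b = c • wedge a b := by
  ext v
  simp only [wedge_apply, ContinuousAlternatingMap.smul_apply, smul_eq_mul, Finset.mul_sum]
  exact Finset.sum_congr rfl fun σ _ => by ring

theorem wedge_smul_right {k l : ℕ} (c : ℝ) (a : V [⋀^Fin k]→L[ℝ] ℝ) (b : V [⋀^Fin l]→L[ℝ] ℝ) :
    wedge a (c • b) = c • wedge a b := by
  ext v
  simp only [wedge_apply, ContinuousAlternatingMap.smul_apply, smul_eq_mul, Finset.mul_sum]
  exact Finset.sum_congr rfl fun σ _ => by ring

theorem wedge_neg_right {k l : ℕ} (a : V [⋀^Fin k]→L[ℝ] ℝ) (b : V [⋀^Fin l]→L[ℝ] ℝ) :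
    wedge a (-b) = -wedge a b := by
  ext v
  simp only [wedge_apply, ContinuousAlternatingMap.neg_apply, mul_neg, Finset.sum_neg_distrib]

theorem wedge_sub_right {k l : ℕ} (a : V [⋀^Fin k]→L[ℝ] ℝ) (b b' : V [⋀^Fin l]→L[ℝ] ℝ) :
    wedge a (b - b') = wedge a b - wedge a b' := by
  rw [sub_eq_add_neg, wedge_add_right, wedge_neg_right, sub_eq_add_neg]

theorem wedge_compContinuousLinearMap {k l : ℕ} (a : V [⋀^Fin k]→L[ℝ] ℝ)
    (b : V [⋀^Fin l]→L[ℝ] ℝ) (g : V' →L[ℝ] V) :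
    (wedge a b).compContinuousLinearMap g =
      wedge (a.compContinuousLinearMap g) (b.compContinuousLinearMap g) := by
  ext v
  simp only [wedge_apply, ContinuousAlternatingMap.compContinuousLinearMap_apply,
    Function.comp_def]

theorem wedge_comm_two (a b : V [⋀^Fin 2]→L[ℝ] ℝ) : wedge a b = wedge b a := by
  ext v
  simp only [wedge_apply]
  congr 1
  -- Exchanging two blocks of length two is an even permutation, so the reindexing costs no sign.
  let ρ : Equiv.Perm (Fin 2 ⊕ Fin 2) := Equiv.sumComm _ _
  have hρ : Equiv.Perm.sign ρ = 1 := by decide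
  let τ : Equiv.Perm (Fin (2 + 2)) := (finSumFinEquiv.symm.trans ρ).trans finSumFinEquiv
  refine Fintype.sum_equiv (Equiv.mulRight ρ) _ _ fun σ => ?_
  simp [hρ, mul_comm (a _), ρ]

/-- If `b` vanishes as soon as one of its arguments is some `v i`, then
`(a ∧ b) (v, w) = a v * b w`. -/
theorem wedge_append {k l : ℕ} (a : V [⋀^Fin k]→L[ℝ] ℝ) (b : V [⋀^Fin l]→L[ℝ] ℝ)
    (v : Fin k → V) (w : Fin l → V) (hb : ∀ x : Fin l → V, (∃ i j, x i = v j) → b x = 0) :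
    wedge a b (Fin.append v w) = a v * b w := by
  rw [wedge_apply_quotient]
  refine (Finset.sum_eq_single (Quotient.mk'' 1 : Equiv.Perm.ModSumCongr (Fin k) (Fin l))
    ?_ ?_).trans ?_
  · intro q _ hq
    induction q using Quotient.inductionOn' with
    | h σ =>
    -- Either σ feeds some `v j` to `b` and the term vanishes, or σ preserves the second block,
    -- hence by counting also the first, and lies in the class of the identity.
    by_cases h : ∃ i j, σ (Sum.inr i) = Sum.inl j
    · obtain ⟨i, j, hij⟩ := h
      rw [AlternatingMap.domCoprod.summand_mk'']
      have : b (fun i => Fin.append v w (finSumFinEquiv (σ (Sum.inr i)))) = 0 :=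
        hb _ ⟨i, j, by simp [hij]⟩
      simp [this]
    · exfalso
      apply hq
      rw [eq_comm, Quotient.eq'', QuotientGroup.leftRel_apply]
      push Not at h
      have : σ ∈ (Equiv.Perm.sumCongrHom (Fin k) (Fin l)).range := by
        apply Equiv.Perm.mem_sumCongrHom_range_of_perm_mapsTo_inl
        rintro _ ⟨i, rfl⟩
        rcases hs : σ (Sum.inl i) with j | j
        · exact ⟨j, rfl⟩
        · exfalso
          have hr : ∀ i, ∃ j, σ (Sum.inr i) = Sum.inr j := fun i => by
            rcases hs : σ (Sum.inr i) with j | j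
            · exact absurd hs (h i j)
            · exact ⟨j, rfl⟩
          choose g hg using hr
          have hinj : Function.Injective g := fun x y hxy => by
            simpa using σ.injective ((hg x).trans ((congrArg Sum.inr hxy).trans (hg y).symm))
          obtain ⟨x, hx⟩ := Finite.injective_iff_surjective.1 hinj j
          have := σ.injective ((hg x).trans ((congrArg Sum.inr hx).trans hs.symm))
          simp at this
      simpa using this
  · simp
  · rw [AlternatingMap.domCoprod.summand_mk'']
    simp

theorem wedge_eq_zero_of_right {k l : ℕ} (a : V [⋀^Fin k]→L[ℝ] ℝ) (b : V [⋀^Fin l]→L[ℝ] ℝ)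
    (v : Fin (k + l) → V) (hb : ∀ s : Fin l → Fin (k + l), b (v ∘ s) = 0) :
    wedge a b v = 0 := by
  rw [wedge_apply, Finset.sum_eq_zero, mul_zero]
  intro σ _
  have : b (fun i => v (finSumFinEquiv (σ (Sum.inr i)))) = 0 := hb _
  rw [this, mul_zero, mul_zero]

end Algebra

/-! ## Signed reordering of lists -/

section Lists

variable {ι : Type*}

/-- A function of lists that changes sign when two neighbours are exchanged. -/
def SwapNeg (F : List ι → ℝ) : Prop :=
  ∀ p q x y, F (p ++ x :: y :: q) = -F (p ++ y :: x :: q)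

theorem SwapNeg.move {F : List ι → ℝ} (hF : SwapNeg F) (x : ι) (t p q : List ι) :
    F (p ++ x :: t ++ q) = (-1) ^ t.length * F (p ++ t ++ x :: q) := by
  induction t generalizing p with
  | nil => simp
  | cons y t ih =>
    have h1 := hF p (t ++ q) x y
    have h2 := ih (p ++ [y])
    simp only [List.cons_append, List.append_assoc, List.nil_append] at h1 h2 ⊢
    rw [h1, h2, List.length_cons, pow_succ]
    ring

variable [DecidableEq ι]

/-- Remove the first occurrence of `x` from the list, together with the sign of the permutation that
moves this occurrence to the end; the sign is `0` if `x` does not occur. -/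
def pull (x : ι) : List ι → ℤ × List ι
  | [] => (0, [])
  | y :: t => if x = y then ((-1) ^ t.length, t) else ((pull x t).1, y :: (pull x t).2)

/-- Remove the entries of the first list from the second one, together with the sign of the
permutation that moves them to the end; the sign is `0` if one of them does not occur. -/
def strip : List ι → List ι → ℤ × List ι
  | [], t => (1, t)
  | x :: K, t => ((strip K t).1 * (pull x (strip K t).2).1, (pull x (strip K t).2).2)

theorem pull_of_notMem {x : ι} {t : List ι} (h : x ∉ t) : (pull x t).1 = 0 := by
  induction t with
  | nil => rfl
  | cons y t ih =>
    simp only [List.mem_cons, not_or] at h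
    simp [pull, h.1, ih h.2]

theorem pull_perm {x : ι} {t : List ι} (h : x ∈ t) : ((pull x t).2 ++ [x]).Perm t := by
  induction t with
  | nil => simp at h
  | cons y t ih =>
    by_cases hxy : x = y
    · subst hxy
      simp [pull]
    · simp only [List.mem_cons, hxy, false_or] at h
      simpa [pull, hxy] using ih h

theorem pull_sq {x : ι} {t : List ι} (h : x ∈ t) : (pull x t).1 * (pull x t).1 = 1 := by
  induction t with
  | nil => simp at h
  | cons y t ih =>
    by_cases hxy : x = y
    · subst hxy
      simp [pull, ← mul_pow]
    · simp only [List.mem_cons, hxy, false_or] at h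
      simpa [pull, hxy] using ih h

theorem pull_subset (x : ι) (t : List ι) : (pull x t).2 ⊆ t := by
  induction t with
  | nil => simp [pull]
  | cons y t ih =>
    by_cases hxy : x = y
    · subst hxy
      simp [pull]
    · simpa [pull, hxy] using List.Subset.trans ih (List.subset_cons_self y t)

theorem SwapNeg.pull {F : List ι → ℝ} (hF : SwapNeg F) {x : ι} {t : List ι} (h : x ∈ t)
    (p q : List ι) :
    F (p ++ t ++ q) = ((pull x t).1 : ℝ) * F (p ++ (pull x t).2 ++ x :: q) := by
  induction t generalizing p with
  | nil => simp at h
  | cons y t ih =>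
    by_cases hxy : x = y
    · subst hxy
      simpa [WarpedG2.pull] using hF.move x t p q
    · simp only [List.mem_cons, hxy, false_or] at h
      simpa [WarpedG2.pull, hxy] using ih h (p ++ [y])

theorem strip_subset (K t : List ι) : (strip K t).2 ⊆ t := by
  induction K with
  | nil => simp [strip]
  | cons x K ih => exact List.Subset.trans (pull_subset x _) ih

theorem strip_of_not_subset {K t : List ι} (h : ¬ K ⊆ t) : (strip K t).1 = 0 := by
  induction K with
  | nil => simp at h
  | cons x K ih =>
    by_cases hK : K ⊆ t
    · have hx : x ∉ t := fun hx => h (by simp [hx, hK])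
      simp [strip, pull_of_notMem fun hm => hx (strip_subset K t hm)]
    · simp [strip, ih hK]

/-- The entries of `K` are moved to the end by exchanges of neighbours, so every antisymmetric
function of lists acquires the same sign. `strip` computes this sign by evaluation on concrete
lists. -/
theorem strip_perm {K t : List ι} (h : K ⊆ t) (hK : K.Nodup) :
    ((strip K t).2 ++ K).Perm t ∧ (strip K t).1 * (strip K t).1 = 1 ∧
      ∀ F, SwapNeg F → F t = ((strip K t).1 : ℝ) * F ((strip K t).2 ++ K) := by
  induction K with
  | nil => simp [strip]
  | cons x K ih =>
    simp only [List.cons_subset] at h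
    simp only [List.nodup_cons] at hK
    obtain ⟨h1, h2, h3⟩ := ih h.2 hK.2
    -- As `x ∉ K`, its occurrence in `t` survives the removal of `K`.
    have hx : x ∈ (strip K t).2 := by
      have := h1.mem_iff.2 h.1
      simpa [hK.1] using this
    refine ⟨?_, ?_, fun F hF => ?_⟩
    · have := ((pull_perm hx).append_right K).trans h1
      simpa [strip] using this
    · have := pull_sq hx
      simp only [strip]
      linear_combination (pull x (strip K t).2).1 * (pull x (strip K t).2).1 * h2 + this
    · have := hF.pull hx [] K
      rw [h3 F hF]
      simp only [List.nil_append] at this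
      rw [this]
      simp only [strip]
      push_cast
      ring

end Lists

/-! ## Components of forms with respect to a frame -/

section Components

variable {V : Type*} [AddCommGroup V] [Module ℝ V] [TopologicalSpace V] {n : ℕ}

/-- The vectors of the frame. -/
def basisVec (u : V ≃L[ℝ] (Fin n → ℝ)) (i : Fin n) : V := u.symm (Pi.single i 1)

theorem coframe_basisVec (u : V ≃L[ℝ] (Fin n → ℝ)) (i j : Fin n) :
    coframe u i (basisVec u j) = if i = j then 1 else 0 := by
  simp [coframe, basisVec, Pi.single_apply]

theorem sum_coframe_smul (u : V ≃L[ℝ] (Fin n → ℝ)) (v : V) :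
    ∑ i, coframe u i v • basisVec u i = v := by
  apply u.injective
  rw [map_sum]
  ext j
  simp [coframe, basisVec, Pi.single_apply]

theorem elem_apply {k : ℕ} (u : V ≃L[ℝ] (Fin n → ℝ)) (i : Fin k → Fin n) (v : Fin k → V) :
    elem u i v =
      ∑ σ : Equiv.Perm (Fin k), ((Equiv.Perm.sign σ : ℤ) : ℝ) * ∏ a, coframe u (i a) (v (σ a)) := by
  rw [elem, ContinuousMultilinearMap.alternatization_apply_apply]
  refine Finset.sum_congr rfl fun σ _ => ?_
  rw [Units.smul_def, zsmul_eq_mul]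
  simp

theorem elem_apply' {k : ℕ} (u : V ≃L[ℝ] (Fin n → ℝ)) (i : Fin k → Fin n) (v : Fin k → V) :
    elem u i v =
      ∑ σ : Equiv.Perm (Fin k), ((Equiv.Perm.sign σ : ℤ) : ℝ) * ∏ a, coframe u (i (σ a)) (v a) := by
  rw [elem_apply]
  refine Fintype.sum_equiv (Equiv.inv _) _ _ fun σ => ?_
  rw [Equiv.inv_apply, Equiv.Perm.sign_inv]
  congr 1
  exact Fintype.prod_equiv σ _ _ fun a => by simp

theorem elem_apply_eq_zero {k : ℕ} (u : V ≃L[ℝ] (Fin n → ℝ)) (i : Fin k → Fin n) (v : Fin k → V)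
    (b : Fin k) (h : ∀ a, coframe u (i a) (v b) = 0) : elem u i v = 0 := by
  rw [elem_apply']
  refine Finset.sum_eq_zero fun σ _ => ?_
  rw [Finset.prod_eq_zero (Finset.mem_univ b) (h _), mul_zero]

theorem elem_apply_eq_zero' {k : ℕ} (u : V ≃L[ℝ] (Fin n → ℝ)) (i : Fin k → Fin n) (v : Fin k → V)
    (a : Fin k) (h : ∀ b, coframe u (i a) (v b) = 0) : elem u i v = 0 := by
  rw [elem_apply]
  refine Finset.sum_eq_zero fun σ _ => ?_
  rw [Finset.prod_eq_zero (Finset.mem_univ a) (h _), mul_zero]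

theorem elem_apply_self {k : ℕ} (u : V ≃L[ℝ] (Fin n → ℝ)) {i : Fin k → Fin n}
    (hi : Function.Injective i) : elem u i (fun a => basisVec u (i a)) = 1 := by
  rw [elem_apply, Finset.sum_eq_single 1]
  · simp [coframe_basisVec]
  · intro σ _ hσ
    obtain ⟨a, ha⟩ : ∃ a, σ a ≠ a := by
      by_contra! h
      exact hσ (Equiv.ext h)
    rw [Finset.prod_eq_zero (Finset.mem_univ a), mul_zero]
    rw [coframe_basisVec, if_neg fun h => ha (hi h).symm]
  · simp

variable [NeZero n]

/-- The component `a (e_{t_1}, …, e_{t_k})` of the `k`-form `a`; `0` if the length of the list `t`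
is not `k`. -/
def val (u : V ≃L[ℝ] (Fin n → ℝ)) {k : ℕ} (a : V [⋀^Fin k]→L[ℝ] ℝ) (t : List (Fin n)) : ℝ :=
  if t.length = k then a fun i => basisVec u (t.getD i 0) else 0

/-- The form `e^{K_1} ∧ ⋯ ∧ e^{K_k}`. -/
def elemL (u : V ≃L[ℝ] (Fin n → ℝ)) (k : ℕ) (K : List (Fin n)) : V [⋀^Fin k]→L[ℝ] ℝ :=
  elem u fun i => K.getD i 0

variable (u : V ≃L[ℝ] (Fin n → ℝ))

theorem val_of_length {k : ℕ} (a : V [⋀^Fin k]→L[ℝ] ℝ) {t : List (Fin n)} (h : t.length = k) :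
    val u a t = a fun i => basisVec u (t.getD i 0) := if_pos h

theorem val_add {k : ℕ} (a b : V [⋀^Fin k]→L[ℝ] ℝ) (t : List (Fin n)) :
    val u (a + b) t = val u a t + val u b t := by
  unfold val; split_ifs <;> simp

theorem val_sub {k : ℕ} (a b : V [⋀^Fin k]→L[ℝ] ℝ) (t : List (Fin n)) :
    val u (a - b) t = val u a t - val u b t := by
  unfold val; split_ifs <;> simp

theorem val_neg {k : ℕ} (a : V [⋀^Fin k]→L[ℝ] ℝ) (t : List (Fin n)) :
    val u (-a) t = -val u a t := by
  unfold val; split_ifs <;> simp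

theorem val_smul {k : ℕ} (c : ℝ) (a : V [⋀^Fin k]→L[ℝ] ℝ) (t : List (Fin n)) :
    val u (c • a) t = c * val u a t := by
  unfold val; split_ifs <;> simp

theorem val_zero {k : ℕ} (t : List (Fin n)) : val u (0 : V [⋀^Fin k]→L[ℝ] ℝ) t = 0 := by
  unfold val; split_ifs <;> simp

theorem getD_swap {ι : Type*} (p q : List ι) (x y d : ι) (m : ℕ) :
    (p ++ x :: y :: q).getD m d = (p ++ y :: x :: q).getD
      (if m = p.length then p.length + 1 else if m = p.length + 1 then p.length else m) d := by
  induction p generalizing m with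
  | nil => rcases m with _ | _ | m <;> simp
  | cons z p ih =>
    rcases m with _ | m
    · simp
    · have := ih m
      simp only [List.cons_append, List.getD_cons_succ, List.length_cons, add_left_inj, this]
      split_ifs <;> simp

theorem swapNeg_val {k : ℕ} (a : V [⋀^Fin k]→L[ℝ] ℝ) : SwapNeg (val u a) := by
  intro p q x y
  by_cases h : (p ++ x :: y :: q).length = k
  · have h' : (p ++ y :: x :: q).length = k := by simpa using h
    rw [val_of_length u a h, val_of_length u a h']
    simp only [List.length_append, List.length_cons] at h
    let i : Fin k := ⟨p.length, by omega⟩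
    let j : Fin k := ⟨p.length + 1, by omega⟩
    have hij : i ≠ j := by simp [i, j]
    have := a.toAlternatingMap.map_swap (fun i => basisVec u ((p ++ y :: x :: q).getD i 0)) hij
    refine Eq.trans ?_ this
    change a _ = a _
    congr 1
    funext m
    rw [getD_swap, Function.comp_apply, Equiv.swap_apply_def]
    simp only [Fin.ext_iff, i, j]
    split_ifs <;> simp
  · have h' : ¬ (p ++ y :: x :: q).length = k := by simpa using h
    rw [val, val, if_neg h, if_neg h', neg_zero]

theorem getD_injective {ι : Type*} {K : List ι} (hK : K.Nodup) {k : ℕ} (h : K.length = k) (d : ι) :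
    Function.Injective fun i : Fin k => K.getD i d := by
  subst h
  intro i j hij
  simpa [List.Nodup.getElem_inj_iff hK, Fin.ext_iff] using hij

theorem getD_append_eq {ι : Type*} {k l : ℕ} (D K : List ι) (hD : D.length = k) (d : ι)
    {X : Type*} (e : ι → X) :
    (fun i : Fin (k + l) => e ((D ++ K).getD i d)) =
      Fin.append (fun i : Fin k => e (D.getD i d)) fun i : Fin l => e (K.getD i d) := by
  subst hD
  funext i
  refine Fin.addCases (fun i => ?_) (fun i => ?_) i
  · simp [List.getElem?_append]
  · simp [List.getElem?_append]

/-- The computational rule for wedge products: once the indices `K` stand at the end, only the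
trivial shuffle contributes, because the covectors of `K` vanish on the remaining basis vectors. If
an index of `K` is missing from `t`, its covector kills every argument, in accordance with the sign
`0` of `strip`. -/
theorem val_wedge_elemL {k l : ℕ} (a : V [⋀^Fin k]→L[ℝ] ℝ) {t K : List (Fin n)}
    (ht : t.Nodup ∧ t.length = k + l) (hK : K.Nodup ∧ K.length = l) :
    val u (wedge a (elemL u l K)) t = ((strip K t).1 : ℝ) * val u a (strip K t).2 := by
  by_cases h : K ⊆ t
  · obtain ⟨h1, h2, h3⟩ := strip_perm h hK.1
    rw [h3 _ (swapNeg_val u _)]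
    congr 1
    have hl : (strip K t).2.length = k := by
      have := h1.length_eq
      simp only [List.length_append] at this
      omega
    rw [val_of_length u _ (by simp [hl, hK.2]), val_of_length u _ hl, getD_append_eq _ _ hl,
      wedge_append]
    · rw [elemL, elem_apply_self u (getD_injective hK.1 hK.2 0), mul_one]
    · rintro x ⟨i, j, hij⟩
      refine elem_apply_eq_zero u _ _ i fun b => ?_
      rw [hij, coframe_basisVec, if_neg]
      intro hbj
      have hnd := h1.nodup_iff.2 ht.1
      rw [List.nodup_append] at hnd
      have hb : (b : ℕ) < K.length := by omega
      have hj : (j : ℕ) < (strip K t).2.length := by omega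
      rw [List.getD_eq_getElem _ _ hb, List.getD_eq_getElem _ _ hj] at hbj
      exact hnd.2.2 _ (List.getElem_mem hj) _ (List.getElem_mem hb) hbj.symm
  · rw [strip_of_not_subset h, Int.cast_zero, zero_mul, val_of_length u _ ht.2]
    obtain ⟨x, hx, hxt⟩ : ∃ x ∈ K, x ∉ t := by
      by_contra! h'
      exact h h'
    obtain ⟨m, hm, rfl⟩ := List.getElem_of_mem hx
    refine wedge_eq_zero_of_right _ _ _ fun s =>
      elem_apply_eq_zero' u _ _ ⟨m, by omega⟩ fun b => ?_
    rw [Function.comp_apply, coframe_basisVec, if_neg]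
    intro hb
    apply hxt
    have hs : (s b : ℕ) < t.length := by omega
    rw [List.getD_eq_getElem _ _ hm, List.getD_eq_getElem _ _ hs] at hb
    rw [hb]
    exact List.getElem_mem hs

theorem val_elemL {k : ℕ} {t K : List (Fin n)} (ht : t.length = k)
    (hK : K.Nodup ∧ K.length = k) : val u (elemL u k K) t = ((strip K t).1 : ℝ) := by
  by_cases h : K ⊆ t
  · obtain ⟨h1, h2, h3⟩ := strip_perm h hK.1
    have hl : (strip K t).2 = [] := by
      have := h1.length_eq
      simp only [List.length_append] at this
      exact List.length_eq_zero_iff.1 (by omega)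
    rw [h3 _ (swapNeg_val u _), hl, List.nil_append, val_of_length u _ hK.2, elemL,
      elem_apply_self u (getD_injective hK.1 hK.2 0), mul_one]
  · rw [strip_of_not_subset h, Int.cast_zero, val_of_length u _ ht]
    obtain ⟨x, hx, hxt⟩ : ∃ x ∈ K, x ∉ t := by
      by_contra! h'
      exact h h'
    obtain ⟨m, hm, rfl⟩ := List.getElem_of_mem hx
    refine elem_apply_eq_zero' u _ _ ⟨m, by omega⟩ fun b => ?_
    rw [coframe_basisVec, if_neg]
    intro hb
    apply hxt
    have hs : (b : ℕ) < t.length := by omega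
    rw [List.getD_eq_getElem _ _ hm, List.getD_eq_getElem _ _ hs] at hb
    rw [hb]
    exact List.getElem_mem hs

end Components

section Star

variable {V : Type*} [AddCommGroup V] [Module ℝ V] [TopologicalSpace V]

/-! ## The Hodge star of a frame -/

/-- The permutation of `Fin (k + l)` that acts by `σ` and `τ` on the two blocks. -/
def blockPerm {k l : ℕ} (σ : Equiv.Perm (Fin k)) (τ : Equiv.Perm (Fin l)) :
    Equiv.Perm (Fin (k + l)) := finSumFinEquiv.permCongr (Equiv.sumCongr σ τ)

theorem blockPerm_castAdd {k l : ℕ} (σ : Equiv.Perm (Fin k)) (τ : Equiv.Perm (Fin l)) (a : Fin k) :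
    blockPerm σ τ (Fin.castAdd l a) = Fin.castAdd l (σ a) := by
  simp [blockPerm, Equiv.permCongr_apply]

theorem blockPerm_natAdd {k l : ℕ} (σ : Equiv.Perm (Fin k)) (τ : Equiv.Perm (Fin l)) (c : Fin l) :
    blockPerm σ τ (Fin.natAdd k c) = Fin.natAdd k (τ c) := by
  simp [blockPerm, Equiv.permCongr_apply]

theorem sign_blockPerm {k l : ℕ} (σ : Equiv.Perm (Fin k)) (τ : Equiv.Perm (Fin l)) :
    Equiv.Perm.sign (blockPerm σ τ) = Equiv.Perm.sign σ * Equiv.Perm.sign τ := by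
  rw [blockPerm, Equiv.Perm.sign_permCongr, Equiv.Perm.sign_sumCongr]

theorem exists_blockPerm {k l : ℕ} (σ : Equiv.Perm (Fin (k + l)))
    (h : ∀ c, σ (Fin.natAdd k c) = Fin.natAdd k c) : ∃ τ, σ = blockPerm τ 1 := by
  have hc : ∀ a, ∃ b, σ (Fin.castAdd l a) = Fin.castAdd l b := by
    intro a
    refine Fin.addCases (motive := fun x => σ (Fin.castAdd l a) = x → ∃ b,
      σ (Fin.castAdd l a) = Fin.castAdd l b) (fun b hb => ⟨b, hb⟩) (fun c hc => ?_) _ rfl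
    have := congrArg Fin.val (σ.injective (hc.trans (h c).symm))
    simp at this
    omega
  choose g hg using hc
  have hinj : Function.Injective g := fun a b hab => by
    have := σ.injective ((hg a).trans ((congrArg _ hab).trans (hg b).symm))
    simpa using this
  refine ⟨Equiv.ofBijective g (Finite.injective_iff_bijective.1 hinj), Equiv.ext fun x => ?_⟩
  refine Fin.addCases (fun a => ?_) (fun c => ?_) x
  · rw [blockPerm_castAdd, hg]; rfl
  · rw [blockPerm_natAdd, h]; rfl

theorem blockPerm_one_injective {k l : ℕ} :
    Function.Injective fun τ : Equiv.Perm (Fin k) => (blockPerm τ 1 : Equiv.Perm (Fin (k + l))) := by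
  intro σ τ h
  ext a
  have := congrArg (fun f => f (Fin.castAdd l a)) h
  simp only [blockPerm_castAdd] at this
  simpa using congrArg Fin.val this

theorem sum_perm_fixing {k l : ℕ} (F : Equiv.Perm (Fin (k + l)) → ℝ) :
    ∑ σ, F σ * ∏ c : Fin l, (if σ (Fin.natAdd k c) = Fin.natAdd k c then (1 : ℝ) else 0) =
      ∑ τ : Equiv.Perm (Fin k), F (blockPerm τ 1) := by
  symm
  rw [← Finset.sum_image (f := F) (g := fun τ => blockPerm τ 1) blockPerm_one_injective.injOn]
  rw [← Finset.sum_subset (Finset.subset_univ (Finset.univ.image fun τ => blockPerm τ 1))]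
  · refine Finset.sum_congr rfl fun σ hσ => ?_
    obtain ⟨τ, -, rfl⟩ := Finset.mem_image.1 hσ
    simp [blockPerm_natAdd]
  · intro σ _ hσ
    have : ∃ c, ¬ σ (Fin.natAdd k c) = Fin.natAdd k c := by
      by_contra! h
      obtain ⟨τ, rfl⟩ := exists_blockPerm σ h
      exact hσ (Finset.mem_image.2 ⟨τ, Finset.mem_univ _, rfl⟩)
    obtain ⟨c, hc⟩ := this
    rw [Finset.prod_eq_zero (Finset.mem_univ c) (if_neg hc), mul_zero]

/-- Expanding the determinant `elem` over permutations τ of the last l positions gives l! equal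
sums, since σ can be multiplied by τ⁻¹ on that block. This removes the factor 1/l!. -/
theorem frameStar_apply_perm {k l : ℕ} (u : V ≃L[ℝ] (Fin (k + l) → ℝ)) (β : V [⋀^Fin k]→L[ℝ] ℝ)
    (w : Fin l → V) :
    frameStar rfl u β w = (k.factorial : ℝ)⁻¹ * ∑ σ : Equiv.Perm (Fin (k + l)),
      ((Equiv.Perm.sign σ : ℤ) : ℝ) * ((β fun a => basisVec u (σ (Fin.castAdd l a))) *
        ∏ c, coframe u (σ (Fin.natAdd k c)) (w c)) := by
  set S := ∑ σ : Equiv.Perm (Fin (k + l)),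
      ((Equiv.Perm.sign σ : ℤ) : ℝ) * ((β fun a => basisVec u (σ (Fin.castAdd l a))) *
        ∏ c, coframe u (σ (Fin.natAdd k c)) (w c)) with hS
  have h1 : frameStar rfl u β w = ((k.factorial * l.factorial : ℝ))⁻¹ *
      ∑ σ : Equiv.Perm (Fin (k + l)), ((Equiv.Perm.sign σ : ℤ) : ℝ) *
        (β fun a => basisVec u (σ (Fin.castAdd l a))) *
          elem u (fun c => σ (Fin.natAdd k c)) w := by
    simp [frameStar, ContinuousAlternatingMap.sum_apply, basisVec]
  have h2 : ∀ τ : Equiv.Perm (Fin l), S = ∑ σ : Equiv.Perm (Fin (k + l)),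
      ((Equiv.Perm.sign σ : ℤ) : ℝ) * (β fun a => basisVec u (σ (Fin.castAdd l a))) *
        (((Equiv.Perm.sign τ : ℤ) : ℝ) * ∏ c, coframe u (σ (Fin.natAdd k (τ c))) (w c)) := by
    intro τ
    refine Fintype.sum_equiv (Equiv.mulRight (blockPerm 1 τ⁻¹)) _ _ fun σ => ?_
    simp only [Equiv.coe_mulRight, Equiv.Perm.sign_mul, sign_blockPerm, Equiv.Perm.coe_mul,
      Function.comp_apply, blockPerm_castAdd, blockPerm_natAdd, Equiv.Perm.sign_symm,
      Equiv.Perm.one_apply, Equiv.Perm.sign_one, one_mul, Equiv.Perm.inv_def,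
      Equiv.symm_apply_apply]
    have : (((Equiv.Perm.sign τ : ℤ) : ℝ)) * ((Equiv.Perm.sign τ : ℤ) : ℝ) = 1 := by
      rcases Int.units_eq_one_or (Equiv.Perm.sign τ) with h | h <;> simp [h]
    push_cast
    linear_combination (-((Equiv.Perm.sign σ : ℤ) : ℝ) *
      (β fun a => basisVec u (σ (Fin.castAdd l a))) *
        ∏ c, coframe u (σ (Fin.natAdd k c)) (w c)) * this
  have h3 : ∑ _τ : Equiv.Perm (Fin l), S = (l.factorial : ℝ) * S := by
    simp [Fintype.card_perm]
  rw [h1, mul_inv, mul_assoc]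
  congr 1
  rw [inv_mul_eq_iff_eq_mul₀ (by positivity), ← h3, Finset.sum_congr rfl fun τ _ => h2 τ,
    Finset.sum_comm]
  refine Finset.sum_congr rfl fun σ _ => ?_
  rw [elem_apply', Finset.mul_sum]

/-- The Hodge star as a contraction with the volume form of the frame. -/
theorem frameStar_apply {k l : ℕ} (u : V ≃L[ℝ] (Fin (k + l) → ℝ)) (β : V [⋀^Fin k]→L[ℝ] ℝ)
    (w : Fin l → V) :
    frameStar rfl u β w = (k.factorial : ℝ)⁻¹ * ∑ j : Fin k → Fin (k + l),
      (β fun a => basisVec u (j a)) *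
        elem u id (Fin.append (fun a => basisVec u (j a)) w) := by
  rw [frameStar_apply_perm]
  congr 1
  simp only [elem_apply', Finset.mul_sum]
  rw [Finset.sum_comm]
  refine Finset.sum_congr rfl fun σ _ => ?_
  -- The covector `σ a` pairs nontrivially only with the basis vector of the same index, so σ
  -- determines `j` on the first block.
  rw [Finset.sum_eq_single fun a => σ (Fin.castAdd l a)]
  · simp [Fin.prod_univ_add, coframe_basisVec]
    ring
  · intro j _ hj
    obtain ⟨a, ha⟩ : ∃ a, σ (Fin.castAdd l a) ≠ j a := by
      by_contra! h
      exact hj (funext fun a => (h a).symm)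
    rw [Finset.prod_eq_zero (Finset.mem_univ (Fin.castAdd l a)), mul_zero, mul_zero]
    simp [coframe_basisVec, ha]
  · simp

/-- After the substitution σ ↦ ρσ only permutations fixing the last block contribute, and the k! of
them give equal terms because β is alternating. -/
theorem frameStar_apply_basisVec {k l : ℕ} (u : V ≃L[ℝ] (Fin (k + l) → ℝ))
    (β : V [⋀^Fin k]→L[ℝ] ℝ) (ρ : Equiv.Perm (Fin (k + l))) :
    frameStar rfl u β (fun c => basisVec u (ρ (Fin.natAdd k c))) =
      ((Equiv.Perm.sign ρ : ℤ) : ℝ) * β fun a => basisVec u (ρ (Fin.castAdd l a)) := by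
  have h1 : ∑ σ : Equiv.Perm (Fin (k + l)),
      ((Equiv.Perm.sign σ : ℤ) : ℝ) * ((β fun a => basisVec u (σ (Fin.castAdd l a))) *
        ∏ c, coframe u (σ (Fin.natAdd k c)) (basisVec u (ρ (Fin.natAdd k c)))) =
      ∑ σ : Equiv.Perm (Fin (k + l)), (((Equiv.Perm.sign ρ : ℤ) : ℝ) *
        ((Equiv.Perm.sign σ : ℤ) : ℝ) * (β fun a => basisVec u (ρ (σ (Fin.castAdd l a))))) *
        ∏ c : Fin l, (if σ (Fin.natAdd k c) = Fin.natAdd k c then (1 : ℝ) else 0) := by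
    symm
    refine Fintype.sum_equiv (Equiv.mulLeft ρ) _ _ fun σ => ?_
    simp [coframe_basisVec, mul_assoc]
  rw [frameStar_apply_perm, h1, sum_perm_fixing, inv_mul_eq_iff_eq_mul₀ (by positivity)]
  have h2 : ∀ τ : Equiv.Perm (Fin k), ((Equiv.Perm.sign ρ : ℤ) : ℝ) *
      ((Equiv.Perm.sign (blockPerm τ (1 : Equiv.Perm (Fin l))) : ℤ) : ℝ) *
        (β fun a => basisVec u (ρ (blockPerm τ 1 (Fin.castAdd l a)))) =
      ((Equiv.Perm.sign ρ : ℤ) : ℝ) * β fun a => basisVec u (ρ (Fin.castAdd l a)) := by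
    intro τ
    have := β.toAlternatingMap.map_perm (fun a => basisVec u (ρ (Fin.castAdd l a))) τ
    simp only [blockPerm_castAdd, sign_blockPerm, Equiv.Perm.sign_one, mul_one]
    change β (fun a => basisVec u (ρ (Fin.castAdd l (τ a)))) = _ at this
    rw [this, Units.smul_def, zsmul_eq_mul]
    have h : (((Equiv.Perm.sign τ : ℤ) : ℝ)) * ((Equiv.Perm.sign τ : ℤ) : ℝ) = 1 := by
      rcases Int.units_eq_one_or (Equiv.Perm.sign τ) with h | h <;> simp [h]
    change _ * (_ * β _) = _
    linear_combination (((Equiv.Perm.sign ρ : ℤ) : ℝ) *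
      β fun a => basisVec u (ρ (Fin.castAdd l a))) * h
  rw [Finset.sum_congr rfl fun τ _ => h2 τ]
  simp [Fintype.card_perm]

variable {n : ℕ} [NeZero n]

theorem val_frameStar {k l : ℕ} (h : k + l = n) (u : V ≃L[ℝ] (Fin n → ℝ))
    (β : V [⋀^Fin k]→L[ℝ] ℝ) {t : List (Fin n)} (ht : t.Nodup ∧ t.length = l) :
    val u (frameStar h u β) t =
      ((strip t (List.finRange n)).1 : ℝ) * val u β (strip t (List.finRange n)).2 := by
  obtain ⟨h1, h2, h3⟩ := strip_perm (fun x _ => List.mem_finRange x : t ⊆ List.finRange n) ht.1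
  set D := (strip t (List.finRange n)).2
  set s := (strip t (List.finRange n)).1
  have hl : (D ++ t).length = n := by simp [h1.length_eq]
  have hD : D.length = k := by
    rw [List.length_append] at hl
    omega
  let ρ : Equiv.Perm (Fin n) := Equiv.ofBijective (fun i : Fin n => (D ++ t).getD i 0)
    (Finite.injective_iff_bijective.1
      (getD_injective (h1.nodup_iff.2 (List.nodup_finRange n)) hl 0))
  -- The sign from the list algorithm and the sign of ρ both measure how the volume form changes
  -- under the reordering `D ++ t`, so they agree.
  have hs : s = Equiv.Perm.sign ρ := by
    have e1 := h3 _ (swapNeg_val u (elem u id))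
    rw [val_of_length u _ hl, val_of_length u _ (List.length_finRange)] at e1
    have e2 := (elem u id).toAlternatingMap.map_perm (fun i => basisVec u i) ρ
    change elem u id (fun i : Fin n => basisVec u ((D ++ t).getD i 0)) =
      Equiv.Perm.sign ρ • elem u id (fun i => basisVec u (id i)) at e2
    rw [e2, elem_apply_self u Function.injective_id] at e1
    have e3 : (fun i : Fin n => basisVec u ((List.finRange n).getD i 0)) =
        fun i => basisVec u (id i) := by
      funext i; simp
    rw [e3, elem_apply_self u Function.injective_id, Units.smul_def, zsmul_eq_mul, mul_one] at e1
    have e4 : (1 : ℤ) = s * Equiv.Perm.sign ρ := by exact_mod_cast e1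
    calc s = s * (s * Equiv.Perm.sign ρ) := by rw [← e4, mul_one]
      _ = Equiv.Perm.sign ρ := by rw [← mul_assoc, h2, one_mul]
  rw [val_of_length u _ ht.2, val_of_length u _ hD, hs]
  have e1 : ∀ i : Fin l, t.getD i 0 = ρ (Fin.cast h (Fin.natAdd k i)) := by
    intro i
    simp [ρ, List.getElem?_append, hD]
  have e2 : ∀ i : Fin k, D.getD i 0 = ρ (Fin.cast h (Fin.castAdd l i)) := by
    intro i
    simp [ρ, List.getElem?_append, hD]
  simp only [e1, e2]
  clear_value ρ
  clear e1 e2 hs hl h3 h1 h2 hD ht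
  subst h
  exact frameStar_apply_basisVec u β ρ

/-! ## Forms are determined by their components -/

theorem SwapNeg.eq_zero_iff {ι : Type*} {F : List ι → ℝ} (hF : SwapNeg F) {s t : List ι}
    (h : s.Perm t) (p : List ι) : F (p ++ s) = 0 ↔ F (p ++ t) = 0 := by
  induction h generalizing p with
  | nil => rfl
  | cons x _ ih => simpa using ih (p ++ [x])
  | swap x y q => rw [hF p q y x, neg_eq_zero]
  | trans _ _ ih1 ih2 => exact (ih1 p).trans (ih2 p)

/-- Reduces an identity of forms to finitely many numerical ones, on the increasing lists enumerated
by `List.sublistsLen`. Lists with a repeated index do not matter since the forms are alternating. -/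
theorem form_ext (u : V ≃L[ℝ] (Fin n → ℝ)) {k : ℕ} {a b : V [⋀^Fin k]→L[ℝ] ℝ}
    (h : ∀ t ∈ List.sublistsLen k (List.finRange n), val u a t = val u b t) : a = b := by
  apply ContinuousAlternatingMap.toAlternatingMap_injective
  refine Module.Basis.ext_alternating
    ((Pi.basisFun ℝ (Fin n)).map u.symm.toLinearEquiv) fun v hv => ?_
  change a (fun i => _) = b (fun i => _)
  have hb : ∀ i, ((Pi.basisFun ℝ (Fin n)).map u.symm.toLinearEquiv) (v i) = basisVec u (v i) := by
    intro i; simp [basisVec]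
  simp only [hb]
  rw [← sub_eq_zero, ← ContinuousAlternatingMap.sub_apply]
  have hl : (List.ofFn v).length = k := List.length_ofFn
  have e : (a - b) (fun i => basisVec u (v i)) = val u (a - b) (List.ofFn v) := by
    rw [val_of_length u _ hl]
    congr 1
    funext i
    simp
  rw [e]
  have hnd : (List.ofFn v).Nodup := List.nodup_ofFn.2 hv
  -- Sorting changes a component only by a sign, so its vanishing can be tested on the sorted list,
  -- which is a sublist of `List.finRange n`.
  have hp := List.mergeSort_perm (List.ofFn v) (fun x y => decide (x ≤ y))
  refine ((swapNeg_val u (a - b)).eq_zero_iff hp.symm []).2 ?_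
  rw [List.nil_append, val_sub, sub_eq_zero]
  refine h _ (List.mem_sublistsLen.2 ⟨?_, by simp⟩)
  refine List.sublist_of_subperm_of_pairwise (r := (· ≤ ·)) ?_ ?_ ?_
  · exact List.subperm_of_subset (hp.nodup_iff.2 hnd) fun x _ => List.mem_finRange x
  · simpa using List.pairwise_mergeSort (le := fun x y : Fin n => decide (x ≤ y))
      (by simpa using fun _ _ _ => le_trans) (by simpa using fun a b => le_total a b) (List.ofFn v)
  · exact (List.pairwise_lt_finRange n).imp le_of_lt

end Star

/-! ### Contraction with a vector -/

section Contract

variable {V : Type*} [AddCommGroup V] [Module ℝ V] [TopologicalSpace V]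

/-- The contraction of a form with a vector. -/
def contract {k : ℕ} (v : V) (a : V [⋀^Fin (k + 1)]→L[ℝ] ℝ) : V [⋀^Fin k]→L[ℝ] ℝ :=
  { a.toAlternatingMap.curryLeft v with
    cont := a.cont.comp (continuous_pi fun i => by
      refine Fin.cases ?_ (fun j => ?_) i
      · exact continuous_const
      · exact continuous_apply j) }

theorem contract_apply {k : ℕ} (v : V) (a : V [⋀^Fin (k + 1)]→L[ℝ] ℝ) (w : Fin k → V) :
    contract v a w = a (Matrix.vecCons v w) := rfl

end Contract

/-! ### Independence of the Hodge star from the adapted frame -/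

section G2

variable {V : Type*} [AddCommGroup V] [Module ℝ V] [TopologicalSpace V]
  (u : V ≃L[ℝ] (Fin 7 → ℝ))

theorem finRange_seven : List.finRange 7 = [0, 1, 2, 3, 4, 5, 6] := by decide

theorem elem_apply_det {n k : ℕ} (u : V ≃L[ℝ] (Fin n → ℝ)) (i : Fin k → Fin n) (v : Fin k → V) :
    elem u i v = (Matrix.of fun a b => coframe u (i a) (v b)).det := by
  rw [← Matrix.det_transpose, Matrix.det_apply, elem_apply]
  refine Finset.sum_congr rfl fun σ _ => ?_
  rw [Units.smul_def, zsmul_eq_mul]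
  simp

theorem contract_elemL {n : ℕ} [NeZero n] (u : V ≃L[ℝ] (Fin n → ℝ)) (v : V) (a b c : Fin n) :
    contract v (elemL u 3 [a, b, c]) = coframe u a v • elemL u 2 [b, c]
      - coframe u b v • elemL u 2 [a, c] + coframe u c v • elemL u 2 [a, b] := by
  ext w
  simp [contract_apply, elemL, elem_apply_det, Matrix.det_fin_three, Matrix.det_fin_two]
  ring

theorem contract_add {k : ℕ} (v : V) (a b : V [⋀^Fin (k + 1)]→L[ℝ] ℝ) :
    contract v (a + b) = contract v a + contract v b := rfl

theorem contract_sub {k : ℕ} (v : V) (a b : V [⋀^Fin (k + 1)]→L[ℝ] ℝ) :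
    contract v (a - b) = contract v a - contract v b := rfl

/-- The model `G₂`-form of a frame. -/
def modelG2 : V [⋀^Fin 3]→L[ℝ] ℝ :=
  elemL u 3 [0, 1, 6] + elemL u 3 [2, 3, 6] + elemL u 3 [4, 5, 6]
    + elemL u 3 [0, 2, 4] - elemL u 3 [0, 3, 5] - elemL u 3 [1, 2, 5] - elemL u 3 [1, 3, 4]

theorem elemL_eq {n k : ℕ} [NeZero n] (u : V ≃L[ℝ] (Fin n → ℝ)) (K : List (Fin n))
    (i : Fin k → Fin n) (h : ∀ a, i a = K.getD a 0) : elem u i = elemL u k K := by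
  rw [elemL, funext h]

theorem isG2Frame_iff (φ : V [⋀^Fin 3]→L[ℝ] ℝ) : IsG2Frame φ u ↔ φ = modelG2 u := by
  rw [IsG2Frame, modelG2, elemL_eq u [0, 1, 6] _ (by decide), elemL_eq u [2, 3, 6] _ (by decide),
    elemL_eq u [4, 5, 6] _ (by decide), elemL_eq u [0, 2, 4] _ (by decide),
    elemL_eq u [0, 3, 5] _ (by decide), elemL_eq u [1, 2, 5] _ (by decide),
    elemL_eq u [1, 3, 4] _ (by decide)]

/-- The classical identity (v⌟φ)∧(w⌟φ)∧φ = 6⟨v,w⟩ vol. Its left side involves φ alone, so φ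
determines the metric up to the choice of volume form, and then both. -/
theorem val_wedge_contract_modelG2 (v w : V) :
    val u (wedge (wedge (contract v (modelG2 u)) (contract w (modelG2 u))) (modelG2 u))
      [0, 1, 2, 3, 4, 5, 6] = 6 * ∑ i, coframe u i v * coframe u i w := by
  simp only [modelG2, contract_add, contract_sub, contract_elemL, wedge_add_right, wedge_sub_right,
    wedge_smul_right, val_add, val_sub]
  simp (disch := decide) only [val_wedge_elemL, strip, pull, List.length_cons, List.length_nil,
    Fin.isValue, Fin.reduceEq, reduceIte, val_add, val_sub, val_smul, val_elemL]
  norm_num [Fin.sum_univ_seven]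
  ring

/-- The forms of top degree are multiples of the volume form of `u`, whose value on the frame `u'`
is the determinant of the change of basis. -/
theorem val_top_eq_det_mul {n k : ℕ} [NeZero n] (hk : k = n) (u u' : V ≃L[ℝ] (Fin n → ℝ))
    (a : V [⋀^Fin k]→L[ℝ] ℝ) : val u' a (List.finRange n) =
      (Matrix.of fun i j => coframe u i (basisVec u' j)).det * val u a (List.finRange n) := by
  subst hk
  have h : a = val u a (List.finRange k) • elem u id := by
    apply form_ext u
    intro t ht
    obtain rfl : t = List.finRange k := by
      have := List.mem_sublistsLen.1 ht
      exact this.1.eq_of_length (by rw [this.2, List.length_finRange])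
    rw [val_smul, val_of_length u (elem u id) List.length_finRange]
    have : (fun i : Fin k => basisVec u ((List.finRange k).getD i 0)) =
        fun i => basisVec u (id i) := by
      funext i; simp
    rw [this, elem_apply_self u Function.injective_id, mul_one]
  conv_lhs => rw [h]
  rw [val_smul, mul_comm, val_of_length u' _ List.length_finRange, elem_apply_det]
  simp

/-- Determinant 1 makes the volume forms equal, so the two stars differ only in the contraction of β
with that form. This is a sum over orthonormal frames, hence unaffected by an orthogonal change of
basis. -/
theorem frameStar_eq_of_orthogonal {n k l : ℕ} [NeZero n] (h : k + l = n)
    (u u' : V ≃L[ℝ] (Fin n → ℝ))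
    (ho : (Matrix.of fun i j => coframe u i (basisVec u' j)) *
      (Matrix.of fun i j => coframe u i (basisVec u' j)).transpose = 1)
    (hd : (Matrix.of fun i j => coframe u i (basisVec u' j)).det = 1)
    (β : V [⋀^Fin k]→L[ℝ] ℝ) : frameStar h u β = frameStar h u' β := by
  set A := Matrix.of fun i j => coframe u i (basisVec u' j) with hA
  have hvol : elem u' id = elem u id := by
    apply form_ext u
    intro t ht
    obtain rfl : t = List.finRange n := by
      have := List.mem_sublistsLen.1 ht
      exact this.1.eq_of_length (by rw [this.2, List.length_finRange])
    have h1 := val_top_eq_det_mul rfl u u' (elem u' id)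
    rw [← hA, hd, one_mul] at h1
    rw [← h1, val_of_length _ _ List.length_finRange, val_of_length _ _ List.length_finRange]
    have : ∀ u : V ≃L[ℝ] (Fin n → ℝ), (fun i : Fin n => basisVec u ((List.finRange n).getD i 0)) =
        fun i => basisVec u (id i) := by
      intro u; funext i; simp
    rw [this, this, elem_apply_self u Function.injective_id,
      elem_apply_self u' Function.injective_id]
  have hexp : ∀ f : MultilinearMap ℝ (fun _ : Fin k => V) ℝ, ∀ j : Fin k → Fin n,
      (f fun a => basisVec u' (j a)) =
        ∑ r : Fin k → Fin n, (∏ a, A (r a) (j a)) * f fun a => basisVec u (r a) := by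
    intro f j
    have h1 : ∀ a, basisVec u' (j a) = ∑ i, A i (j a) • basisVec u i := fun a =>
      (sum_coframe_smul u _).symm
    simp only [h1]
    rw [MultilinearMap.map_sum]
    refine Finset.sum_congr rfl fun r _ => ?_
    rw [MultilinearMap.map_smul_univ, smul_eq_mul]
  subst h
  ext w
  rw [frameStar_apply, frameStar_apply, hvol]
  congr 1
  let f : MultilinearMap ℝ (fun _ : Fin k => V) ℝ := β.toAlternatingMap.toMultilinearMap
  let ev : MultilinearMap ℝ (fun _ : Fin l => V) ℝ →ₗ[ℝ] ℝ :=
    { toFun := fun m => m w, map_add' := fun _ _ => rfl, map_smul' := fun _ _ => rfl }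
  let g : MultilinearMap ℝ (fun _ : Fin k => V) ℝ := ev.compMultilinearMap
    ((elem u id).toMultilinearMap.domDomCongr finSumFinEquiv.symm).currySum
  have hg : ∀ x : Fin k → V, elem u id (Fin.append x w) = g x := by
    intro x
    change _ = elem u id _
    congr 1
    funext i
    refine Fin.addCases (fun i => ?_) (fun i => ?_) i <;> simp
  simp only [hg]
  change _ = ∑ j : Fin k → Fin (k + l), (f fun a => basisVec u' (j a)) * _
  simp only [hexp, Finset.sum_mul_sum]
  rw [Finset.sum_comm]
  refine Finset.sum_congr rfl fun r _ => ?_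
  -- The sum over `j` factors as the product over `a` of the entries (AAᵀ)(r a, s a), which is 1 for
  -- r = s and 0 otherwise.
  rw [Finset.sum_comm, Finset.sum_eq_single r]
  · have : ∑ j : Fin k → Fin (k + l), ∏ a, (A (r a) (j a) * A (r a) (j a)) = 1 := by
      have h1 := Finset.prod_univ_sum (fun _ : Fin k => (Finset.univ : Finset (Fin (k + l))))
        fun a j => A (r a) j * A (r a) j
      rw [Fintype.piFinset_univ] at h1
      rw [← h1]
      refine Finset.prod_eq_one fun a _ => ?_
      simpa [Matrix.mul_apply] using congrFun (congrFun ho (r a)) (r a)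
    calc _ = (∑ j : Fin k → Fin (k + l), ∏ a, (A (r a) (j a) * A (r a) (j a))) *
          ((f fun a => basisVec u (r a)) * g fun a => basisVec u (r a)) := by
            rw [this, one_mul]; rfl
      _ = _ := by
        rw [Finset.sum_mul]
        refine Finset.sum_congr rfl fun j _ => ?_
        rw [Finset.prod_mul_distrib]
        ring
  · intro s _ hs
    obtain ⟨b, hb⟩ : ∃ b, r b ≠ s b := by
      by_contra! h
      exact hs (funext fun a => (h a).symm)
    have : ∑ j : Fin k → Fin (k + l), ∏ a, (A (r a) (j a) * A (s a) (j a)) = 0 := by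
      have h1 := Finset.prod_univ_sum (fun _ : Fin k => (Finset.univ : Finset (Fin (k + l))))
        fun a j => A (r a) j * A (s a) j
      rw [Fintype.piFinset_univ] at h1
      rw [← h1]
      refine Finset.prod_eq_zero (Finset.mem_univ b) ?_
      simpa [Matrix.mul_apply, hb] using congrFun (congrFun ho (r b)) (s b)
    calc _ = (∑ j : Fin k → Fin (k + l), ∏ a, (A (r a) (j a) * A (s a) (j a))) *
          ((f fun a => basisVec u (r a)) * g fun a => basisVec u (s a)) := by
            rw [Finset.sum_mul]
            refine Finset.sum_congr rfl fun j _ => ?_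
            rw [Finset.prod_mul_distrib]
            ring
      _ = 0 := by rw [this, zero_mul]
  · simp

/-- Reading the identity `val_wedge_contract_modelG2` in both frames gives ⟨v,w⟩' = det A · ⟨v,w⟩,
where A is the change of basis. Hence det A · AᵀA = 1; this forces det A = 1, and A is orthogonal.
-/
theorem frameStar_eq_of_isG2Frame {φ : V [⋀^Fin 3]→L[ℝ] ℝ} {u u' : V ≃L[ℝ] (Fin 7 → ℝ)}
    (hu : IsG2Frame φ u) (hu' : IsG2Frame φ u') {k l : ℕ} (h : k + l = 7)
    (β : V [⋀^Fin k]→L[ℝ] ℝ) : frameStar h u β = frameStar h u' β := by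
  rw [isG2Frame_iff] at hu hu'
  set A := Matrix.of fun i j => coframe u i (basisVec u' j) with hA
  have h1 : ∀ v w, ∑ i, coframe u' i v * coframe u' i w =
      A.det * ∑ i, coframe u i v * coframe u i w := by
    intro v w
    have h2 := val_top_eq_det_mul (k := 2 + 2 + 3) rfl u u'
      (wedge (wedge (contract v φ) (contract w φ)) φ)
    rw [finRange_seven] at h2
    have h3 := val_wedge_contract_modelG2 u v w
    have h4 := val_wedge_contract_modelG2 u' v w
    rw [← hu] at h3
    rw [← hu'] at h4
    rw [h3, h4, ← hA] at h2
    linarith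
  have h2 : A.transpose * (A.det • A) = 1 := by
    ext i j
    have := h1 (basisVec u' i) (basisVec u' j)
    simp only [coframe_basisVec] at this
    have h3 : (if i = j then (1 : ℝ) else 0) =
        A.det * ∑ x, coframe u x (basisVec u' i) * coframe u x (basisVec u' j) := by
      rw [← this]
      simp [eq_comm]
    rw [Matrix.one_apply, h3, Finset.mul_sum, Matrix.mul_apply]
    refine Finset.sum_congr rfl fun x _ => ?_
    simp only [hA, Matrix.transpose_apply, Matrix.smul_apply, Matrix.of_apply, smul_eq_mul]
    ring
  have h3 : A.det = 1 := by
    have h4 := congrArg Matrix.det h2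
    rw [Matrix.det_mul, Matrix.det_transpose, Matrix.det_smul, Matrix.det_one,
      Fintype.card_fin] at h4
    -- One factor comes from Aᵀ, one from A, and seven from the scalar det A in dimension 7. Odd
    -- powers are injective on the reals.
    have h5 : A.det ^ 9 = 1 ^ 9 := by linear_combination h4
    exact (Odd.strictMono_pow (by decide : Odd 9)).injective h5
  rw [h3, one_smul] at h2
  exact frameStar_eq_of_orthogonal h u u' (mul_eq_one_comm.1 h2) h3 β

theorem g2StarAt_eq_frameStar {φ : V [⋀^Fin 3]→L[ℝ] ℝ} (hu : IsG2Frame φ u) {k l : ℕ}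
    (h : k + l = 7) (β : V [⋀^Fin k]→L[ℝ] ℝ) : g2StarAt φ h β = frameStar h u β := by
  have hex : ∃ u : V ≃L[ℝ] (Fin 7 → ℝ), IsG2Frame φ u := ⟨u, hu⟩
  rw [g2StarAt, dif_pos hex]
  exact frameStar_eq_of_isG2Frame hex.choose_spec hu h β

end G2

/-! ### Model forms and components of the torsion in an adapted frame -/

section Torsion

variable {V : Type*} [AddCommGroup V] [Module ℝ V] [TopologicalSpace V]
  (u : V ≃L[ℝ] (Fin 7 → ℝ))

/-- Only the first six covectors of the seven-dimensional frame occur: this is the form ω of the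
six-manifold after pullback to the product. The same holds for the next three definitions. -/
def modelOmega : V [⋀^Fin 2]→L[ℝ] ℝ := elemL u 2 [0, 1] + elemL u 2 [2, 3] + elemL u 2 [4, 5]

def modelPsiPlus : V [⋀^Fin 3]→L[ℝ] ℝ :=
  elemL u 3 [0, 2, 4] - elemL u 3 [0, 3, 5] - elemL u 3 [1, 2, 5] - elemL u 3 [1, 3, 4]

def modelPsiMinus : V [⋀^Fin 3]→L[ℝ] ℝ :=
  -elemL u 3 [1, 3, 5] + elemL u 3 [1, 2, 4] + elemL u 3 [0, 3, 4] + elemL u 3 [0, 2, 5]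

def modelOmegaSq : V [⋀^Fin 4]→L[ℝ] ℝ :=
  (2 : ℝ) • (elemL u 4 [0, 1, 2, 3] + elemL u 4 [0, 1, 4, 5] + elemL u 4 [2, 3, 4, 5])

theorem wedge_modelOmega_self : wedge (modelOmega u) (modelOmega u) = modelOmegaSq u := by
  apply form_ext u
  rw [finRange_seven]
  simp only [List.sublistsLen_succ_cons, List.sublistsLen_zero,
    List.sublistsLen_succ_nil, List.map_cons, List.map_nil, List.cons_append, List.nil_append,
    List.forall_mem_cons, List.not_mem_nil, false_imp_iff, implies_true, and_true]
  simp (disch := decide) only [modelOmega, modelOmegaSq, wedge_add_right, val_wedge_elemL, strip,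
    pull, List.length_cons, List.length_nil,
    Fin.isValue, Fin.reduceEq, reduceIte, val_add, val_smul, val_elemL]
  norm_num

/-- The dual `4`-form of the model `G₂`-form. -/
def modelG2Dual : V [⋀^Fin 4]→L[ℝ] ℝ :=
  elemL u 4 [0, 1, 2, 3] + elemL u 4 [0, 1, 4, 5] + elemL u 4 [2, 3, 4, 5]
    - elemL u 4 [1, 3, 5, 6] + elemL u 4 [1, 2, 4, 6] + elemL u 4 [0, 3, 4, 6]
    + elemL u 4 [0, 2, 5, 6]

theorem frameStar_modelG2 : frameStar (k := 3) (l := 4) rfl u (modelG2 u) = modelG2Dual u := by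
  apply form_ext u
  rw [finRange_seven]
  simp only [List.sublistsLen_succ_cons, List.sublistsLen_zero,
    List.sublistsLen_succ_nil, List.map_cons, List.map_nil, List.cons_append, List.nil_append,
    List.forall_mem_cons, List.not_mem_nil, false_imp_iff, implies_true, and_true]
  simp (maxSteps := 1000000) (disch := decide) only [modelG2, modelG2Dual, val_frameStar,
    finRange_seven, strip, pull, List.length_cons, List.length_nil,
    Fin.isValue, Fin.reduceEq, reduceIte, val_add, val_sub, val_elemL]
  norm_num

/-- This splitting into a form from the six-manifold and a multiple of e⁷ is the shape in which ∗φ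
can be differentiated on the product. -/
theorem modelG2Dual_eq : modelG2Dual u =
    (1 / 2 : ℝ) • modelOmegaSq u + wedge (modelPsiMinus u) (elemL u 1 [6]) := by
  apply form_ext u
  rw [finRange_seven]
  simp only [List.sublistsLen_succ_cons, List.sublistsLen_zero,
    List.sublistsLen_succ_nil, List.map_cons, List.map_nil, List.cons_append, List.nil_append,
    List.forall_mem_cons, List.not_mem_nil, false_imp_iff, implies_true, and_true]
  simp (maxSteps := 1000000) (disch := decide) only [modelG2Dual, modelPsiMinus, modelOmegaSq,
    val_wedge_elemL, strip, pull, List.length_cons, List.length_nil,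
    Fin.isValue, Fin.reduceEq, reduceIte, val_add, val_sub, val_neg, val_smul, val_elemL]
  norm_num

/-- The forms `dφ` and `d * φ` of a warped `G₂`-structure at a point, in terms of the torsion forms of
the `SU(3)`-structure. -/
structure IsWarpedTorsion (z p v : V [⋀^Fin 1]→L[ℝ] ℝ) (p2 s2 : V [⋀^Fin 2]→L[ℝ] ℝ)
    (v3 : V [⋀^Fin 3]→L[ℝ] ℝ) (p0 s0 : ℝ) (X : V [⋀^Fin 4]→L[ℝ] ℝ)
    (Y : V [⋀^Fin 5]→L[ℝ] ℝ) : Prop where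
  horizontal_z : ∀ t, 6 ∈ t → val u z t = 0
  horizontal_p : ∀ t, 6 ∈ t → val u p t = 0
  horizontal_v : ∀ t, 6 ∈ t → val u v t = 0
  horizontal_p2 : ∀ t, 6 ∈ t → val u p2 t = 0
  horizontal_s2 : ∀ t, 6 ∈ t → val u s2 t = 0
  horizontal_v3 : ∀ t, 6 ∈ t → val u v3 t = 0
  p2_psi : wedge p2 (modelPsiPlus u) = 0
  p2_omega : wedge p2 (modelOmegaSq u) = 0
  s2_psi : wedge s2 (modelPsiPlus u) = 0
  s2_omega : wedge s2 (modelOmegaSq u) = 0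
  v3_omega : wedge v3 (modelOmega u) = 0
  v3_psiPlus : wedge v3 (modelPsiPlus u) = 0
  v3_psiMinus : wedge v3 (modelPsiMinus u) = 0
  -- `Q` is dω + z∧ω with z = f⁻¹df, so that `X` = dφ is Q∧e⁷ + dψ₊. Prescribing its components,
  -- rather than the form, lets them be rewritten directly.
  exists_Q : ∃ Q : V [⋀^Fin 3]→L[ℝ] ℝ,
    (∀ t, val u Q t = val u (wedge z (modelOmega u)) t + -(3 / 2) * s0 * val u (modelPsiPlus u) t
      + 3 / 2 * p0 * val u (modelPsiMinus u) t + val u (wedge v (modelOmega u)) t + val u v3 t) ∧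
    ∀ t, val u X t = val u (wedge Q (elemL u 1 [6])) t + p0 * val u (modelOmegaSq u) t
      + val u (wedge p (modelPsiPlus u)) t - val u (wedge p2 (modelOmega u)) t
  -- `S` is dψ₋ + z∧ψ₋. The remaining part of `Y` = d∗φ is ½d(ω²) = dω∧ω, where only ν₁∧ω² survives
  -- because ψ₊, ψ₋ and ν₃ are annihilated by ω.
  exists_S : ∃ S : V [⋀^Fin 4]→L[ℝ] ℝ,
    (∀ t, val u S t = val u (wedge z (modelPsiMinus u)) t + s0 * val u (modelOmegaSq u) t
      + val u (wedge p (modelPsiMinus u)) t - val u (wedge s2 (modelOmega u)) t) ∧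
    ∀ t, val u Y t = val u (wedge v (modelOmegaSq u)) t + val u (wedge S (elemL u 1 [6])) t

/-- `τ₁` at a point, for a frame `u` and `X = dφ`. -/
def frameTau1 (X : V [⋀^Fin 4]→L[ℝ] ℝ) : V [⋀^Fin 1]→L[ℝ] ℝ :=
  (-(1 / 12) : ℝ) • frameStar (k := 3 + 3) (l := 1) rfl u
    (wedge (frameStar (k := 4) (l := 3) rfl u X) (modelG2 u))

/-- `τ₀` at a point. -/
def frameTau0 (X : V [⋀^Fin 4]→L[ℝ] ℝ) : ℝ :=
  (1 / 7 : ℝ) * frameStar (k := 4 + 3) (l := 0) rfl u (wedge X (modelG2 u)) ![]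

/-- `τ₂` at a point, for `X = dφ` and `Y = d * φ`. -/
def frameTau2 (X : V [⋀^Fin 4]→L[ℝ] ℝ) (Y : V [⋀^Fin 5]→L[ℝ] ℝ) : V [⋀^Fin 2]→L[ℝ] ℝ :=
  - frameStar (k := 5) (l := 2) rfl u Y
    + (4 : ℝ) • frameStar (k := 1 + 4) (l := 2) rfl u (wedge (frameTau1 u X)
      (frameStar (k := 3) (l := 4) rfl u (modelG2 u)))

/-- `τ₃` at a point. -/
def frameTau3 (X : V [⋀^Fin 4]→L[ℝ] ℝ) : V [⋀^Fin 3]→L[ℝ] ℝ :=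
  frameStar (k := 4) (l := 3) rfl u X - frameTau0 u X • modelG2 u
    - (3 : ℝ) • frameStar (k := 1 + 3) (l := 3) rfl u (wedge (frameTau1 u X) (modelG2 u))

theorem frameTau0_eq_val (X : V [⋀^Fin 4]→L[ℝ] ℝ) : frameTau0 u X =
    (1 / 7 : ℝ) * val u (frameStar (k := 4 + 3) (l := 0) rfl u (wedge X (modelG2 u))) [] := by
  rw [val_of_length u _ (t := []) rfl, frameTau0]
  congr 2
  exact Subsingleton.elim _ _

/-- The six components of b∧ψ₊ = 0 say that b has type (1,1), and the component of b∧ω² = 0 that it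
is primitive. They leave an eight-dimensional space of forms without e⁷. -/
theorem primitive_rel (u : V ≃L[ℝ] (Fin 7 → ℝ)) {b : V [⋀^Fin 2]→L[ℝ] ℝ}
    (hb : wedge b (modelPsiPlus u) = 0) (hb' : wedge b (modelOmegaSq u) = 0) :
    -val u b [3, 4] - val u b [2, 5] = 0 ∧ -val u b [3, 5] + val u b [2, 4] = 0 ∧
    val u b [1, 4] + val u b [0, 5] = 0 ∧ val u b [1, 5] - val u b [0, 4] = 0 ∧
    -val u b [1, 2] - val u b [0, 3] = 0 ∧ -val u b [1, 3] + val u b [0, 2] = 0 ∧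
    val u b [4, 5] + val u b [2, 3] + val u b [0, 1] = 0 := by
  have h1 := congrArg (val u · [1, 2, 3, 4, 5]) hb
  have h2 := congrArg (val u · [0, 2, 3, 4, 5]) hb
  have h3 := congrArg (val u · [0, 1, 3, 4, 5]) hb
  have h4 := congrArg (val u · [0, 1, 2, 4, 5]) hb
  have h5 := congrArg (val u · [0, 1, 2, 3, 5]) hb
  have h6 := congrArg (val u · [0, 1, 2, 3, 4]) hb
  have h7 := congrArg (val u · [0, 1, 2, 3, 4, 5]) hb'
  simp (disch := decide) only [modelPsiPlus, modelOmegaSq, wedge_add_right, wedge_sub_right, wedge_smul_right,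
    val_wedge_elemL, strip, pull, List.length_cons, List.length_nil,
    Fin.isValue, Fin.reduceEq, reduceIte, val_add, val_sub, val_smul, val_zero] at h1 h2 h3 h4 h5 h6 h7
  norm_num at h1 h2 h3 h4 h5 h6 h7
  exact ⟨h1, h2, h3, h4, h5, h6, h7⟩

variable {u}
variable {z p v : V [⋀^Fin 1]→L[ℝ] ℝ} {p2 s2 : V [⋀^Fin 2]→L[ℝ] ℝ}
    {v3 : V [⋀^Fin 3]→L[ℝ] ℝ} {p0 s0 : ℝ} {X : V [⋀^Fin 4]→L[ℝ] ℝ}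
    {Y : V [⋀^Fin 5]→L[ℝ] ℝ}

theorem IsWarpedTorsion.p2_rel
    (h : IsWarpedTorsion u z p v p2 s2 v3 p0 s0 X Y) :
    -val u p2 [3, 4] - val u p2 [2, 5] = 0 ∧ -val u p2 [3, 5] + val u p2 [2, 4] = 0 ∧
    val u p2 [1, 4] + val u p2 [0, 5] = 0 ∧ val u p2 [1, 5] - val u p2 [0, 4] = 0 ∧
    -val u p2 [1, 2] - val u p2 [0, 3] = 0 ∧ -val u p2 [1, 3] + val u p2 [0, 2] = 0 ∧
    val u p2 [4, 5] + val u p2 [2, 3] + val u p2 [0, 1] = 0 :=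
  primitive_rel u h.p2_psi h.p2_omega

theorem IsWarpedTorsion.s2_rel
    (h : IsWarpedTorsion u z p v p2 s2 v3 p0 s0 X Y) :
    -val u s2 [3, 4] - val u s2 [2, 5] = 0 ∧ -val u s2 [3, 5] + val u s2 [2, 4] = 0 ∧
    val u s2 [1, 4] + val u s2 [0, 5] = 0 ∧ val u s2 [1, 5] - val u s2 [0, 4] = 0 ∧
    -val u s2 [1, 2] - val u s2 [0, 3] = 0 ∧ -val u s2 [1, 3] + val u s2 [0, 2] = 0 ∧
    val u s2 [4, 5] + val u s2 [2, 3] + val u s2 [0, 1] = 0 :=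
  primitive_rel u h.s2_psi h.s2_omega

theorem IsWarpedTorsion.v3_rel
    (h : IsWarpedTorsion u z p v p2 s2 v3 p0 s0 X Y) :
    val u v3 [1, 4, 5] + val u v3 [1, 2, 3] = 0 ∧ val u v3 [0, 4, 5] + val u v3 [0, 2, 3] = 0 ∧
    val u v3 [3, 4, 5] + val u v3 [0, 1, 3] = 0 ∧ val u v3 [2, 4, 5] + val u v3 [0, 1, 2] = 0 ∧
    val u v3 [2, 3, 5] + val u v3 [0, 1, 5] = 0 ∧ val u v3 [2, 3, 4] + val u v3 [0, 1, 4] = 0 ∧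
    val u v3 [1, 3, 5] - val u v3 [1, 2, 4] - val u v3 [0, 3, 4] - val u v3 [0, 2, 5] = 0 ∧
    val u v3 [0, 2, 4] + -val u v3 [0, 3, 5] + -val u v3 [1, 2, 5] + -val u v3 [1, 3, 4] = 0 := by
  have h1 := congrArg (val u · [1, 2, 3, 4, 5]) h.v3_omega
  have h2 := congrArg (val u · [0, 2, 3, 4, 5]) h.v3_omega
  have h3 := congrArg (val u · [0, 1, 3, 4, 5]) h.v3_omega
  have h4 := congrArg (val u · [0, 1, 2, 4, 5]) h.v3_omega
  have h5 := congrArg (val u · [0, 1, 2, 3, 5]) h.v3_omega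
  have h6 := congrArg (val u · [0, 1, 2, 3, 4]) h.v3_omega
  have h7 := congrArg (val u · [0, 1, 2, 3, 4, 5]) h.v3_psiPlus
  have h8 := congrArg (val u · [0, 1, 2, 3, 4, 5]) h.v3_psiMinus
  simp (disch := decide) only [modelOmega, modelPsiPlus, modelPsiMinus, wedge_add_right,
    wedge_sub_right, wedge_neg_right, val_wedge_elemL, strip, pull, List.length_cons, List.length_nil,
    Fin.isValue, Fin.reduceEq, reduceIte, val_add, val_sub, val_neg, val_zero]
    at h1 h2 h3 h4 h5 h6 h7 h8
  norm_num at h1 h2 h3 h4 h5 h6 h7 h8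
  exact ⟨h1, h2, h3, h4, h5, h6, h7, h8⟩

/-- The twenty components containing the index `6` are those of dω + z∧ω; the fifteen others are
those of dψ₊. -/
theorem IsWarpedTorsion.val_X
    (h : IsWarpedTorsion u z p v p2 s2 v3 p0 s0 X Y) :
    val u X [3, 4, 5, 6] = val u z [3] + val u v [3] + val u v3 [3, 4, 5] ∧
    val u X [2, 4, 5, 6] = val u z [2] + val u v [2] + val u v3 [2, 4, 5] ∧
    val u X [2, 3, 5, 6] = val u z [5] + val u v [5] + val u v3 [2, 3, 5] ∧
    val u X [2, 3, 4, 6] = val u z [4] + val u v [4] + val u v3 [2, 3, 4] ∧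
    val u X [2, 3, 4, 5] = p0 * 2 - (val u p2 [4, 5] + val u p2 [2, 3]) ∧
    val u X [1, 4, 5, 6] = val u z [1] + val u v [1] + val u v3 [1, 4, 5] ∧
    val u X [1, 3, 5, 6] = -(3 / 2 * p0) + val u v3 [1, 3, 5] ∧
    val u X [1, 3, 4, 6] = 3 / 2 * s0 + val u v3 [1, 3, 4] ∧
    val u X [1, 3, 4, 5] = val u p [5] - val u p2 [1, 3] ∧
    val u X [1, 2, 5, 6] = 3 / 2 * s0 + val u v3 [1, 2, 5] ∧
    val u X [1, 2, 4, 6] = 3 / 2 * p0 + val u v3 [1, 2, 4] ∧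
    val u X [1, 2, 4, 5] = -val u p [4] - val u p2 [1, 2] ∧
    val u X [1, 2, 3, 6] = val u z [1] + val u v [1] + val u v3 [1, 2, 3] ∧
    val u X [1, 2, 3, 5] = -val u p [3] - val u p2 [1, 5] ∧
    val u X [1, 2, 3, 4] = val u p [2] - val u p2 [1, 4] ∧
    val u X [0, 4, 5, 6] = val u z [0] + val u v [0] + val u v3 [0, 4, 5] ∧
    val u X [0, 3, 5, 6] = 3 / 2 * s0 + val u v3 [0, 3, 5] ∧
    val u X [0, 3, 4, 6] = 3 / 2 * p0 + val u v3 [0, 3, 4] ∧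
    val u X [0, 3, 4, 5] = -val u p [4] - val u p2 [0, 3] ∧
    val u X [0, 2, 5, 6] = 3 / 2 * p0 + val u v3 [0, 2, 5] ∧
    val u X [0, 2, 4, 6] = -(3 / 2 * s0) + val u v3 [0, 2, 4] ∧
    val u X [0, 2, 4, 5] = -val u p [5] - val u p2 [0, 2] ∧
    val u X [0, 2, 3, 6] = val u z [0] + val u v [0] + val u v3 [0, 2, 3] ∧
    val u X [0, 2, 3, 5] = val u p [2] - val u p2 [0, 5] ∧
    val u X [0, 2, 3, 4] = val u p [3] - val u p2 [0, 4] ∧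
    val u X [0, 1, 5, 6] = val u z [5] + val u v [5] + val u v3 [0, 1, 5] ∧
    val u X [0, 1, 4, 6] = val u z [4] + val u v [4] + val u v3 [0, 1, 4] ∧
    val u X [0, 1, 4, 5] = p0 * 2 - (val u p2 [4, 5] + val u p2 [0, 1]) ∧
    val u X [0, 1, 3, 6] = val u z [3] + val u v [3] + val u v3 [0, 1, 3] ∧
    val u X [0, 1, 3, 5] = val u p [1] - val u p2 [3, 5] ∧
    val u X [0, 1, 3, 4] = -val u p [0] - val u p2 [3, 4] ∧
    val u X [0, 1, 2, 6] = val u z [2] + val u v [2] + val u v3 [0, 1, 2] ∧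
    val u X [0, 1, 2, 5] = -val u p [0] - val u p2 [2, 5] ∧
    val u X [0, 1, 2, 4] = -val u p [1] - val u p2 [2, 4] ∧
    val u X [0, 1, 2, 3] = p0 * 2 - (val u p2 [2, 3] + val u p2 [0, 1]) := by
  obtain ⟨Q, hQ, hX⟩ := h.exists_Q
  simp (maxSteps := 1000000) (disch := decide) only [hX, hQ, modelOmega, modelPsiPlus,
    modelPsiMinus, modelOmegaSq, wedge_add_right, wedge_sub_right, h.horizontal_p,
    h.horizontal_p2,
    val_wedge_elemL, strip, pull, List.length_cons, List.length_nil,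
    Fin.isValue, Fin.reduceEq, reduceIte, val_add, val_sub, val_neg, val_smul, val_elemL]
  norm_num

/-- Here dφ∧φ = 12p₀ vol: p₀ω²∧ω∧e⁷ contributes 6 since ω³ = 6e¹²³⁴⁵⁶, and (3/2)p₀ψ₋∧e⁷∧ψ₊
contributes 6 since ψ₊∧ψ₋ = 4e¹²³⁴⁵⁶. The other terms cancel by the relations defining Ω²₈ and Ω³₁₂.
-/
theorem IsWarpedTorsion.tau0_eq
    (h : IsWarpedTorsion u z p v p2 s2 v3 p0 s0 X Y) : frameTau0 u X = 12 / 7 * p0 := by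
  rw [frameTau0_eq_val]
  simp (maxSteps := 1000000) (disch := decide) only [modelG2, wedge_add_right, wedge_sub_right,
    val_frameStar, finRange_seven, h.val_X,
    val_wedge_elemL, strip, pull, List.length_cons, List.length_nil,
    Fin.isValue, Fin.reduceEq, reduceIte, val_add, val_sub]
  norm_num
  obtain ⟨h1, h2, h3, h4, h5, h6, h7, h8⟩ := h.v3_rel
  obtain ⟨g1, g2, g3, g4, g5, g6, g7⟩ := h.p2_rel
  linarith

/-- That is, τ₁ = η₁/6 + s₀e⁷/2. The contributions of ν₃ and p₂ disappear by their linear relations.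
-/
theorem IsWarpedTorsion.val_tau1
    (h : IsWarpedTorsion u z p v p2 s2 v3 p0 s0 X Y) :
    val u (frameTau1 u X) [0] = 1 / 6 * (val u z [0] + val u p [0] + val u v [0]) ∧
    val u (frameTau1 u X) [1] = 1 / 6 * (val u z [1] + val u p [1] + val u v [1]) ∧
    val u (frameTau1 u X) [2] = 1 / 6 * (val u z [2] + val u p [2] + val u v [2]) ∧
    val u (frameTau1 u X) [3] = 1 / 6 * (val u z [3] + val u p [3] + val u v [3]) ∧
    val u (frameTau1 u X) [4] = 1 / 6 * (val u z [4] + val u p [4] + val u v [4]) ∧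
    val u (frameTau1 u X) [5] = 1 / 6 * (val u z [5] + val u p [5] + val u v [5]) ∧
    val u (frameTau1 u X) [6] = 1 / 2 * s0 := by
  simp (maxSteps := 1000000) (disch := decide) only [frameTau1, modelG2, wedge_add_right,
    wedge_sub_right,
    val_frameStar, finRange_seven, h.val_X,
    val_wedge_elemL, strip, pull, List.length_cons, List.length_nil,
    Fin.isValue, Fin.reduceEq, reduceIte, val_add, val_sub, val_smul]
  norm_num
  obtain ⟨h1, h2, h3, h4, h5, h6, h7, h8⟩ := h.v3_rel
  obtain ⟨g1, g2, g3, g4, g5, g6, g7⟩ := h.p2_rel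
  refine ⟨?_, ?_, ?_, ?_, ?_, ?_, ?_⟩ <;> linarith

end Torsion

/-! ### Vanishing of the torsion forms in an adapted frame -/

section Torsion

variable {V : Type*} [AddCommGroup V] [Module ℝ V] [TopologicalSpace V]

theorem form_eq_zero_iff {n : ℕ} [NeZero n] (u : V ≃L[ℝ] (Fin n → ℝ)) {k : ℕ}
    (a : V [⋀^Fin k]→L[ℝ] ℝ) :
    a = 0 ↔ ∀ t ∈ List.sublistsLen k (List.finRange n), val u a t = 0 :=
  ⟨fun h t _ => by rw [h, val_zero], fun h => form_ext u fun t ht => by rw [h t ht, val_zero]⟩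

variable {u : V ≃L[ℝ] (Fin 7 → ℝ)}
variable {z p v : V [⋀^Fin 1]→L[ℝ] ℝ} {p2 s2 : V [⋀^Fin 2]→L[ℝ] ℝ}
    {v3 : V [⋀^Fin 3]→L[ℝ] ℝ} {p0 s0 : ℝ} {X : V [⋀^Fin 4]→L[ℝ] ℝ}
    {Y : V [⋀^Fin 5]→L[ℝ] ℝ}

theorem IsWarpedTorsion.tau0_eq_zero_iff
    (h : IsWarpedTorsion u z p v p2 s2 v3 p0 s0 X Y) : frameTau0 u X = 0 ↔ p0 = 0 := by
  rw [h.tau0_eq]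
  constructor <;> intro <;> linarith

theorem IsWarpedTorsion.tau1_eq_zero_iff
    (h : IsWarpedTorsion u z p v p2 s2 v3 p0 s0 X Y) : frameTau1 u X = 0 ↔ s0 = 0 ∧ z + p + v = 0 := by
  rw [form_eq_zero_iff u, form_eq_zero_iff u, finRange_seven]
  simp only [List.sublistsLen_succ_cons, List.sublistsLen_zero,
    List.sublistsLen_succ_nil, List.map_cons, List.map_nil, List.cons_append, List.nil_append,
    List.forall_mem_cons, List.not_mem_nil, false_imp_iff, implies_true, and_true]
  simp (disch := decide) only [h.val_tau1, h.horizontal_z, h.horizontal_p, h.horizontal_v, val_add]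
  constructor
  -- The index lists are enumerated from [6] down to [0]. The index `6` of τ₁ gives s₀, while the
  -- component of η₁ with this index is trivially zero.
  · rintro ⟨h6, h5, h4, h3, h2, h1, h0⟩
    refine ⟨?_, ?_, ?_, ?_, ?_, ?_, ?_, ?_⟩ <;> linarith
  · rintro ⟨h6, -, h5, h4, h3, h2, h1, h0⟩
    refine ⟨?_, ?_, ?_, ?_, ?_, ?_, ?_⟩ <;> linarith

set_option maxHeartbeats 4000000 in
-- The 35 equations and the 15 relations on p₂ and ν₃ have only the trivial solution in p₀, η₃, p₂,
-- ν₃, of dimensions 1+6+8+12 = 27, the dimension of the module of τ₃.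
theorem IsWarpedTorsion.tau3_eq_zero_iff
    (h : IsWarpedTorsion u z p v p2 s2 v3 p0 s0 X Y) :
    frameTau3 u X = 0 ↔ p0 = 0 ∧ z - p + v = 0 ∧ p2 = 0 ∧ v3 = 0 := by
  rw [form_eq_zero_iff u (frameTau3 u X), form_eq_zero_iff u p2, form_eq_zero_iff u (z - p + v),
    form_eq_zero_iff u v3, finRange_seven]
  simp only [List.sublistsLen_succ_cons, List.sublistsLen_zero,
    List.sublistsLen_succ_nil, List.map_cons, List.map_nil, List.cons_append, List.nil_append,
    List.forall_mem_cons, List.not_mem_nil, false_imp_iff, implies_true, and_true]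
  simp (maxSteps := 1000000) (disch := decide) only [frameTau3, modelG2, wedge_add_right,
    wedge_sub_right, val_frameStar, finRange_seven, h.val_X, h.val_tau1, h.tau0_eq,
    h.horizontal_z, h.horizontal_p, h.horizontal_v, h.horizontal_p2, h.horizontal_v3,
    val_wedge_elemL, strip, pull, List.length_cons, List.length_nil,
    Fin.isValue, Fin.reduceEq, reduceIte, val_add, val_sub, val_smul, val_elemL]
  norm_num
  obtain ⟨h1, h2, h3, h4, h5, h6, h7, h8⟩ := h.v3_rel
  obtain ⟨g1, g2, g3, g4, g5, g6, g7⟩ := h.p2_rel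
  clear h
  constructor
  · rintro
      ⟨e0, e1, e2, e3, e4, e5, e6, e7, e8, e9, e10, e11, e12, e13, e14, e15, e16, e17, e18, e19,
      e20, e21, e22, e23, e24, e25, e26, e27, e28, e29, e30, e31, e32, e33, e34⟩
    -- The equations decouple into eight blocks. Six of them contain one component of η₃ each, with
    -- off-diagonal components of p₂ and components of ν₃. Another contains p₀, the diagonal
    -- components of p₂ and four of ν₃, and the last one the other four components of ν₃.
    exact
      ⟨by linarith only [h7, g7, e0, e7, e15, e17, e24, e28, e30],
      ⟨by linarith only [h5, g6, e9, e13, e26, e32],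
      by linarith only [h6, g5, e8, e16, e23, e31],
      by linarith only [h3, g4, e6, e10, e21, e34],
      by linarith only [h4, g3, e3, e11, e20, e33],
      by linarith only [h1, g2, e1, e5, e22, e29],
      by linarith only [h2, g1, e2, e4, e12, e19]⟩,
      ⟨by linarith only [h7, g7, e0, e7, e15, e17, e24, e28, e30],
      by linarith only [h1, g2, e1, e5, e22, e29],
      by linarith only [h2, g1, e2, e4, e12, e19],
      by linarith only [h2, g1, e2, e4, e12, e19],
      by linarith only [h1, g2, e1, e5, e22, e29],
      by linarith only [h7, g7, e0, e7, e15, e17, e24, e28, e30],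
      by linarith only [h3, g4, e6, e10, e21, e34],
      by linarith only [h4, g3, e3, e11, e20, e33],
      by linarith only [h5, g6, e9, e13, e26, e32],
      by linarith only [h6, g5, e8, e16, e23, e31],
      by linarith only [h4, g3, e3, e11, e20, e33],
      by linarith only [h3, g4, e6, e10, e21, e34],
      by linarith only [h6, g5, e8, e16, e23, e31],
      by linarith only [h5, g6, e9, e13, e26, e32],
      by linarith only [h7, g7, e0, e7, e15, e17, e24, e28, e30]⟩,
      by linarith only [h3, g4, e6, e10, e21, e34],
      by linarith only [h4, g3, e3, e11, e20, e33],
      by linarith only [h5, g6, e9, e13, e26, e32],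
      by linarith only [h6, g5, e8, e16, e23, e31],
      by linarith only [h1, g2, e1, e5, e22, e29],
      by linarith only [h7, g7, e0, e7, e15, e17, e24, e28, e30],
      by linarith only [h8, e14, e18, e25, e27],
      by linarith only [h8, e14, e18, e25, e27],
      by linarith only [h7, g7, e0, e7, e15, e17, e24, e28, e30],
      by linarith only [h1, g2, e1, e5, e22, e29],
      by linarith only [h2, g1, e2, e4, e12, e19],
      by linarith only [h8, e14, e18, e25, e27],
      by linarith only [h7, g7, e0, e7, e15, e17, e24, e28, e30],
      by linarith only [h7, g7, e0, e7, e15, e17, e24, e28, e30],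
      by linarith only [h8, e14, e18, e25, e27],
      by linarith only [h2, g1, e2, e4, e12, e19],
      by linarith only [h5, g6, e9, e13, e26, e32],
      by linarith only [h6, g5, e8, e16, e23, e31],
      by linarith only [h3, g4, e6, e10, e21, e34],
      by linarith only [h4, g3, e3, e11, e20, e33]⟩
  · rintro ⟨rfl, ⟨z5, z4, z3, z2, z1, z0⟩, hp2, hv3⟩
    simp only [hp2, hv3]
    refine ⟨?_, ?_, ?_, ?_, ?_, ?_, ?_, ?_, ?_, ?_, ?_, ?_, ?_, ?_, ?_, ?_, ?_, ?_, ?_, ?_, ?_, ?_, ?_,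
      ?_, ?_, ?_, ?_, ?_, ?_, ?_, ?_, ?_, ?_, ?_, ?_⟩ <;> linarith only [z5, z4, z3, z2, z1, z0]

set_option maxHeartbeats 4000000 in
-- The terms −2s₀ω from d∗φ and 2s₀ω from τ₁∧∗φ cancel. What is left are η₂ and s₂, of dimensions
-- 6+8 = 14, the dimension of the module of τ₂.
theorem IsWarpedTorsion.tau2_eq_zero_iff
    (h : IsWarpedTorsion u z p v p2 s2 v3 p0 s0 X Y) :
    frameTau2 u X Y = 0 ↔ z + p - (2 : ℝ) • v = 0 ∧ s2 = 0 := by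
  obtain ⟨S, hS, hY⟩ := h.exists_S
  rw [form_eq_zero_iff u (frameTau2 u X Y), form_eq_zero_iff u (z + p - (2 : ℝ) • v),
    form_eq_zero_iff u s2, finRange_seven]
  simp only [List.sublistsLen_succ_cons, List.sublistsLen_zero,
    List.sublistsLen_succ_nil, List.map_cons, List.map_nil, List.cons_append, List.nil_append,
    List.forall_mem_cons, List.not_mem_nil, false_imp_iff, implies_true, and_true]
  simp (maxSteps := 1000000) (disch := decide) only [frameTau2, frameStar_modelG2, modelG2Dual,
    wedge_add_right, wedge_sub_right, wedge_smul_right, wedge_neg_right, hS, hY, modelOmegaSq,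
    modelPsiMinus, modelOmega, h.horizontal_p, h.horizontal_s2, h.horizontal_z, h.horizontal_v,
    val_frameStar, finRange_seven, h.val_tau1,
    val_wedge_elemL, strip, pull, List.length_cons, List.length_nil,
    Fin.isValue, Fin.reduceEq, reduceIte, val_add, val_sub, val_neg, val_smul, val_elemL]
  norm_num
  obtain ⟨g1, g2, g3, g4, g5, g6, g7⟩ := h.s2_rel
  clear h hS hY
  constructor
  · rintro
      ⟨e0, e1, e2, e3, e4, e5, e6, e7, e8, e9, e10, e11, e12, e13, e14, e15, e16, e17, e18, e19,
      e20⟩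
    -- There are seven blocks of three equations: six contain one component of η₂ and off-diagonal
    -- components of s₂, and the seventh only the diagonal components of s₂.
    exact
      ⟨⟨by linarith only [g5, e1, e14, e18],
      by linarith only [g6, e0, e13, e19],
      by linarith only [g3, e6, e12, e16],
      by linarith only [g4, e3, e11, e17],
      by linarith only [g1, e5, e7, e15],
      by linarith only [g2, e4, e8, e10]⟩,
      by linarith only [g7, e2, e9, e20],
      by linarith only [g2, e4, e8, e10],
      by linarith only [g1, e5, e7, e15],
      by linarith only [g1, e5, e7, e15],
      by linarith only [g2, e4, e8, e10],
      by linarith only [g7, e2, e9, e20],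
      by linarith only [g4, e3, e11, e17],
      by linarith only [g3, e6, e12, e16],
      by linarith only [g6, e0, e13, e19],
      by linarith only [g5, e1, e14, e18],
      by linarith only [g3, e6, e12, e16],
      by linarith only [g4, e3, e11, e17],
      by linarith only [g5, e1, e14, e18],
      by linarith only [g6, e0, e13, e19],
      by linarith only [g7, e2, e9, e20]⟩
  · rintro ⟨⟨z5, z4, z3, z2, z1, z0⟩, hs2⟩
    simp only [hs2]
    refine ⟨?_, ?_, ?_, ?_, ?_, ?_, ?_, ?_, ?_, ?_, ?_, ?_, ?_, ?_, ?_, ?_, ?_, ?_, ?_, ?_, ?_⟩ <;>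
      linarith only [z5, z4, z3, z2, z1, z0]

end Torsion

section OneForms

variable {E : Type*} [NormedAddCommGroup E] [NormedSpace ℝ E]

/-! ## Wedge products with `1`-forms and the exterior derivative -/

open ContinuousAlternatingMap

theorem sign_mul_self_real {ι : Type*} [Fintype ι] [DecidableEq ι] (σ : Equiv.Perm ι) :
    ((Equiv.Perm.sign σ : ℤ) : ℝ) * ((Equiv.Perm.sign σ : ℤ) : ℝ) = 1 := by
  rcases Int.units_eq_one_or (Equiv.Perm.sign σ) with h | h <;> simp [h]

/-- The permutation moving the last position to `i` and permuting the other ones by `τ`. -/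
def lastPerm {k : ℕ} (p : Fin (k + 1) × Equiv.Perm (Fin k)) : Equiv.Perm (Fin (k + 1)) :=
  p.1.cycleRange.symm * finRotate (k + 1) * blockPerm p.2 1

theorem lastPerm_castSucc {k : ℕ} (p : Fin (k + 1) × Equiv.Perm (Fin k)) (j : Fin k) :
    lastPerm p j.castSucc = p.1.succAbove (p.2 j) := by
  have : blockPerm p.2 (1 : Equiv.Perm (Fin 1)) j.castSucc = (p.2 j).castSucc :=
    blockPerm_castAdd p.2 1 j
  simp only [lastPerm, Equiv.Perm.mul_apply, this, finRotate_apply]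
  rw [Fin.coeSucc_eq_succ, Fin.cycleRange_symm_succ]

theorem lastPerm_last {k : ℕ} (p : Fin (k + 1) × Equiv.Perm (Fin k)) :
    lastPerm p (Fin.last k) = p.1 := by
  have : blockPerm p.2 (1 : Equiv.Perm (Fin 1)) (Fin.last k) = Fin.last k :=
    blockPerm_natAdd p.2 1 0
  simp only [lastPerm, Equiv.Perm.mul_apply, this, finRotate_last]
  rw [Fin.cycleRange_symm_zero]

theorem sign_lastPerm {k : ℕ} (p : Fin (k + 1) × Equiv.Perm (Fin k)) :
    Equiv.Perm.sign (lastPerm p) = (-1) ^ (p.1 : ℕ) * (-1) ^ k * Equiv.Perm.sign p.2 := by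
  rw [lastPerm, Equiv.Perm.sign_mul, Equiv.Perm.sign_mul, sign_blockPerm, sign_finRotate,
    Equiv.Perm.sign_symm, Fin.sign_cycleRange, Equiv.Perm.sign_one, mul_one,
    Nat.add_sub_cancel]

theorem lastPerm_bijective (k : ℕ) : Function.Bijective (lastPerm (k := k)) := by
  rw [Fintype.bijective_iff_injective_and_card]
  constructor
  · intro p q h
    have h1 : p.1 = q.1 := by rw [← lastPerm_last p, h, lastPerm_last]
    refine Prod.ext h1 (Equiv.ext fun j => ?_)
    have h2 := lastPerm_castSucc p j
    rw [h, lastPerm_castSucc, h1] at h2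
    exact (Fin.succAbove_right_injective h2).symm
  · simp [Fintype.card_perm, Nat.factorial_succ]

/-- A permutation is given by the position i sent to the last slot, where `L` acts, and a
permutation of the others; the k! choices of the latter agree because `a` is alternating. -/
theorem wedge_oneForm_apply {k : ℕ} (a : E [⋀^Fin k]→L[ℝ] ℝ) (L : E →L[ℝ] ℝ)
    (v : Fin (k + 1) → E) : wedge a (oneForm L) v =
      (-1) ^ k * ∑ i : Fin (k + 1), (-1) ^ (i : ℕ) * (L (v i) * a (i.removeNth v)) := by
  have h1 : wedge a (oneForm L) v = (k.factorial : ℝ)⁻¹ * ∑ σ : Equiv.Perm (Fin (k + 1)),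
      ((Equiv.Perm.sign σ : ℤ) : ℝ) * (a (fun j => v (σ j.castSucc)) * L (v (σ (Fin.last k)))) := by
    rw [wedge_apply, Nat.factorial_one, Nat.cast_one, mul_one]
    congr 1
    refine Fintype.sum_equiv (finSumFinEquiv (m := k) (n := 1)).permCongr _ _ fun σ => ?_
    rw [Equiv.Perm.sign_permCongr]
    have h3 : ∀ j : Fin k, finSumFinEquiv.symm j.castSucc = (Sum.inl j : Fin k ⊕ Fin 1) :=
      fun j => finSumFinEquiv_symm_apply_castAdd j
    have h4 : finSumFinEquiv.symm (Fin.last k) = (Sum.inr 0 : Fin k ⊕ Fin 1) :=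
      finSumFinEquiv_symm_apply_natAdd 0
    simp only [Equiv.permCongr_apply, h3, h4]
    rfl
  have h2 : ∀ p : Fin (k + 1) × Equiv.Perm (Fin k), ((Equiv.Perm.sign (lastPerm p) : ℤ) : ℝ) *
      (a (fun j => v (lastPerm p j.castSucc)) * L (v (lastPerm p (Fin.last k)))) =
      (-1) ^ k * ((-1) ^ (p.1 : ℕ) * (L (v p.1) * a (p.1.removeNth v))) := by
    intro p
    have h3 := a.toAlternatingMap.map_perm (p.1.removeNth v) p.2
    change a (fun j => v (p.1.succAbove (p.2 j))) = _ at h3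
    simp only [lastPerm_castSucc, lastPerm_last, sign_lastPerm]
    rw [h3, Units.smul_def, zsmul_eq_mul]
    change _ * (_ * a _ * _) = _
    push_cast
    linear_combination ((-1) ^ k * ((-1) ^ (p.1 : ℕ) * (L (v p.1) * a (p.1.removeNth v)))) *
      sign_mul_self_real p.2
  rw [h1, ← (lastPerm_bijective k).sum_comp, Finset.sum_congr rfl fun p _ => h2 p,
    Fintype.sum_prod_type, inv_mul_eq_iff_eq_mul₀ (by positivity), Finset.mul_sum, Finset.mul_sum]
  refine Finset.sum_congr rfl fun i _ => ?_
  simp [Fintype.card_perm]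

/-- Expresses the product with a 1-form through the alternatization that defines `extDeriv`. There
the covector stands in front, whence the sign (−1)^k. -/
theorem wedge_oneForm {k : ℕ} (a : E [⋀^Fin k]→L[ℝ] ℝ) (L : E →L[ℝ] ℝ) :
    wedge a (oneForm L) = (-1 : ℝ) ^ k • alternatizeUncurryFin (L.smulRight a) := by
  refine ContinuousAlternatingMap.ext fun v => ?_
  rw [wedge_oneForm_apply, ContinuousAlternatingMap.smul_apply, alternatizeUncurryFin_apply,
    smul_eq_mul]
  congr 1
  refine Finset.sum_congr rfl fun i _ => ?_
  rw [zsmul_eq_mul]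
  push_cast
  rfl

/-- The products have degrees k+l and l+k, which are compared through a common m. The sign is kept
as that of an explicit block exchange, so that it can be decided for given degrees. -/
theorem wedge_swap {k l m : ℕ} (hkl : k + l = m) (hlk : l + k = m) (a : E [⋀^Fin k]→L[ℝ] ℝ)
    (b : E [⋀^Fin l]→L[ℝ] ℝ) (v : Fin m → E) :
    wedge a b (fun i => v (Fin.cast hkl i)) =
      ((Equiv.Perm.sign ((finSumFinEquiv.trans ((finCongr (hkl.trans hlk.symm)).trans
        finSumFinEquiv.symm)).trans (Equiv.sumComm (Fin l) (Fin k))) : ℤ) : ℝ) *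
      wedge b a (fun i => v (Fin.cast hlk i)) := by
  set θ : Fin k ⊕ Fin l ≃ Fin l ⊕ Fin k := finSumFinEquiv.trans
    ((finCongr (hkl.trans hlk.symm)).trans finSumFinEquiv.symm) with hθ
  rw [wedge_apply, wedge_apply, mul_left_comm, mul_comm (l.factorial : ℝ)]
  congr 1
  rw [Finset.mul_sum]
  let F : Equiv.Perm (Fin k ⊕ Fin l) ≃ Equiv.Perm (Fin l ⊕ Fin k) :=
    (Equiv.mulRight (θ.trans (Equiv.sumComm _ _))).trans θ.permCongr
  refine Fintype.sum_equiv F _ _ fun σ => ?_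
  have h1 : ∀ x, F σ x = θ (σ (Equiv.sumComm _ _ x)) := by
    intro x
    simp [F, Equiv.permCongr_apply]
  have h2 : Equiv.Perm.sign (F σ) =
      Equiv.Perm.sign σ * Equiv.Perm.sign (θ.trans (Equiv.sumComm (Fin l) (Fin k))) := by
    simp only [F, Equiv.trans_apply, Equiv.Perm.sign_permCongr, Equiv.coe_mulRight,
      Equiv.Perm.sign_mul]
  have h3 : ∀ x, Fin.cast hlk (finSumFinEquiv (θ x)) = Fin.cast hkl (finSumFinEquiv x) := by
    intro x
    simp [hθ]
  simp only [h1, h2, h3, Equiv.sumComm_apply, Sum.swap_inl, Sum.swap_inr]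
  push_cast
  linear_combination (-((Equiv.Perm.sign σ : ℤ) : ℝ) *
    (a (fun i => v (Fin.cast hkl (finSumFinEquiv (σ (Sum.inl i))))) *
      b (fun i => v (Fin.cast hkl (finSumFinEquiv (σ (Sum.inr i))))))) *
    sign_mul_self_real (θ.trans (Equiv.sumComm (Fin l) (Fin k)))

theorem oneForm_wedge_two (L : E →L[ℝ] ℝ) (a : E [⋀^Fin 2]→L[ℝ] ℝ) :
    wedge (oneForm L) a = (alternatizeUncurryFin (L.smulRight a) : E [⋀^Fin 3]→L[ℝ] ℝ) := by
  have h := wedge_oneForm a L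
  rw [even_two.neg_one_pow, one_smul] at h
  refine Eq.trans ?_ h
  apply ContinuousAlternatingMap.ext
  intro v
  have := wedge_swap (m := 3) rfl rfl (oneForm L) a v
  rw [show Equiv.Perm.sign _ = 1 by decide] at this
  simpa using this

theorem oneForm_wedge_three (L : E →L[ℝ] ℝ) (a : E [⋀^Fin 3]→L[ℝ] ℝ) :
    wedge (oneForm L) a = (alternatizeUncurryFin (L.smulRight a) : E [⋀^Fin 4]→L[ℝ] ℝ) := by
  have h := wedge_oneForm a L
  have h' : (alternatizeUncurryFin (L.smulRight a) : E [⋀^Fin 4]→L[ℝ] ℝ) =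
      (-1 : ℝ) • wedge a (oneForm L) := by
    rw [h, smul_smul]; norm_num
  rw [h']
  apply ContinuousAlternatingMap.ext
  intro v
  have := wedge_swap (m := 4) rfl rfl (oneForm L) a v
  rw [show Equiv.Perm.sign _ = -1 by decide] at this
  simpa using this

/-- The algebraic core of d(β∧L) = dβ∧L for constant L: L⊗A plus its transpose is symmetric in the
two first arguments, so its double alternatization vanishes. Hence exchanging the two
alternatizations costs a sign. -/
theorem alternatizeUncurryFin_wedge_oneForm {k : ℕ} (A : E →L[ℝ] E [⋀^Fin k]→L[ℝ] ℝ)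
    (L : E →L[ℝ] ℝ) :
    alternatizeUncurryFin ((-1 : ℝ) ^ k • (alternatizeUncurryFinCLM ℝ E ℝ ∘L
      (ContinuousLinearMap.smulRightL ℝ E _ L ∘L A))) =
      wedge (alternatizeUncurryFin A) (oneForm L) := by
  have h := alternatizeUncurryFin_alternatizeUncurryFinCLM_comp_of_symmetric
    (f := ContinuousLinearMap.smulRightL ℝ E _ L ∘L A + L.smulRight A)
    (fun x y => by simp [add_comm])
  have h2 : alternatizeUncurryFinCLM ℝ E ℝ ∘L L.smulRight A =
      L.smulRight (alternatizeUncurryFin A) := by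
    ext x : 1
    simp
  rw [ContinuousLinearMap.comp_add, alternatizeUncurryFin_add, h2] at h
  rw [alternatizeUncurryFin_smul, wedge_oneForm, pow_succ, mul_neg_one, neg_smul,
    eq_neg_of_add_eq_zero_left h, smul_neg]

theorem hasFDerivAt_smulRight {W : Type*} [NormedAddCommGroup W] [NormedSpace ℝ W] {β : E → W}
    {L : E → E →L[ℝ] ℝ} {β' : E →L[ℝ] W} {L' : E →L[ℝ] E →L[ℝ] ℝ} {x : E}
    (hβ : HasFDerivAt β β' x) (hL : HasFDerivAt L L' x) :
    HasFDerivAt (fun y => (L y).smulRight (β y))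
      (ContinuousLinearMap.smulRightL ℝ E W (L x) ∘L β' +
        (ContinuousLinearMap.smulRightL ℝ E W).precompL E L' (β x)) x :=
  (ContinuousLinearMap.smulRightL ℝ E W).hasFDerivAt_of_bilinear hL hβ

theorem extDeriv_wedge_oneForm {k : ℕ} {β : E → E [⋀^Fin k]→L[ℝ] ℝ} {L : E → E →L[ℝ] ℝ} {x : E}
    (hβ : DifferentiableAt ℝ β x) (hL : DifferentiableAt ℝ L x)
    (hs : ∀ v w, fderiv ℝ L x v w = fderiv ℝ L x w v) :
    extDeriv (fun y => wedge (β y) (oneForm (L y))) x =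
      wedge (extDeriv β x) (oneForm (L x)) := by
  have h1 : (fun y => wedge (β y) (oneForm (L y))) = fun y => (-1 : ℝ) ^ k •
      alternatizeUncurryFinCLM ℝ E ℝ ((L y).smulRight (β y)) := by
    funext y
    rw [wedge_oneForm]
    rfl
  have h2 := ((alternatizeUncurryFinCLM ℝ E ℝ (n := k)).hasFDerivAt.comp x
    (hasFDerivAt_smulRight hβ.hasFDerivAt hL.hasFDerivAt)).const_smul ((-1 : ℝ) ^ k)
  have h3 := alternatizeUncurryFin_wedge_oneForm (fderiv ℝ β x) (L x)
  -- The term of the product rule containing the derivative of `L` is alternated in two arguments in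
  -- which it is symmetric: this is dL = 0.
  have h4 := alternatizeUncurryFin_alternatizeUncurryFinCLM_comp_of_symmetric
    (f := (ContinuousLinearMap.smulRightL ℝ E (E [⋀^Fin k]→L[ℝ] ℝ)).precompL E
      (fderiv ℝ L x) (β x)) (fun v w => by simp [hs v w])
  rw [h1, extDeriv]
  refine (congrArg alternatizeUncurryFin h2.fderiv).trans ?_
  rw [ContinuousLinearMap.comp_add, smul_add, alternatizeUncurryFin_add,
    alternatizeUncurryFin_smul ((-1 : ℝ) ^ k) (_ ∘L ContinuousLinearMap.precompL _ _ _ _), h4,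
    smul_zero, add_zero]
  exact h3

theorem extDeriv_smul_two {β : E → E [⋀^Fin 2]→L[ℝ] ℝ} {g : E → ℝ} {x : E}
    (hβ : DifferentiableAt ℝ β x) (hg : DifferentiableAt ℝ g x) :
    extDeriv (fun y => g y • β y) x =
      g x • extDeriv β x + wedge (oneForm (fderiv ℝ g x)) (β x) := by
  rw [extDeriv, fderiv_fun_smul hg hβ, alternatizeUncurryFin_add, alternatizeUncurryFin_smul]
  congr 1
  exact (oneForm_wedge_two _ _).symm

theorem extDeriv_smul_three {β : E → E [⋀^Fin 3]→L[ℝ] ℝ} {g : E → ℝ} {x : E}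
    (hβ : DifferentiableAt ℝ β x) (hg : DifferentiableAt ℝ g x) :
    extDeriv (fun y => g y • β y) x =
      g x • extDeriv β x + wedge (oneForm (fderiv ℝ g x)) (β x) := by
  rw [extDeriv, fderiv_fun_smul hg hβ, alternatizeUncurryFin_add, alternatizeUncurryFin_smul]
  congr 1
  exact (oneForm_wedge_three _ _).symm

end OneForms

section WedgeSquare

variable {E : Type*} [NormedAddCommGroup E] [NormedSpace ℝ E]

/-! ## The exterior derivative of the square of a `2`-form -/

open ContinuousAlternatingMap

/-- A crude bound suffices: it makes the wedge product a continuous bilinear map, to which the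
product rule for derivatives applies. -/
theorem norm_wedge_le {k l : ℕ} (a : E [⋀^Fin k]→L[ℝ] ℝ) (b : E [⋀^Fin l]→L[ℝ] ℝ) :
    ‖wedge a b‖ ≤ ((k.factorial * l.factorial : ℝ))⁻¹ * (k + l).factorial * ‖a‖ * ‖b‖ := by
  refine ContinuousAlternatingMap.opNorm_le_bound _ (by positivity) fun v => ?_
  rw [wedge_apply, norm_mul, Real.norm_of_nonneg (by positivity), mul_assoc, mul_assoc, mul_assoc]
  refine mul_le_mul_of_nonneg_left ?_ (by positivity)
  have h : ∀ σ : Equiv.Perm (Fin k ⊕ Fin l), ‖((Equiv.Perm.sign σ : ℤ) : ℝ) *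
      (a (fun i => v (finSumFinEquiv (σ (Sum.inl i)))) *
        b fun i => v (finSumFinEquiv (σ (Sum.inr i))))‖ ≤ ‖a‖ * (‖b‖ * ∏ i, ‖v i‖) := by
    intro σ
    have h1 : ‖((Equiv.Perm.sign σ : ℤ) : ℝ)‖ = 1 := by
      rcases Int.units_eq_one_or (Equiv.Perm.sign σ) with h | h <;> simp [h]
    have h2 : ∏ i, ‖v i‖ = (∏ i : Fin k, ‖v (finSumFinEquiv (σ (Sum.inl i)))‖) *
        ∏ i : Fin l, ‖v (finSumFinEquiv (σ (Sum.inr i)))‖ := by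
      rw [← Fintype.prod_sum_type fun x => ‖v (finSumFinEquiv (σ x))‖]
      exact ((σ.trans finSumFinEquiv).prod_comp fun i => ‖v i‖).symm
    rw [norm_mul, h1, one_mul, norm_mul, h2]
    calc _ ≤ (‖a‖ * ∏ i : Fin k, ‖v (finSumFinEquiv (σ (Sum.inl i)))‖) *
          (‖b‖ * ∏ i : Fin l, ‖v (finSumFinEquiv (σ (Sum.inr i)))‖) :=
          mul_le_mul (a.le_opNorm _) (b.le_opNorm _) (norm_nonneg _) (by positivity)
      _ = _ := by ring
  refine (norm_sum_le_of_le _ fun σ _ => h σ).trans (le_of_eq ?_)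
  rw [Finset.sum_const, nsmul_eq_mul, Finset.card_univ, Fintype.card_perm, Fintype.card_sum,
    Fintype.card_fin, Fintype.card_fin]

/-- The wedge product as a continuous bilinear map. -/
def wedgeCLM (k l : ℕ) :
    E [⋀^Fin k]→L[ℝ] ℝ →L[ℝ] E [⋀^Fin l]→L[ℝ] ℝ →L[ℝ] E [⋀^Fin (k + l)]→L[ℝ] ℝ :=
  LinearMap.mkContinuous₂
    (LinearMap.mk₂ ℝ wedge wedge_add_left wedge_smul_left wedge_add_right wedge_smul_right)
    _ norm_wedge_le

theorem wedgeCLM_apply {k l : ℕ} (a : E [⋀^Fin k]→L[ℝ] ℝ) (b : E [⋀^Fin l]→L[ℝ] ℝ) :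
    wedgeCLM k l a b = wedge a b := rfl

theorem elemL_singleton {n : ℕ} [NeZero n] (u : E ≃L[ℝ] (Fin n → ℝ)) (i : Fin n) :
    elemL u 1 [i] = oneForm (coframe u i) := by
  refine ContinuousAlternatingMap.ext fun v => ?_
  rw [elemL, elem_apply]
  simp [oneForm]

theorem wedge_wedge_elemL {n : ℕ} [NeZero n] (u : E ≃L[ℝ] (Fin n → ℝ)) {k : ℕ}
    (a : E [⋀^Fin k]→L[ℝ] ℝ) {i j : Fin n} (hij : i ≠ j) :
    wedge (wedge a (elemL u 1 [i])) (elemL u 1 [j]) = wedge a (elemL u 2 [i, j]) := by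
  refine form_ext u fun t ht => ?_
  have h1 := List.mem_sublistsLen.1 ht
  have h2 := h1.1.nodup (List.nodup_finRange n)
  rw [val_wedge_elemL u _ ⟨h2, h1.2⟩ (by simp), val_wedge_elemL u (k := k) (l := 2) _ ⟨h2, h1.2⟩
    (by simp [hij])]
  by_cases hj : j ∈ t
  · have h3 := pull_perm hj
    have h4 := h3.nodup_iff.2 h2
    have h5 := h3.length_eq
    have h6 : (strip [j] t).2 = (pull j t).2 := rfl
    rw [val_wedge_elemL u _ ⟨h6 ▸ (List.nodup_append.1 h4).1, ?_⟩ (by simp)]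
    · simp only [strip]
      push_cast
      ring
    · rw [h6]
      have := h1.2
      simp at h5
      omega
  · simp [strip, pull_of_notMem hj]

theorem wedge_oneForm_self (L : E →L[ℝ] ℝ) : wedge (oneForm L) (oneForm L) = 0 := by
  refine ContinuousAlternatingMap.ext fun v => ?_
  rw [wedge_oneForm_apply]
  simp [Fin.sum_univ_two, oneForm, Fin.removeNth]
  ring

theorem wedge_wedge_oneForm_self {k : ℕ} (a : E [⋀^Fin k]→L[ℝ] ℝ) (L : E →L[ℝ] ℝ) :
    wedge (wedge a (oneForm L)) (oneForm L) = 0 := by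
  have h := alternatizeUncurryFin_alternatizeUncurryFinCLM_comp_of_symmetric
    (f := L.smulRight (L.smulRight a)) (fun x y => by
      simp only [ContinuousLinearMap.smulRight_apply, _root_.smul_apply, smul_smul,
        mul_comm])
  rw [wedge_oneForm, wedge_oneForm]
  have h2 : L.smulRight ((-1 : ℝ) ^ k • alternatizeUncurryFin (L.smulRight a)) =
    (-1 : ℝ) ^ k • (alternatizeUncurryFinCLM ℝ E ℝ ∘L L.smulRight (L.smulRight a)) := by
    ext x : 1
    simp only [ContinuousLinearMap.smulRight_apply, _root_.smul_apply,
      ContinuousLinearMap.comp_apply, map_smul, alternatizeUncurryFinCLM_apply]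
    rw [smul_comm]
  rw [h2, alternatizeUncurryFin_smul, h, smul_zero, smul_zero]

/-- This case of associativity is enough for products with 2-forms, which are sums of such e^i∧e^j.
If i = j both sides vanish; otherwise their components agree. -/
theorem wedge_wedge_coframe {n : ℕ} [NeZero n] (u : E ≃L[ℝ] (Fin n → ℝ)) {k : ℕ}
    (a : E [⋀^Fin k]→L[ℝ] ℝ) (i j : Fin n) :
    wedge (wedge a (oneForm (coframe u i))) (oneForm (coframe u j)) =
      wedge a (wedge (oneForm (coframe u i)) (oneForm (coframe u j))) := by
  by_cases hij : i = j
  · rw [hij, wedge_wedge_oneForm_self, wedge_oneForm_self]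
    exact (_root_.map_zero (wedgeCLM k 2 a)).symm
  · have h : wedge (oneForm (coframe u i)) (oneForm (coframe u j)) = elemL u 2 [i, j] := by
      refine ContinuousAlternatingMap.ext fun v => ?_
      rw [wedge_oneForm_apply, elemL, elem_apply_det, Matrix.det_fin_two]
      simp [Fin.sum_univ_two, oneForm, Fin.removeNth]
      ring
    rw [h, ← wedge_wedge_elemL u a hij, elemL_singleton, elemL_singleton]

/-- The expansion of a `2`-form in a coframe. -/
theorem two_form_expansion {n : ℕ} (u : E ≃L[ℝ] (Fin n → ℝ)) (b : E [⋀^Fin 2]→L[ℝ] ℝ) :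
    b = ∑ i, ∑ j, ((1 / 2 : ℝ) * b ![basisVec u i, basisVec u j]) •
      wedge (oneForm (coframe u i)) (oneForm (coframe u j)) := by
  refine ContinuousAlternatingMap.ext fun v => ?_
  have h1 : ∀ x y : E, b ![x, y] =
      ∑ i, ∑ j, coframe u i x * coframe u j y * b ![basisVec u i, basisVec u j] := by
    intro x y
    have := b.toMultilinearMap.map_sum fun (a : Fin 2) (i : Fin n) =>
      coframe u i (![x, y] a) • basisVec u i
    simp only [sum_coframe_smul] at this
    refine this.trans ?_
    rw [← (finTwoArrowEquiv (Fin n)).symm.sum_comp, Fintype.sum_prod_type]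
    refine Finset.sum_congr rfl fun i _ => Finset.sum_congr rfl fun j _ => ?_
    have h := b.toMultilinearMap.map_smul_univ (fun a => coframe u (![i, j] a) (![x, y] a))
      fun a => basisVec u (![i, j] a)
    refine h.trans ?_
    rw [Fin.prod_univ_two, smul_eq_mul]
    refine congrArg _ (congrArg b ?_)
    funext a
    fin_cases a <;> rfl
  -- Half of the antisymmetrization matches the two terms of e^i∧e^j and explains the factor 1/2 in
  -- a sum over ordered pairs.
  have h2 : b v = 1 / 2 * b ![v 0, v 1] - 1 / 2 * b ![v 1, v 0] := by
    have h3 := b.toAlternatingMap.map_swap v (i := 0) (j := 1) (by decide)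
    have h4 : v = ![v 0, v 1] := by
      funext a
      fin_cases a <;> rfl
    have h5 : v ∘ Equiv.swap 0 1 = ![v 1, v 0] := by
      funext a
      fin_cases a <;> rfl
    rw [h5] at h3
    change b ![v 1, v 0] = -b v at h3
    rw [h3, ← h4]
    ring
  rw [h2, h1, h1, Finset.mul_sum, Finset.mul_sum, ← Finset.sum_sub_distrib]
  simp only [ContinuousAlternatingMap.sum_apply]
  refine Finset.sum_congr rfl fun i _ => ?_
  rw [Finset.mul_sum, Finset.mul_sum, ← Finset.sum_sub_distrib]
  refine Finset.sum_congr rfl fun j _ => ?_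
  rw [ContinuousAlternatingMap.smul_apply, wedge_oneForm_apply]
  simp [Fin.sum_univ_two, oneForm, Fin.removeNth]
  ring

theorem two_form_induction {n : ℕ} (u : E ≃L[ℝ] (Fin n → ℝ)) {P : E [⋀^Fin 2]→L[ℝ] ℝ → Prop}
    (hzero : P 0) (hadd : ∀ b b', P b → P b' → P (b + b')) (hsmul : ∀ (c : ℝ) b, P b → P (c • b))
    (h : ∀ i j, P (wedge (oneForm (coframe u i)) (oneForm (coframe u j))))
    (b : E [⋀^Fin 2]→L[ℝ] ℝ) : P b := by
  rw [two_form_expansion u b]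
  exact Finset.sum_induction _ _ hadd hzero fun i _ =>
    Finset.sum_induction _ _ hadd hzero fun j _ => hsmul _ _ (h i j)

theorem alternatizeUncurryFin_wedgeCLM_oneForm {k : ℕ} (A : E →L[ℝ] E [⋀^Fin k]→L[ℝ] ℝ)
    (L : E →L[ℝ] ℝ) :
    alternatizeUncurryFin ((wedgeCLM k 1).flip (oneForm L) ∘L A) =
      wedge (alternatizeUncurryFin A) (oneForm L) := by
  rw [← alternatizeUncurryFin_wedge_oneForm]
  congr 1
  ext x : 1
  exact wedge_oneForm (A x) L

/-- By linearity `b` may be taken to be e^i∧e^j, and then the rule for a constant 1-form applies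
twice. -/
theorem alternatizeUncurryFin_wedgeCLM_two {n : ℕ} [NeZero n] (u : E ≃L[ℝ] (Fin n → ℝ))
    (A : E →L[ℝ] E [⋀^Fin 2]→L[ℝ] ℝ) (b : E [⋀^Fin 2]→L[ℝ] ℝ) :
    alternatizeUncurryFin ((wedgeCLM 2 2).flip b ∘L A) =
      (wedge (alternatizeUncurryFin A) b : E [⋀^Fin 5]→L[ℝ] ℝ) := by
  induction b using two_form_induction u with
  | hzero =>
    rw [_root_.map_zero, ContinuousLinearMap.zero_comp, ← wedgeCLM_apply, _root_.map_zero]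
    exact (alternatizeUncurryFinCLM ℝ E ℝ).map_zero
  | hadd b b' h h' =>
    rw [map_add, ContinuousLinearMap.add_comp, alternatizeUncurryFin_add, h, h', wedge_add_right]
  | hsmul c b h =>
    rw [map_smul, ContinuousLinearMap.smul_comp, alternatizeUncurryFin_smul, h, wedge_smul_right]
  | h i j =>
    have h := alternatizeUncurryFin_wedgeCLM_oneForm
      ((wedgeCLM 2 1).flip (oneForm (coframe u i)) ∘L A) (coframe u j)
    have h' := congrArg (fun a => wedge a (oneForm (coframe u j)))
      (alternatizeUncurryFin_wedgeCLM_oneForm A (coframe u i))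
    refine Eq.trans ?_ (h.trans (h'.trans (wedge_wedge_coframe u (alternatizeUncurryFin A) i j)))
    congr 1
    ext x : 1
    exact (wedge_wedge_coframe u (A x) i j).symm

/-- The two terms of the product rule agree because 2-forms commute. The frame `u` serves only to
expand 2-forms. -/
theorem extDeriv_wedge_self {n : ℕ} [NeZero n] (u : E ≃L[ℝ] (Fin n → ℝ))
    {β : E → E [⋀^Fin 2]→L[ℝ] ℝ} {x : E} (hβ : DifferentiableAt ℝ β x) :
    extDeriv (fun y => wedge (β y) (β y)) x =
      (2 : ℝ) • (wedge (extDeriv β x) (β x) : E [⋀^Fin 5]→L[ℝ] ℝ) := by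
  have h1 := (wedgeCLM 2 2).hasFDerivAt_of_bilinear hβ.hasFDerivAt hβ.hasFDerivAt
  rw [extDeriv]
  refine (congrArg alternatizeUncurryFin h1.fderiv).trans ?_
  have h2 := alternatizeUncurryFin_wedgeCLM_two u (fderiv ℝ β x) (β x)
  rw [extDeriv, two_smul, ← h2, ← alternatizeUncurryFin_add]
  congr 1
  ext x' : 1
  exact congrArg (· + _) (wedge_comm_two (β x) (fderiv ℝ β x x'))

end WedgeSquare

section Charts

variable {E : Type*} [NormedAddCommGroup E] [NormedSpace ℝ E] {H : Type*} [TopologicalSpace H]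
  {I : ModelWithCorners ℝ E H} {M : Type*} [TopologicalSpace M] [ChartedSpace H M]

/-! ## The exterior derivative of forms on a manifold -/

theorem Form.inChart_add {k : ℕ} (β γ : Form I M k) (x : M) :
    (β + γ).inChart x = β.inChart x + γ.inChart x := rfl

theorem Form.inChart_smul {k : ℕ} (c : ℝ) (β : Form I M k) (x : M) :
    (c • β).inChart x = c • β.inChart x := rfl

theorem Form.inChart_wedge {k l : ℕ} (β : Form I M k) (γ : Form I M l) (x : M) (y : E) :
    (β.wedge γ).inChart x y = WarpedG2.wedge (β.inChart x y) (γ.inChart x y) :=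
  wedge_compContinuousLinearMap _ _ _

theorem Form.d_add {k : ℕ} {β γ : Form I M k} {x : M}
    (hβ : DifferentiableAt ℝ (β.inChart x) (extChartAt I x x))
    (hγ : DifferentiableAt ℝ (γ.inChart x) (extChartAt I x x)) :
    (β + γ).d x = β.d x + γ.d x := by
  rw [Form.d, Form.inChart_add, extDeriv_add hβ hγ]
  rfl

theorem Form.d_smul {k : ℕ} (c : ℝ) (β : Form I M k) (x : M) : (c • β).d x = c • β.d x := by
  rw [Form.d, Form.inChart_smul, extDeriv_smul]
  rfl

variable [I.Boundaryless]

theorem Form.IsSmooth.differentiableAt_inChart {k : ℕ} {β : Form I M k} (hβ : β.IsSmooth) (x : M) :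
    DifferentiableAt ℝ (β.inChart x) (extChartAt I x x) :=
  ((hβ x).contDiffAt (extChartAt_target_mem_nhds x)).differentiableAt (by simp)

section Manifold

variable [IsManifold I ∞ M]

theorem mfderiv_extChartAt_symm_comp (x : M) :
    (mfderiv 𝓘(ℝ, E) I (extChartAt I x).symm (extChartAt I x x)).comp
      (mfderiv I 𝓘(ℝ, E) (extChartAt I x) x) = ContinuousLinearMap.id ℝ (TangentSpace I x) := by
  have : IsManifold I 1 M := IsManifold.of_le (n := ∞) (by norm_cast)
  have h := mfderivWithin_extChartAt_symm_comp_mfderiv_extChartAt' (I := I)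
    (mem_extChartAt_source (I := I) x)
  rwa [I.range_eq_univ, mfderivWithin_univ] at h

theorem Form.inChart_comp_mfderiv {k : ℕ} (β : Form I M k) (x : M) :
    (β.inChart x (extChartAt I x x)).compContinuousLinearMap
      (mfderiv I 𝓘(ℝ, E) (extChartAt I x) x) = β x := by
  -- The point κ⁻¹(κ x) equals x only propositionally; the values of β there are compared as forms
  -- on the common model space `E`.
  have h : ∀ x', x' = x → ∀ w : Fin k → E,
      (β x' : E [⋀^Fin k]→L[ℝ] ℝ) w = (β x : E [⋀^Fin k]→L[ℝ] ℝ) w := by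
    rintro _ rfl w
    rfl
  refine ContinuousAlternatingMap.ext fun v => (h _ (extChartAt_to_inv x) _).trans ?_
  refine congrArg (β x) (funext fun i => ?_)
  exact DFunLike.congr_fun (mfderiv_extChartAt_symm_comp x) (v i)

theorem fderiv_comp_extChartAt_symm {g : M → ℝ} {x : M} (hg : MDifferentiableAt I 𝓘(ℝ, ℝ) g x) :
    DifferentiableAt ℝ (fun y => g ((extChartAt I x).symm y)) (extChartAt I x x) ∧
    (fderiv ℝ (fun y => g ((extChartAt I x).symm y)) (extChartAt I x x)).comp
      (mfderiv I 𝓘(ℝ, E) (extChartAt I x) x) = mfderiv I 𝓘(ℝ, ℝ) g x := by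
  have : IsManifold I 1 M := IsManifold.of_le (n := ∞) (by norm_cast)
  have h1 : MDifferentiableAt 𝓘(ℝ, E) I (extChartAt I x).symm (extChartAt I x x) := by
    have := mdifferentiableWithinAt_extChartAt_symm (I := I) (mem_extChartAt_target x)
    rwa [I.range_eq_univ, mdifferentiableWithinAt_univ] at this
  have h2 : MDifferentiableAt 𝓘(ℝ, E) 𝓘(ℝ, ℝ) (g ∘ (extChartAt I x).symm) (extChartAt I x x) := by
    refine MDifferentiableAt.comp _ ?_ h1
    rwa [extChartAt_to_inv]
  refine ⟨h2.differentiableAt, ?_⟩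
  have h3 : g =ᶠ[nhds x] (g ∘ (extChartAt I x).symm) ∘ extChartAt I x := by
    filter_upwards [extChartAt_source_mem_nhds (I := I) x] with y hy
    exact (congrArg g ((extChartAt I x).left_inv hy)).symm
  rw [h3.mfderiv_eq, mfderiv_comp x h2 (mdifferentiableAt_extChartAt (mem_chart_source H x)),
    mfderiv_eq_fderiv]
  rfl

theorem smul_add_compContinuousLinearMap {V V' : Type*} [AddCommGroup V] [Module ℝ V]
    [TopologicalSpace V] [AddCommGroup V'] [Module ℝ V'] [TopologicalSpace V'] {k : ℕ} (c : ℝ)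
    (a b : V [⋀^Fin k]→L[ℝ] ℝ) (D : V' →L[ℝ] V) :
    (c • a + b).compContinuousLinearMap D =
      c • a.compContinuousLinearMap D + b.compContinuousLinearMap D := rfl

theorem Form.d_mulFun_two {g : M → ℝ} {β : Form I M 2} {x : M}
    (hβ : DifferentiableAt ℝ (β.inChart x) (extChartAt I x x))
    (hg : MDifferentiableAt I 𝓘(ℝ, ℝ) g x) :
    (β.mulFun g).d x = g x • β.d x + WarpedG2.wedge (dFun I g x) (β x) := by
  obtain ⟨h1, h2⟩ := fderiv_comp_extChartAt_symm hg
  have h3 := extDeriv_smul_two hβ h1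
  rw [Form.d]
  refine (congrArg (fun a => a.compContinuousLinearMap (mfderiv I 𝓘(ℝ, E) (extChartAt I x) x))
    h3).trans ?_
  have h4 := Form.inChart_comp_mfderiv β x
  have h5 := extChartAt_to_inv (I := I) x
  refine (smul_add_compContinuousLinearMap _ _ _ _).trans ?_
  refine congrArg₂ (· + ·) (congrArg (· • Form.d β x) (congrArg g h5)) ?_
  refine (wedge_compContinuousLinearMap _ _ _).trans (congrArg₂ WarpedG2.wedge ?_ h4)
  rw [dFun, ← h2]
  rfl

theorem Form.d_mulFun_three {g : M → ℝ} {β : Form I M 3} {x : M}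
    (hβ : DifferentiableAt ℝ (β.inChart x) (extChartAt I x x))
    (hg : MDifferentiableAt I 𝓘(ℝ, ℝ) g x) :
    (β.mulFun g).d x = g x • β.d x + WarpedG2.wedge (dFun I g x) (β x) := by
  obtain ⟨h1, h2⟩ := fderiv_comp_extChartAt_symm hg
  have h3 := extDeriv_smul_three hβ h1
  rw [Form.d]
  refine (congrArg (fun a => a.compContinuousLinearMap (mfderiv I 𝓘(ℝ, E) (extChartAt I x) x))
    h3).trans ?_
  have h4 := Form.inChart_comp_mfderiv β x
  have h5 := extChartAt_to_inv (I := I) x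
  refine (smul_add_compContinuousLinearMap _ _ _ _).trans ?_
  refine congrArg₂ (· + ·) (congrArg (· • Form.d β x) (congrArg g h5)) ?_
  refine (wedge_compContinuousLinearMap _ _ _).trans (congrArg₂ WarpedG2.wedge ?_ h4)
  rw [dFun, ← h2]
  rfl

set_option maxRecDepth 10000 in
theorem Form.d_wedge_self {n : ℕ} [NeZero n] (u : E ≃L[ℝ] (Fin n → ℝ)) {β : Form I M 2} {x : M}
    (hβ : DifferentiableAt ℝ (β.inChart x) (extChartAt I x x)) :
    (β.wedge β).d x =
      (2 : ℝ) • (WarpedG2.wedge (β.d x) (β x) : TangentSpace I x [⋀^Fin 5]→L[ℝ] ℝ) := by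
  have h1 : (β.wedge β).inChart x = fun y => WarpedG2.wedge (β.inChart x y) (β.inChart x y) :=
    funext fun y => Form.inChart_wedge β β x y
  have h2 : extDeriv ((β.wedge β).inChart x) (extChartAt I x x) = (2 : ℝ) • (WarpedG2.wedge
      (extDeriv (β.inChart x) (extChartAt I x x)) (β.inChart x (extChartAt I x x)) :
        E [⋀^Fin 5]→L[ℝ] ℝ) := by
    rw [h1]
    exact extDeriv_wedge_self u hβ
  have h3 := wedge_compContinuousLinearMap (extDeriv (β.inChart x) (extChartAt I x x))
    (β.inChart x (extChartAt I x x)) (mfderiv I 𝓘(ℝ, E) (extChartAt I x) x)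
  rw [Form.inChart_comp_mfderiv] at h3
  have h4 : ∀ (a : E [⋀^Fin 5]→L[ℝ] ℝ) (D : TangentSpace I x →L[ℝ] E),
      ((2 : ℝ) • a).compContinuousLinearMap D = (2 : ℝ) • a.compContinuousLinearMap D :=
    fun _ _ => rfl
  rw [Form.d, h2]
  refine (h4 _ _).trans ?_
  rw [h3]
  rfl

end Manifold

end Charts

section Products

variable {E : Type*} [NormedAddCommGroup E] [NormedSpace ℝ E] {H : Type*} [TopologicalSpace H]
  {I : ModelWithCorners ℝ E H} [I.Boundaryless] {M : Type*} [TopologicalSpace M] [ChartedSpace H M]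
  [IsManifold I ∞ M]
  {E' : Type*} [NormedAddCommGroup E'] [NormedSpace ℝ E'] {H' : Type*} [TopologicalSpace H']
  {J : ModelWithCorners ℝ E' H'} [J.Boundaryless] {N : Type*} [TopologicalSpace N]
  [ChartedSpace H' N] [IsManifold J ∞ N]

/-! ## Forms on products -/

theorem mdifferentiableAt_extChartAt_symm {x : M} {y : E} (hy : y ∈ (extChartAt I x).target) :
    MDifferentiableAt 𝓘(ℝ, E) I (extChartAt I x).symm y := by
  have : IsManifold I 1 M := IsManifold.of_le (n := ∞) (by norm_cast)
  have := mdifferentiableWithinAt_extChartAt_symm (I := I) hy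
  rwa [I.range_eq_univ, mdifferentiableWithinAt_univ] at this

theorem Form.d_wedge_oneForm {k : ℕ} {β : Form I M k} {γ : Form I M 1} {x : M}
    (hβ : DifferentiableAt ℝ (β.inChart x) (extChartAt I x x)) {L : E → E →L[ℝ] ℝ}
    (hγ : γ.inChart x =ᶠ[nhds (extChartAt I x x)] fun y => oneForm (L y))
    (hL : DifferentiableAt ℝ L (extChartAt I x x))
    (hs : ∀ v w, fderiv ℝ L (extChartAt I x x) v w = fderiv ℝ L (extChartAt I x x) w v) :
    (β.wedge γ).d x = WarpedG2.wedge (β.d x) (γ x) := by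
  have h1 : (β.wedge γ).inChart x =ᶠ[nhds (extChartAt I x x)]
      fun y => WarpedG2.wedge (β.inChart x y) (oneForm (L y)) := by
    filter_upwards [hγ] with y hy
    rw [Form.inChart_wedge, hy]
  have h2 : extDeriv ((β.wedge γ).inChart x) (extChartAt I x x) =
      WarpedG2.wedge (extDeriv (β.inChart x) (extChartAt I x x))
        (γ.inChart x (extChartAt I x x)) := by
    rw [h1.extDeriv_eq, extDeriv_wedge_oneForm hβ hL hs, hγ.eq_of_nhds]
  rw [Form.d, h2]
  refine (wedge_compContinuousLinearMap _ _ _).trans ?_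
  exact congrArg (WarpedG2.wedge (Form.d β x)) (Form.inChart_comp_mfderiv γ x)

/-- Charts of a product are products of charts, so the projection is linear in coordinates and the
expression of the pullback is a linear pullback. -/
theorem inChart_pullback_fst {k : ℕ} (β : Form I M k) (p : M × N) {y : E × E'}
    (hy : y ∈ (extChartAt (I.prod J) p).target) :
    (Form.pullback (I' := I.prod J) (Prod.fst : M × N → M) β).inChart p y =
      (β.inChart p.1 y.1).compContinuousLinearMap (ContinuousLinearMap.fst ℝ E E') := by
  have h1 := mdifferentiableAt_extChartAt_symm hy
  have h2 : y.1 ∈ (extChartAt I p.1).target := by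
    rw [extChartAt_prod] at hy
    exact hy.1
  have h3 : (Prod.fst : M × N → M) ∘ (extChartAt (I.prod J) p).symm =
      (extChartAt I p.1).symm ∘ (Prod.fst : E × E' → E) := by
    rw [extChartAt_prod]
    rfl
  have h4 : mfderiv 𝓘(ℝ, E × E') I ((Prod.fst : M × N → M) ∘ (extChartAt (I.prod J) p).symm) y =
      (mfderiv (I.prod J) I (Prod.fst : M × N → M) ((extChartAt (I.prod J) p).symm y)).comp
        (mfderiv 𝓘(ℝ, E × E') (I.prod J) (extChartAt (I.prod J) p).symm y) :=
    mfderiv_comp y mdifferentiableAt_fst h1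
  have h5 : mfderiv 𝓘(ℝ, E × E') I ((extChartAt I p.1).symm ∘ (Prod.fst : E × E' → E)) y =
      (mfderiv 𝓘(ℝ, E) I (extChartAt I p.1).symm y.1).comp (ContinuousLinearMap.fst ℝ E E') := by
    rw [mfderiv_comp y (mdifferentiableAt_extChartAt_symm h2)
      differentiableAt_fst.mdifferentiableAt, mfderiv_eq_fderiv, fderiv_fst]
    rfl
  have h6 : ∀ F G : E × E' → M, F = G → (mfderiv 𝓘(ℝ, E × E') I F y : E × E' →L[ℝ] E) =
      (mfderiv 𝓘(ℝ, E × E') I G y : E × E' →L[ℝ] E) := by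
    rintro F _ rfl
    rfl
  have h7 : ∀ (x x' : M) (D D' : E × E' →L[ℝ] E), x = x' → D = D' →
      (β x : E [⋀^Fin k]→L[ℝ] ℝ).compContinuousLinearMap D =
        (β x' : E [⋀^Fin k]→L[ℝ] ℝ).compContinuousLinearMap D' := by
    rintro x _ D _ rfl rfl
    rfl
  exact h7 _ _ _ _ (congrFun h3 y) (h4.symm.trans ((h6 _ _ h3).trans h5))

theorem eventuallyEq_inChart_pullback_fst {k : ℕ} (β : Form I M k) (p : M × N) :
    (Form.pullback (I' := I.prod J) (Prod.fst : M × N → M) β).inChart p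
      =ᶠ[nhds (extChartAt (I.prod J) p p)] fun y =>
        (β.inChart p.1 y.1).compContinuousLinearMap (ContinuousLinearMap.fst ℝ E E') :=
  Filter.eventuallyEq_of_mem (extChartAt_target_mem_nhds p) fun _ => inChart_pullback_fst β p

theorem inChart_pullback_snd {k : ℕ} (β : Form J N k) (p : M × N) {y : E × E'}
    (hy : y ∈ (extChartAt (I.prod J) p).target) :
    (Form.pullback (I' := I.prod J) (Prod.snd : M × N → N) β).inChart p y =
      (β.inChart p.2 y.2).compContinuousLinearMap (ContinuousLinearMap.snd ℝ E E') := by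
  have h1 := mdifferentiableAt_extChartAt_symm hy
  have h2 : y.2 ∈ (extChartAt J p.2).target := by
    rw [extChartAt_prod] at hy
    exact hy.2
  have h3 : (Prod.snd : M × N → N) ∘ (extChartAt (I.prod J) p).symm =
      (extChartAt J p.2).symm ∘ (Prod.snd : E × E' → E') := by
    rw [extChartAt_prod]
    rfl
  have h4 : mfderiv 𝓘(ℝ, E × E') J ((Prod.snd : M × N → N) ∘ (extChartAt (I.prod J) p).symm) y =
      (mfderiv (I.prod J) J (Prod.snd : M × N → N) ((extChartAt (I.prod J) p).symm y)).comp
        (mfderiv 𝓘(ℝ, E × E') (I.prod J) (extChartAt (I.prod J) p).symm y) :=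
    mfderiv_comp y mdifferentiableAt_snd h1
  have h5 : mfderiv 𝓘(ℝ, E × E') J ((extChartAt J p.2).symm ∘ (Prod.snd : E × E' → E')) y =
      (mfderiv 𝓘(ℝ, E') J (extChartAt J p.2).symm y.2).comp (ContinuousLinearMap.snd ℝ E E') := by
    rw [mfderiv_comp y (mdifferentiableAt_extChartAt_symm h2)
      differentiableAt_snd.mdifferentiableAt, mfderiv_eq_fderiv, fderiv_snd]
    rfl
  have h6 : ∀ F G : E × E' → N, F = G → (mfderiv 𝓘(ℝ, E × E') J F y : E × E' →L[ℝ] E') =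
      (mfderiv 𝓘(ℝ, E × E') J G y : E × E' →L[ℝ] E') := by
    rintro F _ rfl
    rfl
  have h7 : ∀ (x x' : N) (D D' : E × E' →L[ℝ] E'), x = x' → D = D' →
      (β x : E' [⋀^Fin k]→L[ℝ] ℝ).compContinuousLinearMap D =
        (β x' : E' [⋀^Fin k]→L[ℝ] ℝ).compContinuousLinearMap D' := by
    rintro x _ D _ rfl rfl
    rfl
  exact h7 _ _ _ _ (congrFun h3 y) (h4.symm.trans ((h6 _ _ h3).trans h5))

theorem eventuallyEq_inChart_pullback_snd {k : ℕ} (β : Form J N k) (p : M × N) :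
    (Form.pullback (I' := I.prod J) (Prod.snd : M × N → N) β).inChart p
      =ᶠ[nhds (extChartAt (I.prod J) p p)] fun y =>
        (β.inChart p.2 y.2).compContinuousLinearMap (ContinuousLinearMap.snd ℝ E E') :=
  Filter.eventuallyEq_of_mem (extChartAt_target_mem_nhds p) fun _ => inChart_pullback_snd β p

theorem mfderiv_extChartAt_prod_fst (p : M × N) :
    (ContinuousLinearMap.fst ℝ E E').comp
        (mfderiv (I.prod J) 𝓘(ℝ, E × E') (extChartAt (I.prod J) p) p) =
      (mfderiv I 𝓘(ℝ, E) (extChartAt I p.1) p.1).comp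
        (mfderiv (I.prod J) I (Prod.fst : M × N → M) p) := by
  have : IsManifold I 1 M := IsManifold.of_le (n := ∞) (by norm_cast)
  have : IsManifold (I.prod J) 1 (M × N) := IsManifold.of_le (n := ∞) (by norm_cast)
  rw [← mfderiv_comp p (mdifferentiableAt_extChartAt (mem_chart_source H p.1))
    mdifferentiableAt_fst]
  have h : extChartAt I p.1 ∘ (Prod.fst : M × N → M) =
      (Prod.fst : E × E' → E) ∘ extChartAt (I.prod J) p := by
    rw [extChartAt_prod]
    rfl
  rw [h, mfderiv_comp p differentiableAt_fst.mdifferentiableAt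
    (mdifferentiableAt_extChartAt (mem_chart_source _ p)), mfderiv_eq_fderiv, fderiv_fst]
  rfl

theorem Form.d_pullback_fst {k : ℕ} {β : Form I M k} {p : M × N}
    (hβ : DifferentiableAt ℝ (β.inChart p.1) (extChartAt I p.1 p.1)) :
    (Form.pullback (I' := I.prod J) (Prod.fst : M × N → M) β).d p =
      Form.pullback (I' := I.prod J) (Prod.fst : M × N → M) β.d p := by
  have h1 : (extChartAt (I.prod J) p p).1 = extChartAt I p.1 p.1 := by
    rw [extChartAt_prod]
    rfl
  rw [← h1] at hβ
  have h2 := extDeriv_pullback (f := (Prod.fst : E × E' → E)) (x := extChartAt (I.prod J) p p)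
    (r := ω) hβ contDiff_fst.contDiffAt (by simp)
  simp only [fderiv_fst] at h2
  rw [Form.d, (eventuallyEq_inChart_pullback_fst β p).extDeriv_eq, h2, h1]
  have h3 := mfderiv_extChartAt_prod_fst (I := I) (J := J) p
  have h7 : ∀ D D' : TangentSpace (I.prod J) p →L[ℝ] E, D = D' →
      (extDeriv (β.inChart p.1) (extChartAt I p.1 p.1)).compContinuousLinearMap D =
      (extDeriv (β.inChart p.1) (extChartAt I p.1 p.1)).compContinuousLinearMap D' := by
    rintro D _ rfl
    rfl
  exact h7 _ _ h3

theorem differentiableAt_inChart_pullback_fst {k : ℕ} {β : Form I M k} {p : M × N}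
    (hβ : DifferentiableAt ℝ (β.inChart p.1) (extChartAt I p.1 p.1)) :
    DifferentiableAt ℝ ((Form.pullback (I' := I.prod J) (Prod.fst : M × N → M) β).inChart p)
      (extChartAt (I.prod J) p p) := by
  refine DifferentiableAt.congr_of_eventuallyEq ?_ (eventuallyEq_inChart_pullback_fst β p)
  have h1 : (extChartAt (I.prod J) p p).1 = extChartAt I p.1 p.1 := by
    rw [extChartAt_prod]
    rfl
  rw [← h1] at hβ
  exact ((ContinuousAlternatingMap.compContinuousLinearMapCLM
    (ContinuousLinearMap.fst ℝ E E')).differentiableAt.comp _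
      (hβ.comp _ differentiableAt_fst))

end Products

section CircleForm

/-! ## The invariant `1`-form of the circle -/

theorem contMDiff_coe_circle : ContMDiff (𝓡 1) 𝓘(ℝ, ℂ) ω fun w : Circle => (w : ℂ) :=
  haveI := finrank_real_complex_fact'
  contMDiff_coe_sphere (E := ℂ) (n := 1)

/-- The derivative of the inclusion of the circle into `ℂ`. -/
def coeDeriv (z : Circle) : EuclideanSpace ℝ (Fin 1) →L[ℝ] ℂ :=
  mfderiv (𝓡 1) 𝓘(ℝ, ℂ) (fun w : Circle => (w : ℂ)) z

theorem coeDeriv_injective (z : Circle) : Function.Injective (coeDeriv z) :=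
  haveI := finrank_real_complex_fact'
  injective_mvfderiv_subtypeVal_sphere (E := ℂ) (n := 1) z

/-- The functional `ds` at the point `z` of the circle. -/
def dsFunctional (z : Circle) : EuclideanSpace ℝ (Fin 1) →L[ℝ] ℝ :=
  Complex.imCLM.comp ((ContinuousLinearMap.mul ℝ ℂ (star (z : ℂ))).comp (coeDeriv z))

/-- Differentiating |z|² = 1 along the circle gives Re(z̄ dz) = 0. -/
theorem re_star_mul_coeDeriv (z : Circle) (v : EuclideanSpace ℝ (Fin 1)) :
    (star (z : ℂ) * coeDeriv z v).re = 0 := by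
  have h1 : MDifferentiableAt (𝓡 1) 𝓘(ℝ, ℂ) (fun w : Circle => (w : ℂ)) z :=
    contMDiff_coe_circle.mdifferentiable (by simp) z
  have h2 : HasFDerivAt (fun w : ℂ => ‖w‖ ^ 2) (2 • innerSL ℝ (z : ℂ)) (z : ℂ) :=
    (hasStrictFDerivAt_norm_sq (z : ℂ)).hasFDerivAt
  have h3 := h2.hasMFDerivAt.comp z h1.hasMFDerivAt
  have h4 : ((fun w : ℂ => ‖w‖ ^ 2) ∘ fun w : Circle => (w : ℂ)) = fun _ => (1 : ℝ) := by
    funext w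
    simp only [Function.comp_apply, Circle.norm_coe, one_pow]
  have h5 := h3.mfderiv
  rw [h4, mfderiv_const] at h5
  have h6 : (0 : ℝ) = (2 • innerSL ℝ (z : ℂ)) (coeDeriv z v) := DFunLike.congr_fun h5 v
  rw [two_smul, add_apply, innerSL_apply_apply, Complex.inner] at h6
  rw [Complex.star_def, mul_comm]
  linarith

/-- If ds(v) = 0 then z̄ dz(v) has vanishing real and imaginary parts, so dz(v) = 0, and the
inclusion of the circle is an immersion. Thus f ds can serve as the seventh covector. -/
theorem dsFunctional_injective (z : Circle) : Function.Injective (dsFunctional z) := by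
  rw [injective_iff_map_eq_zero]
  intro v hv
  have h1 : star (z : ℂ) * coeDeriv z v = 0 := Complex.ext (re_star_mul_coeDeriv z v) hv
  rcases mul_eq_zero.1 h1 with h | h
  · simp at h
  · exact (injective_iff_map_eq_zero _).1 (coeDeriv_injective z) v h

/-- The coordinate expression of `ds`. -/
def dsCoord (z : Circle) (y : EuclideanSpace ℝ (Fin 1)) : EuclideanSpace ℝ (Fin 1) →L[ℝ] ℝ :=
  Complex.imCLM.comp ((ContinuousLinearMap.mul ℝ ℂ (star ((extChartAt (𝓡 1) z).symm y : ℂ))).comp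
    (fderiv ℝ (fun y => ((extChartAt (𝓡 1) z).symm y : ℂ)) y))

theorem inChart_ds (z : Circle) {y : EuclideanSpace ℝ (Fin 1)}
    (hy : y ∈ (extChartAt (𝓡 1) z).target) : ds.inChart z y = oneForm (dsCoord z y) := by
  have : IsManifold (𝓡 1) ∞ Circle := IsManifold.of_le (n := ω) le_top
  have h1 := mfderiv_comp y (contMDiff_coe_circle.mdifferentiable (by simp) _)
    (mdifferentiableAt_extChartAt_symm hy)
  rw [mfderiv_eq_fderiv] at h1
  have h2 : dsCoord z y = (dsFunctional ((extChartAt (𝓡 1) z).symm y)).comp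
      (mfderiv 𝓘(ℝ, EuclideanSpace ℝ (Fin 1)) (𝓡 1) (extChartAt (𝓡 1) z).symm y) :=
    congrArg (fun D : EuclideanSpace ℝ (Fin 1) →L[ℝ] ℂ => Complex.imCLM.comp
      ((ContinuousLinearMap.mul ℝ ℂ (star ((extChartAt (𝓡 1) z).symm y : ℂ))).comp D)) h1
  rw [h2]
  rfl

theorem differentiableAt_dsCoord (z : Circle) :
    DifferentiableAt ℝ (dsCoord z) (extChartAt (𝓡 1) z z) := by
  have : IsManifold (𝓡 1) ∞ Circle := IsManifold.of_le (n := ω) le_top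
  have h1 : ContDiffAt ℝ ∞ (fun y => ((extChartAt (𝓡 1) z).symm y : ℂ)) (extChartAt (𝓡 1) z z) := by
    have h2 : ContMDiffOn 𝓘(ℝ, EuclideanSpace ℝ (Fin 1)) 𝓘(ℝ, ℂ) ∞
        (fun y => ((extChartAt (𝓡 1) z).symm y : ℂ)) (extChartAt (𝓡 1) z).target :=
      (contMDiff_coe_circle.of_le le_top).comp_contMDiffOn (contMDiffOn_extChartAt_symm z)
    exact h2.contDiffOn.contDiffAt (extChartAt_target_mem_nhds z)
  have h2 := (h1.fderiv_right (m := 1) (by norm_cast)).differentiableAt one_ne_zero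
  have h3 : DifferentiableAt ℝ (fun y => ContinuousLinearMap.mul ℝ ℂ
      (star ((extChartAt (𝓡 1) z).symm y : ℂ))) (extChartAt (𝓡 1) z z) :=
    (ContinuousLinearMap.mul ℝ ℂ).differentiableAt.comp _
      ((h1.differentiableAt (by simp)).star)
  exact (differentiableAt_const _).clm_comp (h3.clm_comp h2)

/-- Applied to the derivative of the coordinate expression of ds, this says that ds is closed. -/
theorem bilinear_symm_of_line (B : EuclideanSpace ℝ (Fin 1) →L[ℝ] EuclideanSpace ℝ (Fin 1) →L[ℝ] ℝ)
    (v w : EuclideanSpace ℝ (Fin 1)) : B v w = B w v := by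
  have h : ∀ v : EuclideanSpace ℝ (Fin 1), v = v 0 • EuclideanSpace.single 0 1 := by
    intro v
    ext i
    fin_cases i
    simp
  rw [h v, h w]
  simp [mul_left_comm]

end CircleForm

/-! ### The exterior derivative of products with ds -/

section ProductWithCircle

variable {E : Type*} [NormedAddCommGroup E] [NormedSpace ℝ E] {H : Type*} [TopologicalSpace H]
  {I : ModelWithCorners ℝ E H} [I.Boundaryless] {M : Type*} [TopologicalSpace M] [ChartedSpace H M]
  [IsManifold I ∞ M]

theorem Form.d_pullback_wedge_ds {k : ℕ} {β : Form I M k} {p : M × Circle}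
    (hβ : DifferentiableAt ℝ (β.inChart p.1) (extChartAt I p.1 p.1)) :
    ((Form.pullback (I' := I.prod (𝓡 1)) (Prod.fst : M × Circle → M) β).wedge
        (Form.pullback Prod.snd ds)).d p =
      WarpedG2.wedge (Form.pullback (I' := I.prod (𝓡 1)) (Prod.fst : M × Circle → M) β.d p)
        (Form.pullback (I' := I.prod (𝓡 1)) (Prod.snd : M × Circle → Circle) ds p) := by
  have : IsManifold (𝓡 1) ∞ Circle := IsManifold.of_le (n := ω) le_top
  rw [← Form.d_pullback_fst hβ]
  have h1 : (extChartAt (I.prod (𝓡 1)) p p).2 = extChartAt (𝓡 1) p.2 p.2 := by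
    rw [extChartAt_prod]
    rfl
  have h2 := (differentiableAt_dsCoord p.2).hasFDerivAt
  rw [← h1] at h2
  have h3 : HasFDerivAt (fun y : E × EuclideanSpace ℝ (Fin 1) => (dsCoord p.2 y.2).comp
      (ContinuousLinearMap.snd ℝ E (EuclideanSpace ℝ (Fin 1)))) _ (extChartAt (I.prod (𝓡 1)) p p) :=
    ((ContinuousLinearMap.compL ℝ (E × EuclideanSpace ℝ (Fin 1)) (EuclideanSpace ℝ (Fin 1)) ℝ).flip
      (ContinuousLinearMap.snd ℝ E (EuclideanSpace ℝ (Fin 1)))).hasFDerivAt.comp _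
        (h2.comp _ hasFDerivAt_snd)
  refine Form.d_wedge_oneForm (differentiableAt_inChart_pullback_fst hβ)
    (L := fun y => (dsCoord p.2 y.2).comp
      (ContinuousLinearMap.snd ℝ E (EuclideanSpace ℝ (Fin 1)))) ?_ h3.differentiableAt ?_
  · filter_upwards [eventuallyEq_inChart_pullback_snd (I := I) ds p,
      extChartAt_target_mem_nhds (I := I.prod (𝓡 1)) p] with y hy hy'
    rw [extChartAt_prod] at hy'
    rw [hy, inChart_ds p.2 hy'.2]
    rfl
  · intro v w
    rw [h3.fderiv]
    exact bilinear_symm_of_line _ v.2 w.2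

end ProductWithCircle

section Lifts

variable {V : Type*} [AddCommGroup V] [Module ℝ V] [TopologicalSpace V]
  {W : Type*} [AddCommGroup W] [Module ℝ W] [TopologicalSpace W]

/-! ## Adapted frames on products -/

theorem add_compContinuousLinearMap {k : ℕ} (a b : W [⋀^Fin k]→L[ℝ] ℝ) (A : V →L[ℝ] W) :
    (a + b).compContinuousLinearMap A =
      a.compContinuousLinearMap A + b.compContinuousLinearMap A := rfl

theorem sub_compContinuousLinearMap {k : ℕ} (a b : W [⋀^Fin k]→L[ℝ] ℝ) (A : V →L[ℝ] W) :
    (a - b).compContinuousLinearMap A =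
      a.compContinuousLinearMap A - b.compContinuousLinearMap A := rfl

theorem neg_compContinuousLinearMap {k : ℕ} (a : W [⋀^Fin k]→L[ℝ] ℝ) (A : V →L[ℝ] W) :
    (-a).compContinuousLinearMap A = -a.compContinuousLinearMap A := rfl

theorem smul_compContinuousLinearMap {k : ℕ} (c : ℝ) (a : W [⋀^Fin k]→L[ℝ] ℝ) (A : V →L[ℝ] W) :
    (c • a).compContinuousLinearMap A = c • a.compContinuousLinearMap A := rfl

/-- The first six elements of the coframe of `u` are the pullbacks by `A` of the coframe of `w`. -/
def IsLift (u : V ≃L[ℝ] (Fin 7 → ℝ)) (w : W ≃L[ℝ] (Fin 6 → ℝ)) (A : V →L[ℝ] W) : Prop :=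
  ∀ i : Fin 6, coframe u i.castSucc = (coframe w i).comp A

section

variable {u : V ≃L[ℝ] (Fin 7 → ℝ)} {w : W ≃L[ℝ] (Fin 6 → ℝ)} {A : V →L[ℝ] W}

theorem IsLift.elem_comp (h : IsLift u w A) {k : ℕ} (i : Fin k → Fin 6) :
    (elem w i).compContinuousLinearMap A = elem u fun a => (i a).castSucc := by
  refine ContinuousAlternatingMap.ext fun v => ?_
  rw [ContinuousAlternatingMap.compContinuousLinearMap_apply, elem_apply_det, elem_apply_det]
  simp only [h _]
  rfl

theorem IsLift.basisVec_last (h : IsLift u w A) : A (basisVec u 6) = 0 := by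
  apply w.injective
  ext i
  have h1 := DFunLike.congr_fun (h i) (basisVec u 6)
  have h2 : i.castSucc ≠ 6 := (Fin.castSucc_lt_last i).ne
  rw [coframe_basisVec, if_neg h2] at h1
  rw [map_zero]
  exact h1.symm

theorem IsLift.val_comp (h : IsLift u w A) {k : ℕ} (a : W [⋀^Fin k]→L[ℝ] ℝ) (t : List (Fin 7))
    (ht : 6 ∈ t) : val u (a.compContinuousLinearMap A) t = 0 := by
  unfold val
  split_ifs with hk
  · obtain ⟨m, hm, hm'⟩ := List.getElem_of_mem ht
    refine a.map_coord_zero ⟨m, hk ▸ hm⟩ ?_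
    simp only [List.getD_eq_getElem _ _ hm, hm']
    exact h.basisVec_last
  · rfl

variable {om : W [⋀^Fin 2]→L[ℝ] ℝ} {ψp ψm : W [⋀^Fin 3]→L[ℝ] ℝ}

theorem IsLift.omega_comp (h : IsLift u w A) (hw : IsSU3Frame om ψp ψm w) :
    om.compContinuousLinearMap A = modelOmega u := by
  rw [hw.omega_eq, add_compContinuousLinearMap, add_compContinuousLinearMap, h.elem_comp,
    h.elem_comp, h.elem_comp, elemL_eq u [0, 1] _ (by decide), elemL_eq u [2, 3] _ (by decide),
    elemL_eq u [4, 5] _ (by decide)]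
  rfl

theorem IsLift.psiPlus_comp (h : IsLift u w A) (hw : IsSU3Frame om ψp ψm w) :
    ψp.compContinuousLinearMap A = modelPsiPlus u := by
  rw [hw.psiPlus_eq, sub_compContinuousLinearMap, sub_compContinuousLinearMap,
    sub_compContinuousLinearMap, h.elem_comp, h.elem_comp, h.elem_comp, h.elem_comp,
    elemL_eq u [0, 2, 4] _ (by decide), elemL_eq u [0, 3, 5] _ (by decide),
    elemL_eq u [1, 2, 5] _ (by decide), elemL_eq u [1, 3, 4] _ (by decide)]
  rfl

theorem IsLift.psiMinus_comp (h : IsLift u w A) (hw : IsSU3Frame om ψp ψm w) :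
    ψm.compContinuousLinearMap A = modelPsiMinus u := by
  rw [hw.psiMinus_eq, add_compContinuousLinearMap, add_compContinuousLinearMap,
    add_compContinuousLinearMap, neg_compContinuousLinearMap, h.elem_comp, h.elem_comp,
    h.elem_comp, h.elem_comp,
    elemL_eq u [1, 3, 5] _ (by decide), elemL_eq u [1, 2, 4] _ (by decide),
    elemL_eq u [0, 3, 4] _ (by decide), elemL_eq u [0, 2, 5] _ (by decide)]
  rfl

end

/-- The rotation by the angle with cosine `α` and sine `β` of the first two coordinates. -/
def rotation (α β : ℝ) (hαβ : α ^ 2 + β ^ 2 = 1) : (Fin 6 → ℝ) ≃L[ℝ] (Fin 6 → ℝ) :=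
  LinearEquiv.toContinuousLinearEquiv
  { toFun := fun x => ![α * x 0 - β * x 1, α * x 1 + β * x 0, x 2, x 3, x 4, x 5]
    invFun := fun x => ![α * x 0 + β * x 1, α * x 1 - β * x 0, x 2, x 3, x 4, x 5]
    map_add' := fun x y => by
      ext i
      fin_cases i <;> simp <;> ring
    map_smul' := fun c x => by
      ext i
      fin_cases i <;> simp <;> ring
    left_inv := fun x => by
      ext i
      fin_cases i <;> simp
      · linear_combination x 0 * hαβ
      · linear_combination x 1 * hαβ
    right_inv := fun x => by
      ext i
      fin_cases i <;> simp
      · linear_combination x 0 * hαβ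
      · linear_combination x 1 * hαβ }

/-- The new coframe has e'¹+ie'² = (α+iβ)(e¹+ie²). This multiplies ψ₊+iψ₋ by α+iβ, and a rotation
leaves e¹² unchanged. -/
theorem IsSU3Frame.rotate {om : W [⋀^Fin 2]→L[ℝ] ℝ} {ψp ψm : W [⋀^Fin 3]→L[ℝ] ℝ}
    {w : W ≃L[ℝ] (Fin 6 → ℝ)} (hw : IsSU3Frame om ψp ψm w) (α β : ℝ) (hαβ : α ^ 2 + β ^ 2 = 1) :
    IsSU3Frame om (α • ψp - β • ψm) (α • ψm + β • ψp) (w.trans (rotation α β hαβ)) := by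
  set w' := w.trans (rotation α β hαβ)
  have h0 : ∀ x, coframe w' 0 x = α * coframe w 0 x - β * coframe w 1 x := fun _ => rfl
  have h1 : ∀ x, coframe w' 1 x = α * coframe w 1 x + β * coframe w 0 x := fun _ => rfl
  have h2 : ∀ x, coframe w' 2 x = coframe w 2 x := fun _ => rfl
  have h3 : ∀ x, coframe w' 3 x = coframe w 3 x := fun _ => rfl
  have h4 : ∀ x, coframe w' 4 x = coframe w 4 x := fun _ => rfl
  have h5 : ∀ x, coframe w' 5 x = coframe w 5 x := fun _ => rfl
  refine ⟨hw.omega_eq.trans ?_, ?_, ?_⟩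
  · ext v
    simp [elem_apply_det, Matrix.det_fin_two, h0, h1, h2, h3, h4, h5]
    linear_combination (coframe w 0 (v 1) * coframe w 1 (v 0)
      - coframe w 0 (v 0) * coframe w 1 (v 1)) * hαβ
  · rw [hw.psiPlus_eq, hw.psiMinus_eq]
    ext v
    simp [elem_apply_det, Matrix.det_fin_three, h0, h1, h2, h3, h4, h5]
    ring
  · rw [hw.psiPlus_eq, hw.psiMinus_eq]
    ext v
    simp [elem_apply_det, Matrix.det_fin_three, h0, h1, h2, h3, h4, h5]
    ring

/-- The six pulled back covectors and cL have no common kernel, so they form a coframe by dimension.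
In the application L is ds and c is the value of f, which explains the hypothesis c ≠ 0. -/
theorem exists_lift (w : EuclideanSpace ℝ (Fin 6) ≃L[ℝ] (Fin 6 → ℝ))
    {L : EuclideanSpace ℝ (Fin 1) →L[ℝ] ℝ} (hL : Function.Injective L) {c : ℝ} (hc : c ≠ 0) :
    ∃ u : (EuclideanSpace ℝ (Fin 6) × EuclideanSpace ℝ (Fin 1)) ≃L[ℝ] (Fin 7 → ℝ),
      IsLift u w (ContinuousLinearMap.fst ℝ _ _) ∧
      coframe u 6 = c • L.comp (ContinuousLinearMap.snd ℝ _ _) := by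
  let F : (EuclideanSpace ℝ (Fin 6) × EuclideanSpace ℝ (Fin 1)) →ₗ[ℝ] (Fin 7 → ℝ) :=
    LinearMap.pi (Fin.snoc (α := fun _ => (EuclideanSpace ℝ (Fin 6) ×
      EuclideanSpace ℝ (Fin 1)) →ₗ[ℝ] ℝ)
      (fun i : Fin 6 => ((coframe w i).comp (ContinuousLinearMap.fst ℝ _ _)).toLinearMap)
      (c • L.comp (ContinuousLinearMap.snd ℝ _ _)).toLinearMap)
  have h1 : ∀ x (i : Fin 6), F x i.castSucc = w x.1 i := by
    intro x i
    simp only [F, LinearMap.pi_apply, Fin.snoc_castSucc]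
    rfl
  have h2 : ∀ x, F x 6 = c * L x.2 := by
    intro x
    have : (6 : Fin 7) = Fin.last 6 := rfl
    simp only [F, LinearMap.pi_apply, this, Fin.snoc_last]
    rfl
  have hF : Function.Injective F := by
    rw [injective_iff_map_eq_zero]
    intro x hx
    refine Prod.ext (w.injective ?_) (hL ?_)
    · ext i
      rw [← h1, hx, Prod.fst_zero, map_zero]
      rfl
    · have h3 := h2 x
      rw [hx] at h3
      rw [Prod.snd_zero, map_zero]
      exact (mul_eq_zero.1 h3.symm).resolve_left hc
  refine ⟨(LinearEquiv.ofInjectiveOfFinrankEq F hF (by simp)).toContinuousLinearEquiv, ?_, ?_⟩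
  · intro i
    exact ContinuousLinearMap.ext fun x => h1 x i
  · exact ContinuousLinearMap.ext fun x => h2 x

end Lifts

/-! ### Identities between the model forms -/

section WarpedFrames

variable {V : Type*} [AddCommGroup V] [Module ℝ V] [TopologicalSpace V]
  {W : Type*} [AddCommGroup W] [Module ℝ W] [TopologicalSpace W]

theorem modelG2_eq (u : V ≃L[ℝ] (Fin 7 → ℝ)) :
    modelG2 u = wedge (modelOmega u) (elemL u 1 [6]) + modelPsiPlus u := by
  apply form_ext u
  rw [finRange_seven]
  simp only [List.sublistsLen_succ_cons, List.sublistsLen_zero,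
    List.sublistsLen_succ_nil, List.map_cons, List.map_nil, List.cons_append, List.nil_append,
    List.forall_mem_cons, List.not_mem_nil, false_imp_iff, implies_true, and_true]
  simp (maxSteps := 1000000) (disch := decide) only [modelG2, modelOmega, modelPsiPlus,
    val_wedge_elemL, strip, pull, List.length_cons, List.length_nil,
    Fin.isValue, Fin.reduceEq, reduceIte, val_add, val_sub, val_elemL]
  norm_num

theorem wedge_modelPsiPlus_modelOmega (u : V ≃L[ℝ] (Fin 7 → ℝ)) :
    wedge (modelPsiPlus u) (modelOmega u) = 0 := by
  apply form_ext u
  rw [finRange_seven]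
  simp only [List.sublistsLen_succ_cons, List.sublistsLen_zero,
    List.sublistsLen_succ_nil, List.map_cons, List.map_nil, List.cons_append, List.nil_append,
    List.forall_mem_cons, List.not_mem_nil, false_imp_iff, implies_true, and_true]
  simp (maxSteps := 1000000) (disch := decide) only [modelOmega, modelPsiPlus, wedge_add_right,
    val_wedge_elemL, strip, pull, List.length_cons, List.length_nil, val_zero,
    Fin.isValue, Fin.reduceEq, reduceIte, val_add, val_sub, val_elemL]
  norm_num

theorem wedge_modelPsiMinus_modelOmega (u : V ≃L[ℝ] (Fin 7 → ℝ)) :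
    wedge (modelPsiMinus u) (modelOmega u) = 0 := by
  apply form_ext u
  rw [finRange_seven]
  simp only [List.sublistsLen_succ_cons, List.sublistsLen_zero,
    List.sublistsLen_succ_nil, List.map_cons, List.map_nil, List.cons_append, List.nil_append,
    List.forall_mem_cons, List.not_mem_nil, false_imp_iff, implies_true, and_true]
  simp (maxSteps := 1000000) (disch := decide) only [modelOmega, modelPsiMinus, wedge_add_right,
    val_wedge_elemL, strip, pull, List.length_cons, List.length_nil, val_zero,
    Fin.isValue, Fin.reduceEq, reduceIte, val_add, val_neg, val_elemL]
  norm_num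

theorem wedge_wedge_modelOmega (u : V ≃L[ℝ] (Fin 7 → ℝ)) (v : V [⋀^Fin 1]→L[ℝ] ℝ) :
    wedge (wedge v (modelOmega u)) (modelOmega u) =
      (wedge v (modelOmegaSq u) : V [⋀^Fin 5]→L[ℝ] ℝ) := by
  apply form_ext u
  rw [finRange_seven]
  simp only [List.sublistsLen_succ_cons, List.sublistsLen_zero,
    List.sublistsLen_succ_nil, List.map_cons, List.map_nil, List.cons_append, List.nil_append,
    List.forall_mem_cons, List.not_mem_nil, false_imp_iff, implies_true, and_true]
  simp (maxSteps := 1000000) (disch := decide) only [modelOmega, modelOmegaSq, wedge_add_right,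
    wedge_smul_right, val_smul,
    val_wedge_elemL, strip, pull, List.length_cons, List.length_nil,
    Fin.isValue, Fin.reduceEq, reduceIte, val_add]
  norm_num
  ring_nf
  norm_num

/-- For a form without e⁷, either equation says that its type is (1,1). Since Ω²₈ is defined with ψ₊
only, this is needed for its invariance under the rotation. -/
theorem wedge_modelPsiMinus_eq_zero (u : V ≃L[ℝ] (Fin 7 → ℝ)) {σ : V [⋀^Fin 2]→L[ℝ] ℝ}
    (h : ∀ t, 6 ∈ t → val u σ t = 0) (hσ : wedge σ (modelPsiPlus u) = 0) :
    wedge σ (modelPsiMinus u) = 0 := by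
  rw [form_eq_zero_iff u, finRange_seven] at hσ ⊢
  simp only [List.sublistsLen_succ_cons, List.sublistsLen_zero,
    List.sublistsLen_succ_nil, List.map_cons, List.map_nil, List.cons_append, List.nil_append,
    List.forall_mem_cons, List.not_mem_nil, false_imp_iff, implies_true, and_true] at hσ ⊢
  simp (maxSteps := 1000000) (disch := decide) only [modelPsiPlus, modelPsiMinus, wedge_add_right,
    wedge_sub_right, wedge_neg_right, h, val_neg, val_sub,
    val_wedge_elemL, strip, pull, List.length_cons, List.length_nil,
    Fin.isValue, Fin.reduceEq, reduceIte, val_add] at hσ ⊢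
  norm_num at hσ ⊢
  casesm* _ ∧ _
  refine ⟨?_, ?_, ?_, ?_, ?_, ?_⟩ <;> linarith

end WarpedFrames

/-! ### The torsion of the rotated structure at a point -/

section WarpedTorsion

variable {V : Type*} [AddCommGroup V] [Module ℝ V] [TopologicalSpace V]
  {W : Type*} [AddCommGroup W] [Module ℝ W] [TopologicalSpace W]

theorem wedge_neg_left {k l : ℕ} (a : V [⋀^Fin k]→L[ℝ] ℝ) (b : V [⋀^Fin l]→L[ℝ] ℝ) :
    wedge (-a) b = -wedge a b := by
  ext v
  simp only [wedge_apply, ContinuousAlternatingMap.neg_apply, neg_mul, mul_neg,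
    Finset.sum_neg_distrib]

theorem wedge_sub_left {k l : ℕ} (a a' : V [⋀^Fin k]→L[ℝ] ℝ) (b : V [⋀^Fin l]→L[ℝ] ℝ) :
    wedge (a - a') b = wedge a b - wedge a' b := by
  rw [sub_eq_add_neg, wedge_add_left, wedge_neg_left, sub_eq_add_neg]

/-- The algebraic relations between an `SU(3)`-structure and its torsion forms at a point; `D`,
`Dp`, `Dm` are the exterior derivatives of `om`, `ψp`, `ψm`. -/
structure IsTorsionAt (om : W [⋀^Fin 2]→L[ℝ] ℝ) (ψp ψm : W [⋀^Fin 3]→L[ℝ] ℝ) (π₀ σ₀ : ℝ)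
    (π₁ ν₁ : W [⋀^Fin 1]→L[ℝ] ℝ) (π₂ σ₂ : W [⋀^Fin 2]→L[ℝ] ℝ) (ν₃ : W [⋀^Fin 3]→L[ℝ] ℝ)
    (D : W [⋀^Fin 3]→L[ℝ] ℝ) (Dp Dm : W [⋀^Fin 4]→L[ℝ] ℝ) : Prop where
  pi2_psiPlus : wedge π₂ ψp = 0
  pi2_omega_sq : wedge π₂ (wedge om om) = 0
  sigma2_psiPlus : wedge σ₂ ψp = 0
  sigma2_omega_sq : wedge σ₂ (wedge om om) = 0
  nu3_omega : wedge ν₃ om = 0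
  nu3_psiPlus : wedge ν₃ ψp = 0
  nu3_psiMinus : wedge ν₃ ψm = 0
  d_omega : D = (-(3 / 2) : ℝ) • (σ₀ • ψp) + (3 / 2 : ℝ) • (π₀ • ψm) + wedge ν₁ om + ν₃
  d_psiPlus : Dp = π₀ • wedge om om + wedge π₁ ψp - wedge π₂ om
  d_psiMinus : Dm = σ₀ • wedge om om + wedge π₁ ψm - wedge σ₂ om

variable {om : W [⋀^Fin 2]→L[ℝ] ℝ} {ψp ψm : W [⋀^Fin 3]→L[ℝ] ℝ} {π₀ σ₀ : ℝ}
    {π₁ ν₁ : W [⋀^Fin 1]→L[ℝ] ℝ} {π₂ σ₂ : W [⋀^Fin 2]→L[ℝ] ℝ} {ν₃ : W [⋀^Fin 3]→L[ℝ] ℝ}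
    {D : W [⋀^Fin 3]→L[ℝ] ℝ} {Dp Dm : W [⋀^Fin 4]→L[ℝ] ℝ}

/-- The structure equations are rewritten in Ψ₊ = αψ₊−βψ₋ and Ψ₋ = αψ₋+βψ₊: the pairs (π₀,σ₀) and
(π₂,σ₂) rotate, the other components stay. The unrotated frames enter only through the relation
between ψ₊ and ψ₋ on Ω²₈. -/
theorem IsTorsionAt.isWarpedTorsion (hT : IsTorsionAt om ψp ψm π₀ σ₀ π₁ ν₁ π₂ σ₂ ν₃ D Dp Dm)
    {A : V →L[ℝ] W} {w₀ w : W ≃L[ℝ] (Fin 6 → ℝ)} {u₀ u : V ≃L[ℝ] (Fin 7 → ℝ)}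
    (hw₀ : IsSU3Frame om ψp ψm w₀) (hu₀ : IsLift u₀ w₀ A) {α β : ℝ} (hαβ : α ^ 2 + β ^ 2 = 1)
    (hw : IsSU3Frame om (α • ψp - β • ψm) (α • ψm + β • ψp) w) (hu : IsLift u w A)
    (z : W [⋀^Fin 1]→L[ℝ] ℝ) {X : V [⋀^Fin 4]→L[ℝ] ℝ} {Y : V [⋀^Fin 5]→L[ℝ] ℝ}
    (hX : X = wedge ((D + wedge z om : W [⋀^Fin 3]→L[ℝ] ℝ).compContinuousLinearMap A)
      (elemL u 1 [6]) + (α • Dp - β • Dm).compContinuousLinearMap A)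
    (hY : Y = (wedge D om : W [⋀^Fin 5]→L[ℝ] ℝ).compContinuousLinearMap A +
      wedge ((α • Dm + β • Dp + wedge z (α • ψm + β • ψp) :
        W [⋀^Fin 4]→L[ℝ] ℝ).compContinuousLinearMap A) (elemL u 1 [6])) :
    IsWarpedTorsion u (z.compContinuousLinearMap A) (π₁.compContinuousLinearMap A)
      (ν₁.compContinuousLinearMap A) ((α • π₂ - β • σ₂).compContinuousLinearMap A)
      ((α • σ₂ + β • π₂).compContinuousLinearMap A) (ν₃.compContinuousLinearMap A)
      (α * π₀ - β * σ₀) (α * σ₀ + β * π₀) X Y := by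
  have e1 := hu.omega_comp hw
  have e2 := hu.psiPlus_comp hw
  have e3 := hu.psiMinus_comp hw
  have e4 : (wedge om om).compContinuousLinearMap A = modelOmegaSq u := by
    rw [wedge_compContinuousLinearMap, e1, wedge_modelOmega_self]
  have hm : ∀ σ : W [⋀^Fin 2]→L[ℝ] ℝ, wedge σ ψp = 0 →
      wedge (σ.compContinuousLinearMap A) (modelPsiPlus u) = 0 := by
    intro σ hσ
    have h1 : wedge (σ.compContinuousLinearMap A) (ψp.compContinuousLinearMap A) = 0 := by
      rw [← wedge_compContinuousLinearMap, hσ]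
      rfl
    have h2 : wedge (σ.compContinuousLinearMap A) (ψm.compContinuousLinearMap A) = 0 := by
      rw [hu₀.psiMinus_comp hw₀]
      rw [hu₀.psiPlus_comp hw₀] at h1
      exact wedge_modelPsiMinus_eq_zero u₀ (fun t ht => hu₀.val_comp σ t ht) h1
    rw [← e2, sub_compContinuousLinearMap, smul_compContinuousLinearMap,
      smul_compContinuousLinearMap, wedge_sub_right, wedge_smul_right, wedge_smul_right, h1, h2,
      smul_zero, smul_zero, sub_zero]
  have hsq : ∀ σ : W [⋀^Fin 2]→L[ℝ] ℝ, wedge σ (wedge om om) = 0 →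
      wedge (σ.compContinuousLinearMap A) (modelOmegaSq u) = 0 := by
    intro σ hσ
    rw [← e4, ← wedge_compContinuousLinearMap, hσ]
    rfl
  refine
    { horizontal_z := hu.val_comp z
      horizontal_p := hu.val_comp π₁
      horizontal_v := hu.val_comp ν₁
      horizontal_p2 := hu.val_comp _
      horizontal_s2 := hu.val_comp _
      horizontal_v3 := hu.val_comp ν₃
      p2_psi := hm _ ?_
      p2_omega := hsq _ ?_
      s2_psi := hm _ ?_
      s2_omega := hsq _ ?_
      v3_omega := ?_
      v3_psiPlus := ?_
      v3_psiMinus := ?_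
      exists_Q := ⟨(D + wedge z om : W [⋀^Fin 3]→L[ℝ] ℝ).compContinuousLinearMap A, ?_, ?_⟩
      exists_S := ⟨(α • Dm + β • Dp + wedge z (α • ψm + β • ψp) :
        W [⋀^Fin 4]→L[ℝ] ℝ).compContinuousLinearMap A, ?_, ?_⟩ }
  · rw [wedge_sub_left, wedge_smul_left, wedge_smul_left, hT.pi2_psiPlus, hT.sigma2_psiPlus,
      smul_zero, smul_zero, sub_zero]
  · rw [wedge_sub_left, wedge_smul_left, wedge_smul_left, hT.pi2_omega_sq, hT.sigma2_omega_sq,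
      smul_zero, smul_zero, sub_zero]
  · rw [wedge_add_left, wedge_smul_left, wedge_smul_left, hT.pi2_psiPlus, hT.sigma2_psiPlus,
      smul_zero, smul_zero, add_zero]
  · rw [wedge_add_left, wedge_smul_left, wedge_smul_left, hT.pi2_omega_sq, hT.sigma2_omega_sq,
      smul_zero, smul_zero, add_zero]
  · rw [← e1, ← wedge_compContinuousLinearMap, hT.nu3_omega]
    rfl
  · rw [← e2, ← wedge_compContinuousLinearMap, wedge_sub_right, wedge_smul_right, wedge_smul_right,
      hT.nu3_psiPlus, hT.nu3_psiMinus, smul_zero, smul_zero, sub_zero]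
    rfl
  · rw [← e3, ← wedge_compContinuousLinearMap, wedge_add_right, wedge_smul_right, wedge_smul_right,
      hT.nu3_psiPlus, hT.nu3_psiMinus, smul_zero, smul_zero, add_zero]
    rfl
  · intro t
    rw [← e1, ← e2, ← e3, hT.d_omega, ← wedge_compContinuousLinearMap,
      ← wedge_compContinuousLinearMap]
    simp only [add_compContinuousLinearMap, sub_compContinuousLinearMap,
      smul_compContinuousLinearMap, val_add, val_sub, val_smul]
    -- The terms in ψ₊ and ψ₋ come back multiplied by α²+β².
    linear_combination (-(3 / 2) * σ₀ * val u (ψp.compContinuousLinearMap A) t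
      + 3 / 2 * π₀ * val u (ψm.compContinuousLinearMap A) t) * (-hαβ)
  · intro t
    rw [hX, hT.d_psiPlus, hT.d_psiMinus, ← e4, ← e1, ← e2, ← wedge_compContinuousLinearMap,
      ← wedge_compContinuousLinearMap]
    simp only [wedge_sub_right, wedge_smul_right, wedge_add_left, wedge_sub_left, wedge_smul_left,
      add_compContinuousLinearMap, sub_compContinuousLinearMap,
      smul_compContinuousLinearMap, val_add, val_sub, val_smul]
    ring
  · intro t
    rw [← e1, ← e3, ← e4, hT.d_psiPlus, hT.d_psiMinus, ← wedge_compContinuousLinearMap,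
      ← wedge_compContinuousLinearMap, ← wedge_compContinuousLinearMap]
    simp only [wedge_add_right, wedge_smul_right, wedge_add_left, wedge_smul_left,
      add_compContinuousLinearMap, sub_compContinuousLinearMap,
      smul_compContinuousLinearMap, val_add, val_sub, val_smul]
    ring
  · intro t
    rw [hY, val_add]
    refine congrArg (· + _) (congrArg (fun a => val u a t) ?_)
    have h1 : wedge ((α • ψp - β • ψm).compContinuousLinearMap A) (modelOmega u) = 0 := by
      rw [e2]
      exact wedge_modelPsiPlus_modelOmega u
    have h2 : wedge ((α • ψm + β • ψp).compContinuousLinearMap A) (modelOmega u) = 0 := by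
      rw [e3]
      exact wedge_modelPsiMinus_modelOmega u
    -- In this form dω∧ω reduces to ν₁∧ω∧ω, because Ψ₊, Ψ₋ and ν₃ are annihilated by ω.
    have h3 : D = (wedge ν₁ om : W [⋀^Fin 3]→L[ℝ] ℝ) + ν₃
        + (-(3 / 2) * (α * σ₀ + β * π₀)) • (α • ψp - β • ψm)
        + (3 / 2 * (α * π₀ - β * σ₀)) • (α • ψm + β • ψp) := by
      rw [hT.d_omega]
      refine ContinuousAlternatingMap.ext fun v => ?_
      simp only [ContinuousAlternatingMap.add_apply, ContinuousAlternatingMap.sub_apply,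
        ContinuousAlternatingMap.smul_apply, smul_eq_mul]
      linear_combination (-(3 / 2) * σ₀ * ψp v + 3 / 2 * π₀ * ψm v) * (-hαβ)
    rw [h3, wedge_add_left, wedge_add_left, wedge_add_left, hT.nu3_omega, add_zero,
      wedge_smul_left, wedge_smul_left, add_compContinuousLinearMap, add_compContinuousLinearMap,
      smul_compContinuousLinearMap, smul_compContinuousLinearMap, wedge_compContinuousLinearMap,
      wedge_compContinuousLinearMap, wedge_compContinuousLinearMap, wedge_compContinuousLinearMap,
      e1, h1, h2, smul_zero, smul_zero, add_zero, add_zero]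
    exact wedge_wedge_modelOmega u _

end WarpedTorsion

local infixr:70 " ⋏ " => Form.wedge
local infixr:73 " ⊙ " => Form.mulFun

section Differentiability

variable {E : Type*} [NormedAddCommGroup E] [NormedSpace ℝ E] {H : Type*} [TopologicalSpace H]
  {I : ModelWithCorners ℝ E H} {M : Type*} [TopologicalSpace M] [ChartedSpace H M]

/-! ## Differentiability of coordinate expressions -/

/-- The coordinate expression of `β` around `x` is differentiable at `x`. -/
def Form.DiffAt {k : ℕ} (β : Form I M k) (x : M) : Prop :=
  DifferentiableAt ℝ (β.inChart x) (extChartAt I x x)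

theorem Form.DiffAt.add {k : ℕ} {β γ : Form I M k} {x : M} (hβ : β.DiffAt x) (hγ : γ.DiffAt x) :
    (β + γ).DiffAt x :=
  DifferentiableAt.add hβ hγ

theorem Form.DiffAt.sub {k : ℕ} {β γ : Form I M k} {x : M} (hβ : β.DiffAt x) (hγ : γ.DiffAt x) :
    (β - γ).DiffAt x :=
  DifferentiableAt.sub hβ hγ

theorem Form.DiffAt.smul {k : ℕ} {β : Form I M k} {x : M} (hβ : β.DiffAt x) (c : ℝ) :
    (c • β).DiffAt x :=
  DifferentiableAt.const_smul hβ c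

theorem Form.DiffAt.wedge {k l : ℕ} {β : Form I M k} {γ : Form I M l} {x : M} (hβ : β.DiffAt x)
    (hγ : γ.DiffAt x) : (β ⋏ γ).DiffAt x := by
  have h : (β ⋏ γ).inChart x = fun y => wedgeCLM k l (β.inChart x y) (γ.inChart x y) :=
    funext fun y => Form.inChart_wedge β γ x y
  rw [Form.DiffAt, h]
  exact ((wedgeCLM k l).hasFDerivAt_of_bilinear (DifferentiableAt.hasFDerivAt hβ)
    (DifferentiableAt.hasFDerivAt hγ)).differentiableAt

theorem Form.DiffAt.mulFun [I.Boundaryless] [IsManifold I ∞ M] {k : ℕ} {β : Form I M k} {x : M}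
    (hβ : β.DiffAt x) {g : M → ℝ} (hg : MDifferentiableAt I 𝓘(ℝ, ℝ) g x) : (g ⊙ β).DiffAt x :=
  DifferentiableAt.smul (fderiv_comp_extChartAt_symm hg).1 hβ

theorem Form.d_sub {k : ℕ} {β γ : Form I M k} {x : M} (hβ : β.DiffAt x) (hγ : γ.DiffAt x) :
    (β - γ).d x = β.d x - γ.d x := by
  have h := Form.d_add (Form.DiffAt.sub hβ hγ) hγ
  rw [sub_add_cancel] at h
  rw [h, add_sub_cancel_right]

theorem ds_diffAt (z : Circle) : ds.DiffAt z := by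
  have h : ds.inChart z =ᶠ[nhds (extChartAt (𝓡 1) z z)] fun y =>
      (ContinuousAlternatingMap.ofSubsingletonLIE (𝕜 := ℝ) (F := ℝ) (0 : Fin 1))
        (dsCoord z y) :=
    Filter.eventuallyEq_of_mem (extChartAt_target_mem_nhds z) fun y hy => inChart_ds z hy
  refine DifferentiableAt.congr_of_eventuallyEq ?_ h
  exact (LinearIsometryEquiv.differentiable _ _).comp _ (differentiableAt_dsCoord z)

theorem ds_pullback_diffAt [I.Boundaryless] [IsManifold I ∞ M] (p : M × Circle) :
    (Form.pullback (I' := I.prod (𝓡 1)) (Prod.snd : M × Circle → Circle) ds).DiffAt p := by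
  have : IsManifold (𝓡 1) ∞ Circle := IsManifold.of_le (n := ω) le_top
  refine DifferentiableAt.congr_of_eventuallyEq ?_ (eventuallyEq_inChart_pullback_snd ds p)
  have h1 : (extChartAt (I.prod (𝓡 1)) p p).2 = extChartAt (𝓡 1) p.2 p.2 := by
    rw [extChartAt_prod]
    rfl
  have h2 := ds_diffAt p.2
  rw [Form.DiffAt, ← h1] at h2
  exact ((ContinuousAlternatingMap.compContinuousLinearMapCLM
    (ContinuousLinearMap.snd ℝ E (EuclideanSpace ℝ (Fin 1)))).differentiableAt.comp _
      (h2.comp _ differentiableAt_snd))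

end Differentiability

section Warped

variable {M : Type*} [TopologicalSpace M] [ChartedSpace (EuclideanSpace ℝ (Fin 6)) M]

/-! ## The torsion of the warped structure -/

/-- Adapted frames of `M × S¹` at `p`, over an adapted frame of `M` and its rotation. -/
structure IsWarpedFrames (om : Form (𝓡 6) M 2) (ψp ψm : Form (𝓡 6) M 3) (c α β : ℝ)
    (p : M × Circle) (w₀ w : EuclideanSpace ℝ (Fin 6) ≃L[ℝ] (Fin 6 → ℝ))
    (u₀ u : TangentSpace ((𝓡 6).prod (𝓡 1)) p ≃L[ℝ] (Fin 7 → ℝ)) : Prop where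
  frame₀ : IsSU3Frame (V := EuclideanSpace ℝ (Fin 6)) (om p.1) (ψp p.1) (ψm p.1) w₀
  frame : IsSU3Frame (V := EuclideanSpace ℝ (Fin 6)) (om p.1) ((α • ψp - β • ψm) p.1)
    ((α • ψm + β • ψp) p.1) w
  lift₀ : IsLift u₀ w₀ (mfderiv ((𝓡 6).prod (𝓡 1)) (𝓡 6) (Prod.fst : M × Circle → M) p)
  lift : IsLift u w (mfderiv ((𝓡 6).prod (𝓡 1)) (𝓡 6) (Prod.fst : M × Circle → M) p)
  elemL_last : elemL u 1 [6] = c • ds.pullback (I' := (𝓡 6).prod (𝓡 1)) Prod.snd p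

variable {om : Form (𝓡 6) M 2} {ψp ψm : Form (𝓡 6) M 3}

theorem exists_isWarpedFrames (h : IsSU3Structure om ψp ψm) {c α β : ℝ} (hc : c ≠ 0)
    (hαβ : α ^ 2 + β ^ 2 = 1) (p : M × Circle) :
    ∃ w₀ w u₀ u, IsWarpedFrames om ψp ψm c α β p w₀ w u₀ u := by
  obtain ⟨w₀, hw₀⟩ := h.exists_frame p.1
  have hw := hw₀.rotate α β hαβ
  obtain ⟨u₀, hu₀, -⟩ := exists_lift w₀ (dsFunctional_injective p.2) hc
  obtain ⟨u, hu, hu6⟩ := exists_lift (w₀.trans (rotation α β hαβ)) (dsFunctional_injective p.2) hc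
  refine ⟨w₀, w₀.trans (rotation α β hαβ), u₀, u, hw₀, hw, ?_, ?_, ?_⟩
  · rw [mfderiv_fst]
    exact hu₀
  · rw [mfderiv_fst]
    exact hu
  · have h1 : (elemL u 1 [6] : (EuclideanSpace ℝ (Fin 6) × EuclideanSpace ℝ (Fin 1))
        [⋀^Fin 1]→L[ℝ] ℝ) = c • oneForm ((dsFunctional p.2).comp
          (ContinuousLinearMap.snd ℝ (EuclideanSpace ℝ (Fin 6)) (EuclideanSpace ℝ (Fin 1)))) := by
      rw [elemL_singleton, hu6]
      rfl
    refine Eq.trans h1 ?_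
    rw [Form.pullback, mfderiv_snd]
    rfl

variable {α β : ℝ} {f : M → ℝ} {p : M × Circle}
  {w₀ w : EuclideanSpace ℝ (Fin 6) ≃L[ℝ] (Fin 6 → ℝ)}
  {u₀ u : TangentSpace ((𝓡 6).prod (𝓡 1)) p ≃L[ℝ] (Fin 7 → ℝ)}

theorem IsWarpedFrames.warpedForm_eq (h : IsWarpedFrames om ψp ψm (f p.1) α β p w₀ w u₀ u) :
    warpedForm om ψp ψm f α β p = modelG2 u := by
  rw [modelG2_eq, ← h.lift.omega_comp h.frame, ← h.lift.psiPlus_comp h.frame, h.elemL_last,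
    wedge_smul_right, ← wedge_smul_left]
  rfl

/-- The star is computed in a frame at each point, but the result does not mention the frame, so ∗φ
is now an explicit form that can be differentiated. -/
theorem g2Star_warpedForm (h : IsSU3Structure om ψp ψm) (hf : ∀ x, f x ≠ 0)
    (hαβ : α ^ 2 + β ^ 2 = 1) :
    g2Star (warpedForm om ψp ψm f α β) (k := 3) (l := 4) rfl (warpedForm om ψp ψm f α β) =
      (1 / 2 : ℝ) • (om ⋏ om).pullback Prod.fst +
        (f ⊙ (α • ψm + β • ψp)).pullback Prod.fst ⋏ ds.pullback Prod.snd := by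
  funext p
  obtain ⟨w₀, w, u₀, u, hu⟩ := exists_isWarpedFrames h (hf p.1) hαβ p
  rw [g2Star, g2StarAt_eq_frameStar u ((isG2Frame_iff u _).2 hu.warpedForm_eq), hu.warpedForm_eq,
    frameStar_modelG2, modelG2Dual_eq, ← hu.lift.psiMinus_comp hu.frame, hu.elemL_last,
    wedge_smul_right, ← wedge_smul_left, ← wedge_modelOmega_self, ← hu.lift.omega_comp hu.frame]
  exact congrArg (fun a => (1 / 2 : ℝ) • a + _)
    (wedge_compContinuousLinearMap (om p.1) (om p.1) _).symm

end Warped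

/-! ### The exterior derivatives of φ and ∗φ -/

section WarpedDerivatives

variable {M : Type*} [TopologicalSpace M] [ChartedSpace (EuclideanSpace ℝ (Fin 6)) M]

theorem pullback_fst_apply {k : ℕ} (γ : Form (𝓡 6) M k) (p : M × Circle) :
    Form.pullback (I' := (𝓡 6).prod (𝓡 1)) (Prod.fst : M × Circle → M) γ p =
      (γ p.1).compContinuousLinearMap
        (mfderiv ((𝓡 6).prod (𝓡 1)) (𝓡 6) (Prod.fst : M × Circle → M) p) := rfl

variable [IsManifold (𝓡 6) ∞ M]

/-- The factor f is extracted so that it combines with ds to e⁷, leaving f⁻¹df as the only trace of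
the warping. -/
theorem d_mulFun_two_eq {om : Form (𝓡 6) M 2} {f : M → ℝ} {x : M} (hom : om.DiffAt x)
    (hf : MDifferentiableAt (𝓡 6) 𝓘(ℝ, ℝ) f x) (hf0 : f x ≠ 0) :
    (f ⊙ om).d x = f x • (om.d x + wedge (dLog f x) (om x) :
      TangentSpace (𝓡 6) x [⋀^Fin 3]→L[ℝ] ℝ) := by
  rw [Form.d_mulFun_two hom hf, smul_add, ← wedge_smul_left]
  have h : f x • dLog f x = dFun (𝓡 6) f x := by
    rw [dLog, Form.mulFun, smul_smul, mul_inv_cancel₀ hf0, one_smul]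
  rw [h]

theorem d_mulFun_three_eq {ψ : Form (𝓡 6) M 3} {f : M → ℝ} {x : M} (hψ : ψ.DiffAt x)
    (hf : MDifferentiableAt (𝓡 6) 𝓘(ℝ, ℝ) f x) (hf0 : f x ≠ 0) :
    (f ⊙ ψ).d x = f x • (ψ.d x + wedge (dLog f x) (ψ x) :
      TangentSpace (𝓡 6) x [⋀^Fin 4]→L[ℝ] ℝ) := by
  rw [Form.d_mulFun_three hψ hf, smul_add, ← wedge_smul_left]
  have h : f x • dLog f x = dFun (𝓡 6) f x := by
    rw [dLog, Form.mulFun, smul_smul, mul_inv_cancel₀ hf0, one_smul]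
  rw [h]

variable {om : Form (𝓡 6) M 2} {ψp ψm : Form (𝓡 6) M 3} {α β : ℝ} {f : M → ℝ} {p : M × Circle}
  {w₀ w : EuclideanSpace ℝ (Fin 6) ≃L[ℝ] (Fin 6 → ℝ)}
  {u₀ u : TangentSpace ((𝓡 6).prod (𝓡 1)) p ≃L[ℝ] (Fin 7 → ℝ)}

theorem d_warpedForm (h : IsSU3Structure om ψp ψm)
    (hf : MDifferentiableAt (𝓡 6) 𝓘(ℝ, ℝ) f p.1) (hf0 : f p.1 ≠ 0)
    (hu : IsWarpedFrames om ψp ψm (f p.1) α β p w₀ w u₀ u) :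
    (warpedForm om ψp ψm f α β).d p = wedge ((om.d p.1 + wedge (dLog f p.1) (om p.1) :
        TangentSpace (𝓡 6) p.1 [⋀^Fin 3]→L[ℝ] ℝ).compContinuousLinearMap
          (mfderiv ((𝓡 6).prod (𝓡 1)) (𝓡 6) (Prod.fst : M × Circle → M) p)) (elemL u 1 [6]) +
      (α • ψp.d p.1 - β • ψm.d p.1).compContinuousLinearMap
        (mfderiv ((𝓡 6).prod (𝓡 1)) (𝓡 6) (Prod.fst : M × Circle → M) p) := by
  have : IsManifold (𝓡 1) ∞ Circle := IsManifold.of_le (n := ω) le_top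
  have h1 : om.DiffAt p.1 := h.smooth_omega.differentiableAt_inChart p.1
  have h2 : ψp.DiffAt p.1 := h.smooth_psiPlus.differentiableAt_inChart p.1
  have h3 : ψm.DiffAt p.1 := h.smooth_psiMinus.differentiableAt_inChart p.1
  have h4 : (f ⊙ om).DiffAt p.1 := h1.mulFun hf
  have h5 : (α • ψp - β • ψm).DiffAt p.1 := (h2.smul α).sub (h3.smul β)
  have h6 := Form.d_sub (h2.smul α) (h3.smul β)
  rw [Form.d_smul, Form.d_smul] at h6
  have h7 : (Form.pullback (I' := (𝓡 6).prod (𝓡 1)) (Prod.fst : M × Circle → M)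
      (f ⊙ om)).DiffAt p := differentiableAt_inChart_pullback_fst h4
  have h8 : (Form.pullback (I' := (𝓡 6).prod (𝓡 1)) (Prod.fst : M × Circle → M)
      (α • ψp - β • ψm)).DiffAt p := differentiableAt_inChart_pullback_fst h5
  rw [warpedForm, Form.d_add (h7.wedge (ds_pullback_diffAt p)) h8,
    Form.d_pullback_wedge_ds h4, Form.d_pullback_fst h5, pullback_fst_apply, pullback_fst_apply, h6,
    d_mulFun_two_eq h1 hf hf0, hu.elemL_last, wedge_smul_right, ← wedge_smul_left]
  rfl

set_option maxRecDepth 10000 in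
theorem d_g2Star_warpedForm (h : IsSU3Structure om ψp ψm) (hαβ : α ^ 2 + β ^ 2 = 1)
    (hf : MDifferentiableAt (𝓡 6) 𝓘(ℝ, ℝ) f p.1) (hf0 : ∀ x, f x ≠ 0)
    (hu : IsWarpedFrames om ψp ψm (f p.1) α β p w₀ w u₀ u) :
    (g2Star (warpedForm om ψp ψm f α β) (k := 3) (l := 4) rfl (warpedForm om ψp ψm f α β)).d p =
      (wedge (om.d p.1) (om p.1) :
        TangentSpace (𝓡 6) p.1 [⋀^Fin 5]→L[ℝ] ℝ).compContinuousLinearMap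
          (mfderiv ((𝓡 6).prod (𝓡 1)) (𝓡 6) (Prod.fst : M × Circle → M) p) +
      wedge ((α • ψm.d p.1 + β • ψp.d p.1 + wedge (dLog f p.1) ((α • ψm + β • ψp) p.1) :
        TangentSpace (𝓡 6) p.1 [⋀^Fin 4]→L[ℝ] ℝ).compContinuousLinearMap
          (mfderiv ((𝓡 6).prod (𝓡 1)) (𝓡 6) (Prod.fst : M × Circle → M) p)) (elemL u 1 [6]) := by
  have : IsManifold (𝓡 1) ∞ Circle := IsManifold.of_le (n := ω) le_top
  have h1 : om.DiffAt p.1 := h.smooth_omega.differentiableAt_inChart p.1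
  have h2 : ψp.DiffAt p.1 := h.smooth_psiPlus.differentiableAt_inChart p.1
  have h3 : ψm.DiffAt p.1 := h.smooth_psiMinus.differentiableAt_inChart p.1
  have h4 : (α • ψm + β • ψp).DiffAt p.1 := (h3.smul α).add (h2.smul β)
  have h5 : (f ⊙ (α • ψm + β • ψp)).DiffAt p.1 := h4.mulFun hf
  have h6 := Form.d_add (h3.smul α) (h2.smul β)
  rw [Form.d_smul, Form.d_smul] at h6
  have h7 : (om ⋏ om).DiffAt p.1 := h1.wedge h1
  have h8 := Form.d_wedge_self w h1
  have h11 := Form.d_pullback_fst (J := 𝓡 1) (p := p) h7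
  have h9 : (Form.pullback (I' := (𝓡 6).prod (𝓡 1)) (Prod.fst : M × Circle → M)
      (om ⋏ om)).DiffAt p := differentiableAt_inChart_pullback_fst h7
  have h10 : (Form.pullback (I' := (𝓡 6).prod (𝓡 1)) (Prod.fst : M × Circle → M)
      (f ⊙ (α • ψm + β • ψp))).DiffAt p := differentiableAt_inChart_pullback_fst h5
  -- The factor 1/2 of ∗φ cancels the 2 in d(ω²) = 2dω∧ω.
  have h12 : (1 / 2 : ℝ) • (Form.pullback (I' := (𝓡 6).prod (𝓡 1)) (Prod.fst : M × Circle → M)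
      (om ⋏ om)).d p = (wedge (om.d p.1) (om p.1) :
        TangentSpace (𝓡 6) p.1 [⋀^Fin 5]→L[ℝ] ℝ).compContinuousLinearMap
          (mfderiv ((𝓡 6).prod (𝓡 1)) (𝓡 6) (Prod.fst : M × Circle → M) p) := by
    rw [h11, pullback_fst_apply, h8, smul_compContinuousLinearMap, smul_smul]
    norm_num
  rw [g2Star_warpedForm h hf0 hαβ, Form.d_add (h9.smul _) (h10.wedge (ds_pullback_diffAt p)),
    Form.d_pullback_wedge_ds h5, Form.d_smul, h12, pullback_fst_apply,
    d_mulFun_three_eq h4 hf (hf0 _), h6, hu.elemL_last, wedge_smul_right, ← wedge_smul_left]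
  rfl

end WarpedDerivatives

section FrameTau

variable {E : Type*} [NormedAddCommGroup E] [NormedSpace ℝ E] {H : Type*} [TopologicalSpace H]
  {I : ModelWithCorners ℝ E H} {N : Type*} [TopologicalSpace N] [ChartedSpace H N]
  {φ : Form I N 3} {p : N} {u : TangentSpace I p ≃L[ℝ] (Fin 7 → ℝ)}

/-! ## The torsion forms in an adapted frame -/

theorem g2Star_eq_frameStar (hφ : φ p = modelG2 u) {k l : ℕ} (h : k + l = 7) (β : Form I N k) :
    g2Star φ h β p = frameStar h u (β p) :=
  g2StarAt_eq_frameStar u ((isG2Frame_iff u _).2 hφ) h (β p)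

theorem g2Star_wedge_self (hφ : φ p = modelG2 u) {k l : ℕ} (h : k + 3 + l = 7) (β : Form I N k) :
    g2Star φ h (β ⋏ φ) p = frameStar h u (wedge (β p) (modelG2 u)) :=
  (g2Star_eq_frameStar hφ h (β ⋏ φ)).trans
    (congrArg (fun a => frameStar h u (wedge (β p) a)) hφ)

theorem tau0_eq_frameTau0 (hφ : φ p = modelG2 u) : τ₀ φ p = frameTau0 u (φ.d p) :=
  congrArg (fun a : TangentSpace I p [⋀^Fin 0]→L[ℝ] ℝ => (1 / 7 : ℝ) * a ![])
    (g2Star_wedge_self hφ (k := 4) (l := 0) rfl φ.d)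

theorem tau1_eq_frameTau1 (hφ : φ p = modelG2 u) : τ₁ φ p = frameTau1 u (φ.d p) :=
  congrArg (fun a : TangentSpace I p [⋀^Fin 1]→L[ℝ] ℝ => (-(1 / 12) : ℝ) • a)
    ((g2Star_wedge_self hφ (k := 3) (l := 1) rfl _).trans
      (congrArg (fun a => frameStar (k := 3 + 3) (l := 1) rfl u (wedge a (modelG2 u)))
        (g2Star_eq_frameStar hφ (k := 4) (l := 3) rfl φ.d)))

theorem tau2_eq_frameTau2 (hφ : φ p = modelG2 u) :
    τ₂ φ p = frameTau2 u (φ.d p) ((g2Star φ (k := 3) (l := 4) rfl φ).d p) := by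
  have h1 : g2Star φ (k := 3) (l := 4) rfl φ p = frameStar (k := 3) (l := 4) rfl u (modelG2 u) :=
    (g2Star_eq_frameStar hφ (k := 3) (l := 4) rfl φ).trans
      (congrArg (frameStar (k := 3) (l := 4) rfl u) hφ)
  have h2 : (τ₁ φ ⋏ g2Star φ (k := 3) (l := 4) rfl φ) p = wedge (frameTau1 u (φ.d p))
      (frameStar (k := 3) (l := 4) rfl u (modelG2 u)) :=
    congrArg₂ wedge (tau1_eq_frameTau1 hφ) h1
  have h3 := (g2Star_eq_frameStar hφ (k := 1 + 4) (l := 2) rfl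
    (τ₁ φ ⋏ g2Star φ (k := 3) (l := 4) rfl φ)).trans
    (congrArg (frameStar (k := 1 + 4) (l := 2) rfl u) h2)
  exact congrArg₂ (fun a b : TangentSpace I p [⋀^Fin 2]→L[ℝ] ℝ => -a + (4 : ℝ) • b)
    (g2Star_eq_frameStar hφ (k := 5) (l := 2) rfl (g2Star φ (k := 3) (l := 4) rfl φ).d) h3

theorem tau3_eq_frameTau3 (hφ : φ p = modelG2 u) : τ₃ φ p = frameTau3 u (φ.d p) := by
  have h1 : (τ₀ φ ⊙ φ) p = frameTau0 u (φ.d p) • modelG2 u :=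
    congrArg₂ (· • ·) (tau0_eq_frameTau0 hφ) hφ
  have h2 : g2Star φ (k := 1 + 3) (l := 3) rfl (τ₁ φ ⋏ φ) p =
      frameStar (k := 1 + 3) (l := 3) rfl u (wedge (frameTau1 u (φ.d p)) (modelG2 u)) :=
    (g2Star_wedge_self hφ (k := 1) (l := 3) rfl (τ₁ φ)).trans
      (congrArg (fun a => frameStar (k := 1 + 3) (l := 3) rfl u (wedge a (modelG2 u)))
        (tau1_eq_frameTau1 hφ))
  exact congrArg₂ (fun a b : TangentSpace I p [⋀^Fin 3]→L[ℝ] ℝ => a - (3 : ℝ) • b)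
    (congrArg₂ (fun a b : TangentSpace I p [⋀^Fin 3]→L[ℝ] ℝ => a - b)
      (g2Star_eq_frameStar hφ (k := 4) (l := 3) rfl φ.d) h1) h2

end FrameTau

/-! ### From a point to the whole manifold -/

section TorsionAtPoint

variable {M : Type*} [TopologicalSpace M] [ChartedSpace (EuclideanSpace ℝ (Fin 6)) M]
  {om : Form (𝓡 6) M 2} {ψp ψm : Form (𝓡 6) M 3} {T : SU3Forms M}

theorem IsSU3Torsion.isTorsionAt (hT : IsSU3Torsion om ψp ψm T) (x : M) :
    IsTorsionAt (om x) (ψp x) (ψm x) (T.π₀ x) (T.σ₀ x) (T.π₁ x) (T.ν₁ x) (T.π₂ x) (T.σ₂ x) (T.ν₃ x)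
      (om.d x) (ψp.d x) (ψm.d x) where
  pi2_psiPlus := congrFun hT.mem_pi2.wedge_psiPlus x
  pi2_omega_sq := congrFun hT.mem_pi2.wedge_omega_sq x
  sigma2_psiPlus := congrFun hT.mem_sigma2.wedge_psiPlus x
  sigma2_omega_sq := congrFun hT.mem_sigma2.wedge_omega_sq x
  nu3_omega := congrFun hT.mem_nu3.wedge_omega x
  nu3_psiPlus := congrFun hT.mem_nu3.wedge_psiPlus x
  nu3_psiMinus := congrFun hT.mem_nu3.wedge_psiMinus x
  d_omega := congrFun hT.d_omega x
  d_psiPlus := congrFun hT.d_psiPlus x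
  d_psiMinus := congrFun hT.d_psiMinus x

theorem compContinuousLinearMap_eq_zero_iff {V W : Type*} [AddCommGroup V] [Module ℝ V]
    [TopologicalSpace V] [AddCommGroup W] [Module ℝ W] [TopologicalSpace W] {k : ℕ}
    {A : V →L[ℝ] W} (hA : Function.Surjective A) {a : W [⋀^Fin k]→L[ℝ] ℝ} :
    a.compContinuousLinearMap A = 0 ↔ a = 0 := by
  refine ⟨fun h => ContinuousAlternatingMap.ext fun v => ?_, fun h => by rw [h]; rfl⟩
  choose g hg using hA
  have h1 := DFunLike.congr_fun h fun i => g (v i)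
  rw [ContinuousAlternatingMap.compContinuousLinearMap_apply] at h1
  exact (congrArg a (funext fun i => (hg (v i)).symm)).trans h1

theorem forall_fst_iff {X : Type*} {P : X → Prop} : (∀ p : X × Circle, P p.1) ↔ ∀ x, P x :=
  ⟨fun h x => h (x, 1), fun h p => h p.1⟩

variable [IsManifold (𝓡 6) ∞ M] {f : M → ℝ} {α β : ℝ}

set_option maxRecDepth 20000 in
-- The frame computation gives conditions on pullbacks to the product. They descend to the
-- six-manifold because the differential of the projection is surjective.
theorem torsion_warpedForm_at (h : IsSU3Structure om ψp ψm) (hT : IsSU3Torsion om ψp ψm T)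
    (hf : ContMDiff (𝓡 6) 𝓘(ℝ, ℝ) ∞ f) (hf0 : ∀ x, f x ≠ 0) (hαβ : α ^ 2 + β ^ 2 = 1)
    (p : M × Circle) :
    (τ₀ (warpedForm om ψp ψm f α β) p = 0 ↔ (α • T.π₀ - β • T.σ₀) p.1 = 0) ∧
    (τ₁ (warpedForm om ψp ψm f α β) p = 0 ↔
      (α • T.σ₀ + β • T.π₀) p.1 = 0 ∧ T.η₁ f p.1 = 0) ∧
    (τ₂ (warpedForm om ψp ψm f α β) p = 0 ↔
      T.η₂ f p.1 = 0 ∧ (α • T.σ₂ + β • T.π₂) p.1 = 0) ∧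
    (τ₃ (warpedForm om ψp ψm f α β) p = 0 ↔ (α • T.π₀ - β • T.σ₀) p.1 = 0 ∧ T.η₃ f p.1 = 0 ∧
      (α • T.π₂ - β • T.σ₂) p.1 = 0 ∧ T.ν₃ p.1 = 0) := by
  obtain ⟨w₀, w, u₀, u, hu⟩ := exists_isWarpedFrames h (hf0 p.1) hαβ p
  have hf1 : MDifferentiableAt (𝓡 6) 𝓘(ℝ, ℝ) f p.1 := hf.mdifferentiable (by simp) p.1
  have hφ := hu.warpedForm_eq
  have hW := (hT.isTorsionAt p.1).isWarpedTorsion hu.frame₀ hu.lift₀ hαβ hu.frame hu.lift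
    (dLog f p.1) (d_warpedForm h hf1 (hf0 p.1) hu) (d_g2Star_warpedForm h hαβ hf1 hf0 hu)
  have hA : Function.Surjective
      (mfderiv ((𝓡 6).prod (𝓡 1)) (𝓡 6) (Prod.fst : M × Circle → M) p) := by
    rw [mfderiv_fst]
    exact Prod.fst_surjective
  rw [tau0_eq_frameTau0 hφ, tau1_eq_frameTau1 hφ, tau2_eq_frameTau2 hφ, tau3_eq_frameTau3 hφ,
    hW.tau0_eq_zero_iff, hW.tau1_eq_zero_iff, hW.tau2_eq_zero_iff, hW.tau3_eq_zero_iff,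
    compContinuousLinearMap_eq_zero_iff hA, compContinuousLinearMap_eq_zero_iff hA,
    compContinuousLinearMap_eq_zero_iff hA]
  refine ⟨Iff.rfl, and_congr Iff.rfl ?_, and_congr ?_ Iff.rfl,
    and_congr Iff.rfl (and_congr ?_ Iff.rfl)⟩
  · exact compContinuousLinearMap_eq_zero_iff (a := T.η₁ f p.1) hA
  · exact compContinuousLinearMap_eq_zero_iff (a := T.η₂ f p.1) hA
  · exact compContinuousLinearMap_eq_zero_iff (a := T.η₃ f p.1) hA

theorem torsion_warpedForm (h : IsSU3Structure om ψp ψm) (hT : IsSU3Torsion om ψp ψm T)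
    (hf : ContMDiff (𝓡 6) 𝓘(ℝ, ℝ) ∞ f) (hf0 : ∀ x, f x ≠ 0) (hαβ : α ^ 2 + β ^ 2 = 1) :
    (τ₀ (warpedForm om ψp ψm f α β) = 0 ↔ α • T.π₀ - β • T.σ₀ = 0) ∧
    (τ₁ (warpedForm om ψp ψm f α β) = 0 ↔ α • T.σ₀ + β • T.π₀ = 0 ∧ T.η₁ f = 0) ∧
    (τ₂ (warpedForm om ψp ψm f α β) = 0 ↔ T.η₂ f = 0 ∧ α • T.σ₂ + β • T.π₂ = 0) ∧
    (τ₃ (warpedForm om ψp ψm f α β) = 0 ↔ α • T.π₀ - β • T.σ₀ = 0 ∧ T.η₃ f = 0 ∧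
      α • T.π₂ - β • T.σ₂ = 0 ∧ T.ν₃ = 0) := by
  have h1 := fun p => torsion_warpedForm_at h hT hf hf0 hαβ p
  simp only [funext_iff, ← forall_and, ← forall_fst_iff (X := M)]
  exact ⟨forall_congr' fun p => (h1 p).1, forall_congr' fun p => (h1 p).2.1,
    forall_congr' fun p => (h1 p).2.2.1, forall_congr' fun p => (h1 p).2.2.2⟩

end TorsionAtPoint

section Classes

/-! ## Torsion classes -/

/-! ### Elimination among the scalar combinations and the forms η₁, η₂, η₃ -/

section LinearAlgebra

variable {X : Type*} [AddCommGroup X] [Module ℝ X] {α β : ℝ} {x y z p v : X}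

/-- The matrix of the two combinations is a rotation; its transpose recovers x and y. -/
theorem rotation_eq_zero_iff (hαβ : α ^ 2 + β ^ 2 = 1) :
    α • x - β • y = 0 ∧ α • y + β • x = 0 ↔ x = 0 ∧ y = 0 := by
  refine ⟨fun ⟨h1, h2⟩ => ⟨?_, ?_⟩, fun ⟨h1, h2⟩ => by simp [h1, h2]⟩
  · have h3 : x = (α ^ 2 + β ^ 2) • x := by rw [hαβ, one_smul]
    rw [h3]
    linear_combination (norm := module) α • h1 + β • h2
  · have h3 : y = (α ^ 2 + β ^ 2) • y := by rw [hαβ, one_smul]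
    rw [h3]
    linear_combination (norm := module) α • h2 - β • h1

/-- The coefficient matrix of η₁, η₂, η₃ in z, p, v has determinant −6. The coefficients below are
rows of its inverse; the next three lemmas treat pairs of the ηᵢ. -/
theorem eta_one_two_three_iff : (z + p + v = 0 ∧ z + p - (2 : ℝ) • v = 0 ∧ z - p + v = 0) ↔
    v = 0 ∧ p = 0 ∧ z = 0 := by
  refine ⟨fun ⟨h1, h2, h3⟩ => ⟨?_, ?_, ?_⟩, fun ⟨h1, h2, h3⟩ => by simp [h1, h2, h3]⟩
  · linear_combination (norm := module) (1 / 3 : ℝ) • h1 - (1 / 3 : ℝ) • h2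
  · linear_combination (norm := module) (1 / 2 : ℝ) • h1 - (1 / 2 : ℝ) • h3
  · linear_combination (norm := module) (1 / 2 : ℝ) • h3 + (1 / 6 : ℝ) • h1 + (1 / 3 : ℝ) • h2

theorem eta_one_three_iff : (z + p + v = 0 ∧ z - p + v = 0) ↔ p = 0 ∧ z = -v := by
  refine ⟨fun ⟨h1, h3⟩ => ⟨?_, ?_⟩, fun ⟨h1, h2⟩ => by simp [h1, h2]⟩
  · linear_combination (norm := module) (1 / 2 : ℝ) • h1 - (1 / 2 : ℝ) • h3
  · linear_combination (norm := module) (1 / 2 : ℝ) • h1 + (1 / 2 : ℝ) • h3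

theorem eta_one_two_iff : (z + p + v = 0 ∧ z + p - (2 : ℝ) • v = 0) ↔ v = 0 ∧ z = -p := by
  refine ⟨fun ⟨h1, h2⟩ => ⟨?_, ?_⟩, fun ⟨h1, h2⟩ => by simp [h1, h2]⟩
  · linear_combination (norm := module) (1 / 3 : ℝ) • h1 - (1 / 3 : ℝ) • h2
  · linear_combination (norm := module) (2 / 3 : ℝ) • h1 + (1 / 3 : ℝ) • h2

theorem eta_two_three_iff : (z + p - (2 : ℝ) • v = 0 ∧ z - p + v = 0) ↔
    z = (1 / 2 : ℝ) • v ∧ z = (1 / 3 : ℝ) • p := by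
  refine ⟨fun ⟨h2, h3⟩ => ⟨?_, ?_⟩, fun ⟨h1, h2⟩ => ⟨?_, ?_⟩⟩
  · linear_combination (norm := module) (1 / 2 : ℝ) • h2 + (1 / 2 : ℝ) • h3
  · linear_combination (norm := module) (1 / 3 : ℝ) • h2 + (2 / 3 : ℝ) • h3
  · linear_combination (norm := module) (4 : ℝ) • h1 - (3 : ℝ) • h2
  · linear_combination (norm := module) (3 : ℝ) • h2 - (2 : ℝ) • h1

end LinearAlgebra

variable {M : Type*} [TopologicalSpace M] [ChartedSpace (EuclideanSpace ℝ (Fin 6)) M]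

theorem dLog_eq_zero_iff {f : M → ℝ} (hf0 : ∀ x, f x ≠ 0) : dLog f = 0 ↔ dFun (𝓡 6) f = 0 := by
  rw [funext_iff, funext_iff]
  exact forall_congr' fun x => smul_eq_zero_iff_right (inv_ne_zero (hf0 x))

theorem SU3Forms.inClass_iff (T : SU3Forms M) (S : Set ℕ) : T.InClass S ↔
    (1 ∉ S → T.π₀ = 0 ∧ T.σ₀ = 0) ∧ (2 ∉ S → T.π₂ = 0 ∧ T.σ₂ = 0) ∧ (3 ∉ S → T.ν₃ = 0) ∧
      (4 ∉ S → T.ν₁ = 0) ∧ (5 ∉ S → T.π₁ = 0) :=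
  ⟨fun h => ⟨h.w1, h.w2, h.w3, h.w4, h.w5⟩, fun ⟨h1, h2, h3, h4, h5⟩ => ⟨h1, h2, h3, h4, h5⟩⟩

theorem inG2Class_iff {E : Type*} [NormedAddCommGroup E] [NormedSpace ℝ E] {H : Type*}
    [TopologicalSpace H] {I : ModelWithCorners ℝ E H} {N : Type*} [TopologicalSpace N]
    [ChartedSpace H N] (φ : Form I N 3) (S : Set ℕ) : InG2Class φ S ↔
    (1 ∉ S → τ₀ φ = 0) ∧ (2 ∉ S → τ₂ φ = 0) ∧ (3 ∉ S → τ₃ φ = 0) ∧ (4 ∉ S → τ₁ φ = 0) :=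
  ⟨fun h => ⟨h.x1, h.x2, h.x3, h.x4⟩, fun ⟨h1, h2, h3, h4⟩ => ⟨h1, h2, h3, h4⟩⟩

end Classes

end

end WarpedG2

/-- In each class the vanishing τᵢ select equations among p₀, s₀, p₂, s₂, ν₃ and the ηᵢ. Where both
members of a pair (p₀,s₀) or (p₂,s₂) vanish, the original pair vanishes; where only one does, it
remains as the explicit linear condition. -/
theorem mainTheorem2 {M : Type*} [TopologicalSpace M] [ChartedSpace (EuclideanSpace ℝ (Fin 6)) M]
    [IsManifold (𝓡 6) ∞ M]
    (om : WarpedG2.Form (𝓡 6) M 2) (ψp ψm : WarpedG2.Form (𝓡 6) M 3)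
    (hSU3 : WarpedG2.IsSU3Structure om ψp ψm)
    (T : WarpedG2.SU3Forms M) (hT : WarpedG2.IsSU3Torsion om ψp ψm T)
    (f : M → ℝ) (hf : ContMDiff (𝓡 6) 𝓘(ℝ, ℝ) ∞ f) (hf0 : ∀ x, f x ≠ 0)
    (α β : ℝ) (hαβ : α ^ 2 + β ^ 2 = 1)
    (φ : WarpedG2.Form ((𝓡 6).prod (𝓡 1)) (M × Circle) 3)
    (hφ : φ = WarpedG2.warpedForm om ψp ψm f α β) :
    -- vanishing of the torsion forms
    (WarpedG2.τ₀ φ = 0 ↔ α • T.π₀ - β • T.σ₀ = 0) ∧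
    (WarpedG2.τ₁ φ = 0 ↔ α • T.σ₀ + β • T.π₀ = 0 ∧ T.η₁ f = 0) ∧
    (WarpedG2.τ₂ φ = 0 ↔ T.η₂ f = 0 ∧ α • T.σ₂ + β • T.π₂ = 0) ∧
    (WarpedG2.τ₃ φ = 0 ↔
      α • T.π₀ - β • T.σ₀ = 0 ∧ T.η₃ f = 0 ∧ α • T.π₂ - β • T.σ₂ = 0 ∧ T.ν₃ = 0) ∧
    -- parallel
    (WarpedG2.InG2Class φ ∅ ↔ T.InClass ∅ ∧ WarpedG2.dFun (𝓡 6) f = 0) ∧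
    -- closed
    (WarpedG2.InG2Class φ {2} ↔
      T.InClass {2, 4} ∧ α • T.π₂ - β • T.σ₂ = 0 ∧ WarpedG2.dLog f = -T.ν₁) ∧
    -- coclosed of pure type
    (WarpedG2.InG2Class φ {3} ↔
      T.InClass {2, 3, 5} ∧ α • T.σ₂ + β • T.π₂ = 0 ∧ WarpedG2.dLog f = -T.π₁) ∧
    -- locally conformal parallel
    (WarpedG2.InG2Class φ {4} ↔
      T.InClass {1, 4, 5} ∧ α • T.π₀ - β • T.σ₀ = 0 ∧
        WarpedG2.dLog f = (1 / 2 : ℝ) • T.ν₁ ∧ WarpedG2.dLog f = (1 / 3 : ℝ) • T.π₁) ∧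
    -- coclosed
    (WarpedG2.InG2Class φ {1, 3} ↔
      T.InClass {1, 2, 3, 5} ∧ α • T.σ₀ + β • T.π₀ = 0 ∧ α • T.σ₂ + β • T.π₂ = 0 ∧
        WarpedG2.dLog f = -T.π₁) := by
  subst hφ
  obtain ⟨h0, h1, h2, h3⟩ := WarpedG2.torsion_warpedForm hSU3 hT hf hf0 hαβ
  have r0 := WarpedG2.rotation_eq_zero_iff (x := T.π₀) (y := T.σ₀) hαβ
  have r2 := WarpedG2.rotation_eq_zero_iff (x := T.π₂) (y := T.σ₂) hαβ
  have e123 : (T.η₁ f = 0 ∧ T.η₂ f = 0 ∧ T.η₃ f = 0) ↔ T.ν₁ = 0 ∧ T.π₁ = 0 ∧ WarpedG2.dLog f = 0 :=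
    WarpedG2.eta_one_two_three_iff
  have e13 : (T.η₁ f = 0 ∧ T.η₃ f = 0) ↔ T.π₁ = 0 ∧ WarpedG2.dLog f = -T.ν₁ :=
    WarpedG2.eta_one_three_iff
  have e12 : (T.η₁ f = 0 ∧ T.η₂ f = 0) ↔ T.ν₁ = 0 ∧ WarpedG2.dLog f = -T.π₁ :=
    WarpedG2.eta_one_two_iff
  have e23 : (T.η₂ f = 0 ∧ T.η₃ f = 0) ↔ WarpedG2.dLog f = (1 / 2 : ℝ) • T.ν₁ ∧
      WarpedG2.dLog f = (1 / 3 : ℝ) • T.π₁ :=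
    WarpedG2.eta_two_three_iff
  rw [WarpedG2.dLog_eq_zero_iff hf0] at e123
  refine ⟨h0, h1, h2, h3, ?_, ?_, ?_, ?_, ?_⟩ <;>
    simp only [WarpedG2.inG2Class_iff, WarpedG2.SU3Forms.inClass_iff, h0, h1, h2, h3,
      Set.mem_empty_iff_false, Set.mem_insert_iff, Set.mem_singleton_iff, Nat.reduceEqDiff,
      not_true_eq_false, not_false_eq_true, or_true, or_false, or_self, forall_const,
      false_imp_iff, true_and, and_true]
  · constructor
    -- The equation p₀ = 0 occurs twice, in τ₀ = 0 and in τ₃ = 0.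
    · rintro ⟨a, ⟨c, d⟩, ⟨-, g, i, k⟩, b, e⟩
      obtain ⟨e4, e5, e6⟩ := e123.1 ⟨e, c, g⟩
      exact ⟨⟨r0.1 ⟨a, b⟩, r2.1 ⟨i, d⟩, k, e4, e5⟩, e6⟩
    · rintro ⟨⟨a, b, k, e4, e5⟩, e6⟩
      obtain ⟨a1, a2⟩ := r0.2 a
      obtain ⟨b1, b2⟩ := r2.2 b
      obtain ⟨c1, c2, c3⟩ := e123.2 ⟨e4, e5, e6⟩
      exact ⟨a1, ⟨c2, b2⟩, ⟨a1, c3, b1, k⟩, a2, c1⟩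
  · constructor
    · rintro ⟨a, ⟨-, g, i, k⟩, b, e⟩
      obtain ⟨e5, e6⟩ := e13.1 ⟨e, g⟩
      exact ⟨⟨r0.1 ⟨a, b⟩, k, e5⟩, i, e6⟩
    · rintro ⟨⟨a, k, e5⟩, i, e6⟩
      obtain ⟨a1, a2⟩ := r0.2 a
      obtain ⟨c1, c3⟩ := e13.2 ⟨e5, e6⟩
      exact ⟨a1, ⟨a1, c3, i, k⟩, a2, c1⟩
  · constructor
    · rintro ⟨a, ⟨c, d⟩, b, e⟩
      obtain ⟨e5, e6⟩ := e12.1 ⟨e, c⟩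
      exact ⟨⟨r0.1 ⟨a, b⟩, e5⟩, d, e6⟩
    · rintro ⟨⟨a, e5⟩, d, e6⟩
      obtain ⟨a1, a2⟩ := r0.2 a
      obtain ⟨c1, c2⟩ := e12.2 ⟨e5, e6⟩
      exact ⟨a1, ⟨c2, d⟩, a2, c1⟩
  · constructor
    -- Here τ₁ is free, so s₀ and η₁ are unconstrained: only p₀ = 0 remains of the first pair, and
    -- η₂ = η₃ = 0 fixes the ratios of f⁻¹df, ν₁ and π₁.
    · rintro ⟨a, ⟨c, d⟩, -, g, i, k⟩
      exact ⟨⟨r2.1 ⟨i, d⟩, k⟩, a, e23.1 ⟨c, g⟩⟩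
    · rintro ⟨⟨b, k⟩, a, e⟩
      obtain ⟨b1, b2⟩ := r2.2 b
      obtain ⟨c, g⟩ := e23.2 e
      exact ⟨a, ⟨c, b2⟩, a, g, b1, k⟩
  · constructor
    -- With τ₀ and τ₃ free, neither pair is complete; only s₀ = 0, s₂ = 0 and η₁ = η₂ = 0 are
    -- imposed.
    · rintro ⟨⟨c, d⟩, b, e⟩
      obtain ⟨e5, e6⟩ := e12.1 ⟨e, c⟩
      exact ⟨e5, b, d, e6⟩
    · rintro ⟨e5, b, d, e6⟩
      obtain ⟨c1, c2⟩ := e12.2 ⟨e5, e6⟩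
      exact ⟨⟨c2, d⟩, b, c1⟩
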